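/- Meromorphic and entire functions are meant on the whole plane $\mathbb{C}$. For meromorphic $h$ let $m(r,h)=\frac1{2\pi}\int_0^{2\pi}\log^+|h(re^{i\theta})|\,d\theta$, let $N(r,h)$ be the integrated counting function of the poles of $h$ (with multiplicity), and let $T(r,h)=m(r,h)+N(r,h)$ be the Nevanlinna characteristic. Write $\varphi(r)=S(r,h)$ if $\varphi(r)=o(T(r,h))$ as $r\to\infty$ outside a set of finite measure $E\subset(0,\infty)$, and let $\mathcal{S}_h$ be the set of meromorphic $y$ with $T(r,y)=S(r,h)$. For meromorphic $a$ and $h$ the deficiency is $$\delta(a,h)=\liminf_{r\to\infty}\frac{m\left(r,\frac1{h-a}\right)}{T(r,h)}.$$ A meromorphic function $w$ is hypertranscendental over a set $\mathcal{K}$ of meromorphic functions if $P(z,w,w',\dots,w^{(n)})\not\equiv0$ for every $n\ge0$ and every nontrivial polynomial $P(z,u_0,\dots,u_n)$ in $u_0,\dots,u_n$ with coefficients in $\mathcal{K}$ (nontrivial: some coefficient is $\not\equiv0$). Such a polynomial is distinguished if distinct monomials $u_0^{i_0}\cdots u_n^{i_n}$ occurring in it with nonzero coefficients have distinct total degrees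 $i_0+\dots+i_n$. **Theorem.** Let $f$ and $g$ be meromorphic functions, let $\mathcal{S}=\mathcal{S}_{f'/f}$, and suppose that $f$ is hypertranscendental over $\mathcal{S}$. 1. If $f$ is entire, $g$ is nonconstant, and $g-R$ has finitely many zeros for some nonconstant rational function $R$, then $g\circ f$ is hypertranscendental over $\mathcal{S}$. 2. If $f\in\mathcal{S}_g$ and $\delta(a,g)>0$ for some $a\in\mathcal{S}\setminus\{0\}$, then $fg$ is hypertranscendental over $\mathcal{S}$. 3. If there is an integer $k\ge0$ such that $T(r,f)=S(r,g^{(k)})$ and $\delta(a,g^{(k)})>0$ for some $a\in\mathcal{S}$, then $f+g$ is hypertranscendental over $\mathcal{S}$. 4. If $g$ is entire and there is an integer $k\ge0$ such that $T(r,f'/f)=S(r,g^{(k)})$ and $\delta(a,g^{(k)})>0$ for some $a\in\mathcal{S}$, then $fe^g$ is hypertranscendental over $\mathcal{S}$. 5. If $g$ is entire and $f\in\mathcal{S}_{e^g}$, then $P(z,fe^g,(fe^g)',\dots,(fe^g)^{(n)})\not\equiv0$ for every $n\ge0$ and every nontrivial distinguished polynomial $P(z,u_0,\dots,u_n)$ with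 coefficients in $\mathcal{S}$. -/

import Mathlib

open Filter Topology MeasureTheory Asymptotics

noncomputable section

/-! Meromorphic functions on the plane are represented by functions `ℂ → ℂ` satisfying Mathlib's
`Meromorphic`. Their values on a closed discrete set of points are irrelevant, so that two
of them are the same meromorphic function if and only if they agree on a codiscrete set. -/

/-- Equality of meromorphic functions: agreement off a closed discrete set. -/
def MerEq (u v : ℂ → ℂ) : Prop := u =ᶠ[codiscrete ℂ] v

/-- The Nevanlinna characteristic `T(r, f) = m(r, f) + N(r, f)`. -/
def nevT (f : ℂ → ℂ) : ℝ → ℝ := ValueDistribution.characteristic f ⊤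

/-- The proximity function `m(r, a, f) = m(r, 1 / (f - a))` of `f` to the function `a`. -/
def nevProx (a f : ℂ → ℂ) : ℝ → ℝ :=
  ValueDistribution.proximity (fun z => (f z - a z)⁻¹) ⊤

/-- `φ(r) = S(r, f)`, i.e. `φ(r) = o(T(r, f))` as `r → ∞` outside a set of finite measure. -/
def IsNevS (φ : ℝ → ℝ) (f : ℂ → ℂ) : Prop :=
  ∃ E : Set ℝ, E ⊆ Set.Ioi 0 ∧ volume E < ⊤ ∧ φ =o[atTop ⊓ 𝓟 Eᶜ] nevT f

/-- The set `𝒮_f` of the meromorphic functions `y` with `T(r, y) = S(r, f)`. -/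
def smallFunctions (f : ℂ → ℂ) : Set (ℂ → ℂ) :=
  {y | Meromorphic y ∧ IsNevS (nevT y) f}

/-- The deficiency `δ(a, f) = liminf m(r, a, f) / T(r, f)` as `r → ∞`. -/
def deficiency (a f : ℂ → ℂ) : EReal :=
  liminf (fun r : ℝ => ((nevProx a f r / nevT f r : ℝ) : EReal)) atTop

/-! A polynomial `P(z, u_0, u_1, …, u_n)` in `u_0, …, u_n` whose coefficients are functions of `z`
is an element of `MvPolynomial ℕ (ℂ → ℂ)`; only finitely many variables `u_j` occur in it. -/

/-- All coefficients of `P` belong to `K`. -/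
def HasCoeffsIn (K : Set (ℂ → ℂ)) (P : MvPolynomial ℕ (ℂ → ℂ)) : Prop :=
  ∀ I : ℕ →₀ ℕ, P.coeff I ∈ K

/-- `P` is nontrivial: some coefficient is not identically zero as a meromorphic function. -/
def IsNontrivialPoly (P : MvPolynomial ℕ (ℂ → ℂ)) : Prop :=
  ∃ I : ℕ →₀ ℕ, ¬ MerEq (P.coeff I) 0

/-- The function `P(z, f, f', …, f^(n))`. -/
def evalDiff (P : MvPolynomial ℕ (ℂ → ℂ)) (f : ℂ → ℂ) : ℂ → ℂ :=
  MvPolynomial.eval (fun j : ℕ => iteratedDeriv j f) P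

/-- `P` is distinguished: distinct multi-indices with nonzero coefficients have distinct total
degrees, i.e. each homogeneous part of `P` has at most one term. -/
def IsDistinguished (P : MvPolynomial ℕ (ℂ → ℂ)) : Prop :=
  ∀ I J : ℕ →₀ ℕ, ¬ MerEq (P.coeff I) 0 → ¬ MerEq (P.coeff J) 0 → I ≠ J → I.degree ≠ J.degree

/-- The meromorphic function `f` satisfies no nontrivial algebraic differential equation with
coefficients in `K`. -/
def Hypertranscendental (K : Set (ℂ → ℂ)) (f : ℂ → ℂ) : Prop :=
  Meromorphic f ∧
    ∀ P : MvPolynomial ℕ (ℂ → ℂ), HasCoeffsIn K P → IsNontrivialPoly P → ¬ MerEq (evalDiff P f) 0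

/-- The function `z ↦ R(z)` of a rational function `R`. -/
def ratFun (R : RatFunc ℂ) : ℂ → ℂ := fun z => R.eval (RingHom.id ℂ) z

/-- The zeros of a meromorphic function: the points where its order is positive (all points, for
the zero function). -/
def merZeros (h : ℂ → ℂ) : Set ℂ := {z | 0 < meromorphicOrderAt h z}

end

/-!
Meromorphic functions, identified when they agree off a closed discrete set, form a differential
field `Mer` of characteristic zero. For `T : ℝ → ℝ` with `log r = o(T(r))`, asymptotics being taken
as `r → ∞` outside sets of finite measure (`nevFilter`), the functions with `T(r, x) = o(T)` form
a subfield `Mer.smallField`, those with `T(r, x) = O(T)` a subfield `Mer.bigField`, and those with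
`m(r, x) = o(T)` a subring `Mer.proxRing`. The lemma on the logarithmic derivative
(`exists_eventually_proximity_logDeriv_le`) says that `x' / x` lies in `proxRing` for `x` in
`bigField`, whence both fields are stable under differentiation. It rests
on a factorization on discs, the Poisson integral and Borel's growth lemma.

In a differential field of characteristic zero, an element satisfies an algebraic differential
equation over `K` if and only if it is algebraic over a finitely generated extension of `K` whose
algebraic closure in the field is stable under differentiation (`IsDiffAlgebraic`). The elements
of this kind form a field that is closed under differentiation, integration and solution of
`y' = b y`, and that contains `x` as soon as it contains a nonconstant rational function of `x`.
Hypertranscendence of `f` over `𝒮` is the failure of `IsDiffAlgebraic` over the field of the small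
functions.

The first four assertions follow from one argument. Suppose that the new function `w` satisfies
a differential equation over `𝒮`. Then so does a function `v` derived from `w`, and `v` is compared
with a function `u` of the same shape that is small against `T` and built from `f`:
* for `w = g ∘ f`: `v = w` and `u = R ∘ f`, with `T = T(r, g ∘ f)`;
* for `w = f g`: `v = w` and `u = f a`, with `T = T(r, g)`;
* for `w = f + g`: `v = w^(k)` and `u = f^(k) + a`, with `T = T(r, g^(k))`;
* for `w = f e^g`: `v = (w' / w)^(k)` and `u = (f' / f)^(k) + a'`, with `T = T(r, g^(k))`.

The function `u` is not differentially algebraic, since otherwise `f` would be. Let `h` be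
`g ∘ f - R ∘ f`, `g - a` and twice `g^(k) - a`, respectively. The quotients `(v - u)^(j) / h` belong
to `proxRing`, and expansion of the equation of `v` around `u` in powers of `h` yields
`m(r, 1 / h) = o(T)` (`Mer.inv_mem_proxRing_of_aeval`, due to Mokhon'ko). In the last three cases
this contradicts the positive deficiency. In the first case `1 / h` has its poles among the zeros
of `q ∘ f` with a polynomial `q`, so that `T(r, h) = o(T)`, which is absurd; if `g` is rational,
then `f` is algebraic over `g ∘ f`, and there is nothing to compare. That `T(r, f)` is
`o(T(r, g ∘ f))` unless `g` is rational is `exists_mul_characteristic_le_comp`; applied to the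
identity in place of `f` it also gives `log r = o(T(r, g))`.

In the last assertion, `e = e^g` has neither zeros nor poles, and is therefore transcendental over
the small functions. The quotients `w^(j) / w` are small, so that a term of degree `d` of the
polynomial is a small multiple of `e ^ d`. In a distinguished polynomial the terms cannot cancel.
None of them vanishes: otherwise some derivative `w^(j)` would be a nonzero constant, so that `w`,
and with it `e`, would be small.
-/

/-! ### Asymptotics outside sets of finite measure -/

/-- The filter of the assertions that hold for all large `r` outside a set of finite measure. -/
noncomputable def nevFilter : Filter ℝ := atTop ⊓ (volume : Measure ℝ).cofinite

theorem nevFilter_le_atTop : nevFilter ≤ atTop := inf_le_left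

instance nevFilter_neBot : nevFilter.NeBot := by
  rw [nevFilter, inf_neBot_iff]
  intro A hA B hB
  obtain ⟨a, ha⟩ := mem_atTop_sets.1 hA
  rw [Measure.mem_cofinite] at hB
  by_contra h
  rw [Set.not_nonempty_iff_eq_empty] at h
  have : Set.Ici a ⊆ Bᶜ := fun x hx hxB => by
    have : x ∈ A ∩ B := ⟨ha x hx, hxB⟩
    simp [h] at this
  have := (measure_mono this).trans_lt hB
  simp at this

theorem eventually_nevFilter_of_measure_lt_top {E : Set ℝ} (hE : volume E < ⊤) {p : ℝ → Prop}
    (h : ∀ᶠ r in atTop, r ∉ E → p r) : ∀ᶠ r in nevFilter, p r := by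
  have h1 : ∀ᶠ r in nevFilter, r ∈ Eᶜ :=
    inf_le_right (a := atTop) (Measure.compl_mem_cofinite.2 hE)
  filter_upwards [h1, nevFilter_le_atTop h] with r hr hr' using hr' hr

theorem exists_of_eventually_nevFilter {p : ℝ → Prop} (h : ∀ᶠ r in nevFilter, p r) :
    ∃ E : Set ℝ, volume E < ⊤ ∧ MeasurableSet E ∧ ∃ a : ℝ, ∀ r ≥ a, r ∉ E → p r := by
  obtain ⟨A, hA, B, hB, hAB⟩ := mem_inf_iff_superset.1 h
  obtain ⟨a, ha⟩ := mem_atTop_sets.1 hA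
  refine ⟨toMeasurable volume Bᶜ, by rwa [measure_toMeasurable], measurableSet_toMeasurable _ _,
    a, fun r hr hrE => hAB ⟨ha r hr, ?_⟩⟩
  by_contra hB'
  exact hrE (subset_toMeasurable _ _ hB')

theorem tendsto_measure_inter_Ici {E : Set ℝ} (hE : volume E < ⊤) (hm : MeasurableSet E) :
    Tendsto (fun n : ℕ => volume (E ∩ Set.Ici (n : ℝ))) atTop (𝓝 0) := by
  have h := tendsto_measure_iInter_atTop (μ := volume) (s := fun n : ℕ => E ∩ Set.Ici (n : ℝ))
    (fun n => (hm.inter measurableSet_Ici).nullMeasurableSet)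
    (fun m n hmn => Set.inter_subset_inter_right _ (Set.Ici_subset_Ici.2 (by exact_mod_cast hmn)))
    ⟨0, ((measure_mono Set.inter_subset_left).trans_lt hE).ne⟩
  have h0 : (⋂ n : ℕ, E ∩ Set.Ici (n : ℝ)) = ∅ := by
    ext x
    simp only [Set.mem_iInter, Set.mem_inter_iff, Set.mem_Ici, Set.mem_empty_iff_false, iff_false,
      not_forall]
    obtain ⟨n, hn⟩ := exists_nat_gt x
    exact ⟨n, fun h => absurd h.2 (not_le.2 hn)⟩
  simpa [h0, Function.comp_def] using h

/-- A relation `φ = o(ψ)` along `nevFilter` allows a single exceptional set: the exceptional sets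
belonging to the constants `1 / (n + 1)` are cut off so far out that their measures are summable. -/
theorem exists_isLittleO_of_isLittleO_nevFilter {φ ψ : ℝ → ℝ} (h : φ =o[nevFilter] ψ) :
    ∃ E : Set ℝ, E ⊆ Set.Ioi 0 ∧ volume E < ⊤ ∧ φ =o[atTop ⊓ 𝓟 Eᶜ] ψ := by
  have h1 : ∀ n : ℕ, ∃ E : Set ℝ, volume E < ⊤ ∧ MeasurableSet E ∧ ∃ a : ℝ, ∀ r ≥ a, r ∉ E →
      ‖φ r‖ ≤ (1 / ((n : ℝ) + 1)) * ‖ψ r‖ := fun n =>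
    exists_of_eventually_nevFilter (h.bound (by positivity))
  choose E hE hm a ha using h1
  obtain ⟨ε, hε, hsum⟩ := ENNReal.exists_pos_sum_of_countable (ε := 1) one_ne_zero ℕ
  have h2 : ∀ n, ∃ N : ℕ, volume (E n ∩ Set.Ici (N : ℝ)) ≤ ε n ∧ a n ≤ N ∧ 1 ≤ N := by
    intro n
    have h3 := (tendsto_measure_inter_Ici (hE n) (hm n)).eventually_lt_const
      (ENNReal.coe_pos.2 (hε n))
    obtain ⟨N, hN⟩ := (h3.and ((tendsto_natCast_atTop_atTop.eventually_ge_atTop (a n)).and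
      (eventually_ge_atTop 1))).exists
    exact ⟨N, hN.1.le, hN.2⟩
  choose N hN using h2
  refine ⟨⋃ n, E n ∩ Set.Ici (N n : ℝ), ?_, ?_, ?_⟩
  · refine Set.iUnion_subset fun n x hx => ?_
    have : (1 : ℝ) ≤ N n := by exact_mod_cast (hN n).2.2
    exact lt_of_lt_of_le one_pos (this.trans hx.2)
  · refine (measure_iUnion_le _).trans_lt ?_
    refine ((ENNReal.tsum_le_tsum fun n => (hN n).1).trans_lt hsum).trans ENNReal.one_lt_top
  · rw [isLittleO_iff]
    intro c hc
    obtain ⟨n, hn⟩ := exists_nat_one_div_lt hc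
    rw [eventually_inf_principal]
    filter_upwards [eventually_ge_atTop (N n : ℝ)] with r hr hrE
    have h4 : r ∉ E n := fun hrn => hrE (Set.mem_iUnion.2 ⟨n, hrn, hr⟩)
    exact (ha n r ((hN n).2.1.trans hr) h4).trans
      (mul_le_mul_of_nonneg_right hn.le (norm_nonneg _))

theorem isNevS_iff_isLittleO {φ : ℝ → ℝ} {f : ℂ → ℂ} : IsNevS φ f ↔ φ =o[nevFilter] nevT f := by
  refine ⟨fun ⟨E, _, hE, h⟩ => h.mono ?_, exists_isLittleO_of_isLittleO_nevFilter⟩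
  exact inf_le_inf_left _ (le_principal_iff.2 (Measure.compl_mem_cofinite.2 hE))

/-- **Borel's growth lemma**. On the part of the exceptional set where `2 ^ k ≤ T < 2 ^ (k + 1)`,
two points are less than `2 ^ (-k)` apart, because `T` at least doubles over that distance. -/
theorem measure_borel_exceptional_lt_top {T : ℝ → ℝ} (hT : MonotoneOn T (Set.Ici 1))
    (h1 : ∀ r ≥ 1, 1 ≤ T r) :
    volume {r : ℝ | 1 ≤ r ∧ 2 * T r < T (r + 1 / T r)} < ⊤ := by
  set E := {r : ℝ | 1 ≤ r ∧ 2 * T r < T (r + 1 / T r)} with hE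
  have hsub : E ⊆ ⋃ k : ℕ, E ∩ {r | (2 : ℝ) ^ k ≤ T r ∧ T r < 2 ^ (k + 1)} := by
    intro r hr
    obtain ⟨k, hk⟩ := exists_nat_pow_near (h1 r hr.1) (one_lt_two : (1 : ℝ) < 2)
    exact Set.mem_iUnion.2 ⟨k, hr, hk⟩
  have hk : ∀ k : ℕ, volume (E ∩ {r | (2 : ℝ) ^ k ≤ T r ∧ T r < 2 ^ (k + 1)})
      ≤ (2⁻¹ : ENNReal) ^ k := by
    intro k
    refine (Real.volume_le_diam _).trans (Metric.ediam_le fun x hx y hy => ?_)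
    wlog hxy : x ≤ y generalizing x y
    · rw [edist_comm]; exact this y hy x hx (le_of_not_ge hxy)
    have hT0 : 0 < T x := one_pos.trans_le (h1 x hx.1.1)
    have h3 : y < x + 1 / T x := by
      by_contra h4
      have h5 := hT (show x + 1 / T x ∈ Set.Ici 1 from
        hx.1.1.trans (le_add_of_nonneg_right (by positivity))) hy.1.1 (not_lt.1 h4)
      have h6 := hx.1.2
      have h7 := hx.2.1
      have h8 := hy.2.2
      rw [pow_succ] at h8
      linarith
    have h4 : 1 / T x ≤ (2⁻¹ : ℝ) ^ k := by
      rw [one_div, inv_pow]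
      exact inv_anti₀ (by positivity) hx.2.1
    rw [edist_dist, Real.dist_eq, abs_sub_comm, abs_of_nonneg (by linarith)]
    refine (ENNReal.ofReal_le_ofReal (show y - x ≤ (2⁻¹ : ℝ) ^ k by linarith)).trans (le_of_eq ?_)
    rw [ENNReal.ofReal_pow (by norm_num), ENNReal.ofReal_inv_of_pos (by norm_num)]
    simp
  refine ((measure_mono hsub).trans (measure_iUnion_le _)).trans_lt
    ((ENNReal.tsum_le_tsum hk).trans_lt ?_)
  rw [ENNReal.tsum_geometric, ENNReal.one_sub_inv_two]
  simp

/-! ### Circle means and the Poisson integral -/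

theorem intervalIntegrable_abs_sin_rpow (a b : ℝ) :
    IntervalIntegrable (fun t => |Real.sin t| ^ (-(1 / 2) : ℝ)) volume a b := by
  have hper : Function.Periodic (fun t => |Real.sin t| ^ (-(1 / 2) : ℝ)) Real.pi := fun t => by
    simp [Real.sin_add_pi]
  have hmeas : Measurable (fun t => |Real.sin t| ^ (-(1 / 2) : ℝ)) := by fun_prop
  have h0 : IntervalIntegrable (fun t => |Real.sin t| ^ (-(1 / 2) : ℝ)) volume 0 (Real.pi / 2) := by
    have h1 : IntervalIntegrable (fun t : ℝ => (2 / Real.pi) ^ (-(1 / 2) : ℝ) * t ^ (-(1 / 2) : ℝ))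
        volume 0 (Real.pi / 2) :=
      (intervalIntegral.intervalIntegrable_rpow' (by norm_num)).const_mul _
    refine h1.mono_fun' hmeas.aestronglyMeasurable ?_
    rw [Set.uIoc_of_le (by positivity)]
    filter_upwards [ae_restrict_mem measurableSet_Ioc] with t ht
    have h2 := Real.mul_abs_le_abs_sin (x := t) (by rw [abs_of_pos ht.1]; exact ht.2)
    rw [abs_of_pos ht.1] at h2
    rw [Real.norm_of_nonneg (by positivity), ← Real.mul_rpow (by positivity) ht.1.le]
    have := ht.1
    exact Real.rpow_le_rpow_of_nonpos (by positivity) h2 (by norm_num)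
  have h1 : IntervalIntegrable (fun t => |Real.sin t| ^ (-(1 / 2) : ℝ)) volume
      (-(Real.pi / 2)) 0 := by
    have h2 := (IntervalIntegrable.iff_comp_neg (by simp)).1 h0
    simp only [Real.sin_neg, abs_neg, neg_zero] at h2
    exact h2.symm
  refine hper.intervalIntegrable Real.pi_ne_zero (t := -(Real.pi / 2)) ?_ a b
  have h3 : -(Real.pi / 2) + Real.pi = Real.pi / 2 := by ring
  rw [h3]
  exact h1.trans h0

/-- The distance of the point `r e^{iθ}` from the line through `0` and `u` is
`r |sin (θ - arg u)|`. -/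
theorem abs_sin_le_norm_circleMap_sub {r : ℝ} (hr : 1 ≤ r) (u : ℂ) (θ : ℝ) :
    |Real.sin (θ - u.arg)| ≤ ‖circleMap 0 r θ - u‖ := by
  have h1 : circleMap 0 r θ - u
      = Complex.exp (u.arg * Complex.I) * (r * Complex.exp ((θ - u.arg : ℝ) * Complex.I) - ‖u‖) := by
    have h2 : Complex.exp (θ * Complex.I)
        = Complex.exp (u.arg * Complex.I) * Complex.exp ((θ - u.arg : ℝ) * Complex.I) := by
      rw [← Complex.exp_add]; congr 1; push_cast; ring
    conv_lhs => rw [← Complex.norm_mul_exp_arg_mul_I u, circleMap, zero_add, h2]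
    ring
  rw [h1, norm_mul, Complex.norm_exp_ofReal_mul_I, one_mul]
  refine le_trans ?_ (Complex.abs_im_le_norm _)
  have h3 : ((r : ℂ) * Complex.exp ((θ - u.arg : ℝ) * Complex.I) - ‖u‖).im
      = r * Real.sin (θ - u.arg) := by
    rw [Complex.sub_im, Complex.im_ofReal_mul, Complex.exp_ofReal_mul_I_im, Complex.ofReal_im,
      sub_zero]
  rw [h3, abs_mul, abs_of_pos (show 0 < r by linarith)]
  exact le_mul_of_one_le_left (abs_nonneg _) hr

/-- The means of `‖z - u‖ ^ (-1 / 2)` over the circles of radius at least `1` are bounded,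
uniformly in `u`. -/
theorem exists_circleAverage_norm_sub_rpow_le : ∃ C : ℝ, 0 ≤ C ∧ ∀ r : ℝ, 1 ≤ r → ∀ u : ℂ,
    CircleIntegrable (fun z => ‖z - u‖ ^ (-(1 / 2) : ℝ)) 0 r ∧
      Real.circleAverage (fun z => ‖z - u‖ ^ (-(1 / 2) : ℝ)) 0 r ≤ C := by
  have hper : Function.Periodic (fun t => |Real.sin t| ^ (-(1 / 2) : ℝ)) (2 * Real.pi) := fun t => by
    simp [Real.sin_add_two_pi]
  refine ⟨(2 * Real.pi)⁻¹ * ∫ t in 0..2 * Real.pi, |Real.sin t| ^ (-(1 / 2) : ℝ),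
    mul_nonneg (by positivity)
      (intervalIntegral.integral_nonneg (by positivity) fun t _ => by positivity), ?_⟩
  intro r hr u
  have hI : IntervalIntegrable (fun t => |Real.sin (t - u.arg)| ^ (-(1 / 2) : ℝ)) volume
      0 (2 * Real.pi) := by
    have := (intervalIntegrable_abs_sin_rpow (0 - u.arg) (2 * Real.pi - u.arg)).comp_sub_right u.arg
    simpa using this
  have hae : ∀ᵐ t : ℝ, ‖circleMap 0 r t - u‖ ^ (-(1 / 2) : ℝ)
      ≤ |Real.sin (t - u.arg)| ^ (-(1 / 2) : ℝ) := by
    have hc : {t : ℝ | Real.sin (t - u.arg) = 0}.Countable := by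
      refine (Set.countable_range (fun n : ℤ => (n : ℝ) * Real.pi + u.arg)).mono ?_
      intro t ht
      obtain ⟨n, hn⟩ := Real.sin_eq_zero_iff.1 ht
      exact ⟨n, by simp [hn]⟩
    filter_upwards [hc.ae_notMem volume] with t ht
    exact Real.rpow_le_rpow_of_nonpos (abs_pos.2 ht) (abs_sin_le_norm_circleMap_sub hr u t)
      (by norm_num)
  have hJ : IntervalIntegrable (fun t => ‖circleMap 0 r t - u‖ ^ (-(1 / 2) : ℝ)) volume
      0 (2 * Real.pi) := by
    refine hI.mono_fun' ?_ ?_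
    · have : Measurable (fun t => ‖circleMap 0 r t - u‖ ^ (-(1 / 2) : ℝ)) := by
        have : Measurable (circleMap 0 r) := (continuous_circleMap 0 r).measurable
        fun_prop
      exact this.aestronglyMeasurable
    · filter_upwards [ae_restrict_of_ae hae] with t ht
      rwa [Real.norm_of_nonneg (by positivity)]
  refine ⟨hJ, ?_⟩
  rw [Real.circleAverage_def, smul_eq_mul]
  refine mul_le_mul_of_nonneg_left ?_ (by positivity)
  refine (intervalIntegral.integral_mono_ae (by positivity) hJ hI hae).trans (le_of_eq ?_)
  rw [intervalIntegral.integral_comp_sub_right (fun t => |Real.sin t| ^ (-(1 / 2) : ℝ)),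
    show 2 * Real.pi - u.arg = (0 - u.arg) + 2 * Real.pi by ring,
    hper.intervalIntegral_add_eq (0 - u.arg) 0, zero_add]

/-- For a holomorphic function without zeros, the derivative of the Poisson integral of `log ‖g‖`
bounds the logarithmic derivative. -/
theorem norm_logDeriv_le_of_ne_zero {g : ℂ → ℂ} {R : ℝ}
    (hg : AnalyticOnNhd ℂ g (Metric.closedBall 0 R))
    (h0 : ∀ u ∈ Metric.closedBall (0 : ℂ) R, g u ≠ 0)
    {z : ℂ} (hz : z ∈ Metric.ball (0 : ℂ) R) :
    ‖logDeriv g z‖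
      ≤ 2 * R / (R - ‖z‖) ^ 2 * Real.circleAverage (fun ζ => |Real.log ‖g ζ‖|) 0 R := by
  have hR : 0 < R := Metric.pos_of_mem_ball hz
  set v : ℂ → ℝ := fun ζ => Real.log ‖g ζ‖ with hv
  have hharm : InnerProductSpace.HarmonicOnNhd v (Metric.closedBall 0 R) := fun x hx =>
    (hg x hx).harmonicAt_log_norm (h0 x hx)
  have hvI : CircleIntegrable v 0 R :=
    (hharm.continuousOn.mono Metric.sphere_subset_closedBall).circleIntegrable hR.le
  have hvI' : CircleIntegrable (fun ζ => (v ζ : ℂ)) 0 R := by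
    have := Complex.ofRealCLM.continuous.comp_continuousOn
      (hharm.continuousOn.mono Metric.sphere_subset_closedBall)
    exact ContinuousOn.circleIntegrable hR.le this
  set W : ℂ → ℂ := fun w =>
    Real.circleAverage (fun ζ => herglotzRieszKernel 0 w ζ • (v ζ : ℂ)) 0 R with hW
  have hWd : ∀ w ∈ Metric.ball (0 : ℂ) R, HasDerivAt W
      (Real.circleAverage (fun ζ => (2 * ζ / (ζ - w) ^ 2) • (v ζ : ℂ)) 0 R) w := fun w hw =>
    hasDerivAt_circleAverage_herglotzRieszKernel_smul hvI' hw
  have hre : ∀ w ∈ Metric.ball (0 : ℂ) R, (W w).re = v w := fun w hw => by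
    rw [hW, re_circleAverage_herglotzRieszKernel_smul hvI hw,
      hharm.circleAverage_re_herglotzRieszKernel_smul hw]
  have hgb : ∀ w ∈ Metric.ball (0 : ℂ) R, DifferentiableAt ℂ g w := fun w hw =>
    (hg w (Metric.ball_subset_closedBall hw)).differentiableAt
  -- `g * exp (-W)` has modulus one, hence is constant on the disc.
  have hconst : Set.EqOn (fun w => g w * Complex.exp (-W w))
      (Function.const ℂ (g z * Complex.exp (-W z))) (Metric.ball 0 R) := by
    refine Complex.eqOn_of_isPreconnected_of_isMaxOn_norm (convex_ball 0 R).isPreconnected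
      Metric.isOpen_ball (fun w hw => ?_) hz ?_
    · exact ((hgb w hw).mul (hWd w hw).differentiableAt.neg.cexp).differentiableWithinAt
    · have h1 : ∀ w ∈ Metric.ball (0 : ℂ) R, ‖g w * Complex.exp (-W w)‖ = 1 := fun w hw => by
        rw [norm_mul, Complex.norm_exp, Complex.neg_re, hre w hw, Real.exp_neg, hv,
          Real.exp_log (norm_pos_iff.2 (h0 w (Metric.ball_subset_closedBall hw)))]
        exact mul_inv_cancel₀ (norm_ne_zero_iff.2 (h0 w (Metric.ball_subset_closedBall hw)))
      intro w hw
      simp only [Set.mem_ofPred_eq, Function.comp_apply, h1 w hw, h1 z hz, le_refl]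
  have hder : deriv g z = g z * deriv W z := by
    have h1 : HasDerivAt (fun w => g w * Complex.exp (-W w))
        (deriv g z * Complex.exp (-W z) + g z * (Complex.exp (-W z) * -deriv W z)) z :=
      (hgb z hz).hasDerivAt.mul (hWd z hz).differentiableAt.hasDerivAt.neg.cexp
    have h2 : HasDerivAt (fun w => g w * Complex.exp (-W w)) 0 z :=
      (hasDerivAt_const z (g z * Complex.exp (-W z))).congr_of_eventuallyEq
        (hconst.eventuallyEq_of_mem (Metric.isOpen_ball.mem_nhds hz))
    have h3 := h1.unique h2
    have h4 : Complex.exp (-W z) * (deriv g z - g z * deriv W z) = 0 := by rw [← h3]; ring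
    exact sub_eq_zero.1 ((mul_eq_zero.1 h4).resolve_left (Complex.exp_ne_zero _))
  have hlog : logDeriv g z = Real.circleAverage (fun ζ => (2 * ζ / (ζ - z) ^ 2) • (v ζ : ℂ)) 0 R := by
    rw [logDeriv_apply, hder, (hWd z hz).deriv, mul_div_cancel_left₀ _
      (h0 z (Metric.ball_subset_closedBall hz))]
  have hz' : ‖z‖ < R := by simpa using hz
  rw [hlog, Real.circleAverage_def, Real.circleAverage_def, norm_smul, smul_eq_mul,
    Real.norm_of_nonneg (by positivity), mul_left_comm]
  refine mul_le_mul_of_nonneg_left ?_ (by positivity)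
  rw [← intervalIntegral.integral_const_mul]
  refine intervalIntegral.norm_integral_le_of_norm_le (by positivity) (ae_of_all _ fun t _ => ?_)
    ((hvI.abs : CircleIntegrable (fun ζ => |v ζ|) 0 R).const_mul _)
  rw [norm_smul, Complex.norm_real, Real.norm_eq_abs]
  refine mul_le_mul_of_nonneg_right ?_ (abs_nonneg _)
  have h5 : ‖circleMap 0 R t‖ = R := by simp [abs_of_pos hR]
  rw [norm_div, norm_mul, norm_pow, h5, Complex.norm_ofNat]
  have h6 : R - ‖z‖ ≤ ‖circleMap 0 R t - z‖ := by
    have := norm_sub_norm_le (circleMap 0 R t) z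
    rwa [h5] at this
  have h7 : 0 < R - ‖z‖ := by linarith
  gcongr

theorem Real.circleAverage_mono_codiscreteWithin {c : ℂ} {R : ℝ} {f₁ f₂ : ℂ → ℝ} (hR : R ≠ 0)
    (hf₁ : CircleIntegrable f₁ c R) (hf₂ : CircleIntegrable f₂ c R)
    (h : f₁ ≤ᶠ[codiscreteWithin (Metric.sphere c |R|)] f₂) :
    Real.circleAverage f₁ c R ≤ Real.circleAverage f₂ c R := by
  rw [Real.circleAverage_def, Real.circleAverage_def, smul_eq_mul, smul_eq_mul]
  refine mul_le_mul_of_nonneg_left ?_ (by positivity)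
  refine intervalIntegral.integral_mono_ae_restrict (by positivity) hf₁ hf₂ ?_
  have h1 : ∀ᶠ t in codiscreteWithin (Set.Icc 0 (2 * Real.pi)),
      f₁ (circleMap c R t) ≤ f₂ (circleMap c R t) :=
    codiscreteWithin_mono (Set.subset_univ _) (circleMap_preimage_codiscrete hR h)
  exact ae_restrict_le_codiscreteWithin measurableSet_Icc h1

/-- Two functions that agree codiscretely within an open set have equal germs at all points of a
codiscrete subset. -/
theorem eventuallyEq_nhds_of_eventuallyEq_codiscreteWithin {f g : ℂ → ℂ} {U : Set ℂ} (hU : IsOpen U)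
    (h : f =ᶠ[codiscreteWithin U] g) : ∀ᶠ z in codiscreteWithin U, f =ᶠ[𝓝 z] g := by
  refine mem_codiscreteWithin_iff_forall_mem_nhdsNE.2 fun x hx => ?_
  have h1 := mem_codiscreteWithin_iff_forall_mem_nhdsNE.1 h x hx
  have h2 : ∀ᶠ y in 𝓝[≠] x, f y = g y := by
    filter_upwards [h1, mem_nhdsWithin_of_mem_nhds (hU.mem_nhds hx)] with y hy hyU
    exact hy.resolve_right (fun h => h hyU)
  filter_upwards [eventually_eventually_nhdsWithin.2 h2, self_mem_nhdsWithin] with y hy hyx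
  left
  rwa [isOpen_compl_singleton.nhdsWithin_eq hyx] at hy

/-- The counting function dominates the number of points times `log (R' / R)`. -/
theorem sum_mul_log_le_logCounting {E : Function.locallyFinsupp ℂ ℤ} (hE : 0 ≤ E) {R R' : ℝ}
    (hR : 1 ≤ R) (hRR : R < R') {s : Finset ℂ} (hs : ∀ u ∈ s, ‖u‖ ≤ R) :
    (∑ u ∈ s, (E u : ℝ)) * Real.log (R' / R)
      ≤ Function.locallyFinsuppWithin.logCounting E R' := by
  classical
  have hR' : 0 < R' := by linarith
  have hE' : ∀ z, (0 : ℝ) ≤ E z := fun z => by exact_mod_cast hE z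
  set F := Function.locallyFinsuppWithin.toClosedBall R' E with hF
  have hfin : (Function.support (fun z => (F z : ℝ) * Real.log (R' * ‖z‖⁻¹))).Finite := by
    refine (F.finiteSupport (isCompact_closedBall 0 |R'|)).subset fun z hz hz' => hz ?_
    simp [hz']
  have hball : ∀ u, ‖u‖ ≤ R' → F u = E u := fun u hu =>
    Function.locallyFinsuppWithin.toClosedBall_eval_within E (by simpa [abs_of_pos hR'] using hu)
  have hnn : ∀ z, 0 ≤ (F z : ℝ) * Real.log (R' * ‖z‖⁻¹) := by
    intro z
    by_cases hz : ‖z‖ ≤ R'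
    · by_cases hz0 : z = 0
      · simp [hz0]
      · have : 0 < ‖z‖ := norm_pos_iff.2 hz0
        refine mul_nonneg (by rw [hball z hz]; exact hE' z) (Real.log_nonneg ?_)
        rw [← div_eq_mul_inv, one_le_div this]; exact hz
    · have : F z = 0 := Function.locallyFinsuppWithin.apply_eq_zero_of_notMem _
        (by simpa [abs_of_pos hR'] using hz)
      simp [this]
  change _ ≤ ∑ᶠ z, (F z : ℝ) * Real.log (R' * ‖z‖⁻¹) + (E 0 : ℝ) * Real.log R'
  have h1 : ∑ u ∈ s, (F u : ℝ) * Real.log (R' * ‖u‖⁻¹)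
      ≤ ∑ᶠ z, (F z : ℝ) * Real.log (R' * ‖z‖⁻¹) := by
    rw [finsum_eq_sum_of_support_subset (s := s ∪ hfin.toFinset) _
      (fun z hz => by
        simp only [Finset.coe_union, Set.mem_union, Finset.mem_coe]
        exact Or.inr (hfin.mem_toFinset.2 hz))]
    exact Finset.sum_le_sum_of_subset_of_nonneg Finset.subset_union_left fun z _ _ => hnn z
  have hlog : Real.log (R' / R) ≤ Real.log R' :=
    Real.log_le_log (by positivity) (div_le_self hR'.le hR)
  have hlog0 : 0 ≤ Real.log (R' / R) := Real.log_nonneg (by rw [one_le_div (by linarith)]; exact hRR.le)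
  have h2 : ∀ u ∈ s, (E u : ℝ) * Real.log (R' / R)
      ≤ (F u : ℝ) * Real.log (R' * ‖u‖⁻¹) + (if u = 0 then (E 0 : ℝ) * Real.log R' else 0) := by
    intro u hu
    rw [hball u ((hs u hu).trans hRR.le)]
    split_ifs with h0
    · subst h0
      simp only [norm_zero, inv_zero, mul_zero, Real.log_zero, zero_add]
      exact mul_le_mul_of_nonneg_left hlog (hE' 0)
    · have : 0 < ‖u‖ := norm_pos_iff.2 h0
      rw [add_zero, ← div_eq_mul_inv]
      refine mul_le_mul_of_nonneg_left (Real.log_le_log (by positivity) ?_) (hE' u)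
      exact div_le_div_of_nonneg_left hR'.le this (hs u hu)
  rw [Finset.sum_mul]
  refine (Finset.sum_le_sum h2).trans ?_
  rw [Finset.sum_add_distrib]
  refine add_le_add h1 ?_
  rw [Finset.sum_ite_eq']
  split_ifs
  · exact le_rfl
  · exact mul_nonneg (hE' 0) (hlog0.trans hlog)

theorem circleAverage_abs_log_norm_sub_le {R : ℝ} (hR : 1 ≤ R) {u : ℂ} (hu : ‖u‖ ≤ R) :
    Real.circleAverage (fun z => |Real.log ‖z - u‖|) 0 R ≤ 2 * Real.log (2 * R) := by
  have hI : CircleIntegrable (fun z => Real.log ‖z - u‖) 0 R := circleIntegrable_log_norm_sub_const R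
  have hm : MeromorphicOn (fun z => z - u) (Metric.sphere 0 |R|) := fun z _ => by fun_prop
  have hI' : CircleIntegrable (fun z => Real.posLog ‖z - u‖) 0 R := hm.circleIntegrable_posLog_norm
  have h1 : (fun z : ℂ => |Real.log ‖z - u‖|)
      = (fun z => (2 : ℝ) * Real.posLog ‖z - u‖) - fun z => Real.log ‖z - u‖ := by
    ext z
    have := Real.half_mul_log_add_log_abs (x := ‖z - u‖)
    simp only [Pi.sub_apply]
    linarith
  have hI2 : CircleIntegrable (fun z => (2 : ℝ) * Real.posLog ‖z - u‖) 0 R := hI'.const_mul 2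
  rw [h1, Real.circleAverage_sub hI2 hI,
    circleAverage_log_norm_sub_const_of_mem_closedBall
      (by simpa [abs_of_pos (show 0 < R by linarith)] using hu)]
  have h2 : Real.circleAverage (fun z => (2 : ℝ) * Real.posLog ‖z - u‖) 0 R ≤ 2 * Real.log (2 * R) := by
    refine Real.circleAverage_mono_on_of_le_circle hI2 fun z hz => ?_
    have h3 : ‖z - u‖ ≤ 2 * R := by
      have hz' : ‖z‖ = R := by simpa [abs_of_pos (show 0 < R by linarith)] using hz
      linarith [norm_sub_le z u]
    have h4 := Real.posLog_le_posLog (norm_nonneg _) h3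
    rw [Real.posLog_eq_log (x := 2 * R) (by rw [abs_of_pos] <;> linarith)] at h4
    linarith
  have := Real.log_nonneg hR
  linarith

theorem abs_log_eq_posLog_add_posLog_inv (x : ℝ) :
    |Real.log x| = Real.posLog x + Real.posLog x⁻¹ := by
  have h1 := Real.half_mul_log_add_log_abs (x := x)
  have h2 := Real.half_mul_log_add_log_abs (x := x⁻¹)
  rw [Real.log_inv, abs_neg] at h2
  linarith

theorem circleAverage_abs_log_norm {h : ℂ → ℂ} (hh : Meromorphic h) (R : ℝ) :
    Real.circleAverage (fun z => |Real.log ‖h z‖|) 0 R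
      = ValueDistribution.proximity h ⊤ R + ValueDistribution.proximity h⁻¹ ⊤ R := by
  have h1 : (fun z => |Real.log ‖h z‖|)
      = (fun z => Real.posLog ‖h z‖) + fun z => Real.posLog ‖h⁻¹ z‖ := by
    ext z
    rw [Pi.add_apply, Pi.inv_apply, norm_inv, abs_log_eq_posLog_add_posLog_inv]
  rw [h1, Real.circleAverage_add hh.meromorphicOn.circleIntegrable_posLog_norm
    hh.inv.meromorphicOn.circleIntegrable_posLog_norm, ValueDistribution.proximity_top,
    ValueDistribution.proximity_top]

/-! ### The lemma on the logarithmic derivative -/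

/-- On a disc, a meromorphic function is a product of integer powers of linear factors and a
holomorphic function `g` without zeros; its logarithmic derivative is estimated term by term. The
numbers `d u` are the multiplicities of the zeros and poles, and `A` is the mean of `|log ‖g‖|`. -/
theorem exists_norm_logDeriv_le {h : ℂ → ℂ} (hh : Meromorphic h)
    (htop : ∀ z, meromorphicOrderAt h z ≠ ⊤) {R R' : ℝ} (hR : 1 ≤ R) (hRR : R < R') :
    ∃ (s : Finset ℂ) (d : ℂ → ℝ) (A : ℝ), (∀ u ∈ s, 1 ≤ d u) ∧ 0 ≤ A ∧
      (∑ u ∈ s, d u) * Real.log (R' / R)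
        ≤ ValueDistribution.logCounting h 0 R' + ValueDistribution.logCounting h ⊤ R' ∧
      A ≤ ValueDistribution.proximity h ⊤ R + ValueDistribution.proximity h⁻¹ ⊤ R
        + (∑ u ∈ s, d u) * (2 * Real.log (2 * R)) ∧
      ∀ᶠ z in codiscreteWithin (Metric.ball (0 : ℂ) R),
        ‖logDeriv h z‖ ≤ ∑ u ∈ s, d u * ‖z - u‖⁻¹ + 2 * R / (R - ‖z‖) ^ 2 * A := by
  classical
  have hR0 : 0 < R := by linarith
  set D := MeromorphicOn.divisor h (Metric.closedBall (0 : ℂ) R) with hD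
  have hDfin : D.support.Finite := D.finiteSupport (isCompact_closedBall 0 R)
  obtain ⟨g, hg, hg0, hEq⟩ := hh.meromorphicOn.extract_zeros_poles (U := Metric.closedBall (0 : ℂ) R)
    (fun u => htop u) hDfin
  have hg0' : ∀ u ∈ Metric.closedBall (0 : ℂ) R, g u ≠ 0 := fun u hu => hg0 ⟨u, hu⟩
  set s := hDfin.toFinset with hs
  have hsD : ∀ u ∈ s, D u ≠ 0 := fun u hu => by simpa [hs] using hu
  have hsR : ∀ u ∈ s, ‖u‖ ≤ R := fun u hu => by
    have := D.supportWithinDomain (hDfin.mem_toFinset.1 hu)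
    simpa using this
  refine ⟨s, fun u => |(D u : ℝ)|, Real.circleAverage (fun ζ => |Real.log ‖g ζ‖|) 0 R, ?_, ?_, ?_,
    ?_, ?_⟩
  · intro u hu
    have := Int.one_le_abs (hsD u hu)
    change (1 : ℝ) ≤ |(D u : ℝ)|
    exact_mod_cast this
  · exact Real.circleAverage_nonneg_of_nonneg fun z _ => abs_nonneg _
  · set D0 := MeromorphicOn.divisor h Set.univ with hD0
    have hval : ∀ u ∈ s, D u = D0 u := fun u hu => by
      rw [hD, hD0, MeromorphicOn.divisor_apply hh.meromorphicOn (by simpa using hsR u hu),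
        MeromorphicOn.divisor_apply hh.meromorphicOn (Set.mem_univ _)]
    have h1 := sum_mul_log_le_logCounting (E := D0⁺ + D0⁻)
      (add_nonneg (posPart_nonneg _) (negPart_nonneg _)) hR hRR hsR
    rw [ValueDistribution.logCounting_zero, ValueDistribution.logCounting_top, ← Pi.add_apply,
      ← map_add]
    refine le_trans (le_of_eq ?_) h1
    congr 1
    refine Finset.sum_congr rfl fun u hu => ?_
    change |(D u : ℝ)| = _
    rw [hval u hu, ← Int.cast_abs, Function.locallyFinsuppWithin.coe_add, Pi.add_apply,
      Function.locallyFinsuppWithin.posPart_apply, Function.locallyFinsuppWithin.negPart_apply,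
      posPart_add_negPart]
  · have hlog := MeromorphicOn.extract_zeros_poles_log hg0 hEq
    have hlog' := codiscreteWithin_mono (Metric.sphere_subset_closedBall) hlog
    have hIg : CircleIntegrable (fun z => |Real.log ‖g z‖|) 0 R :=
      ((hg.mono Metric.sphere_subset_closedBall).meromorphicOn.circleIntegrable_log_norm_of_nonneg
        hR0.le).abs
    have hIh : CircleIntegrable (fun z => |Real.log ‖h z‖|) 0 R :=
      (hh.meromorphicOn.circleIntegrable_log_norm).abs
    have hIu : ∀ u ∈ s, CircleIntegrable (fun z => |(D u : ℝ)| * |Real.log ‖z - u‖|) 0 R :=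
      fun u _ => ((circleIntegrable_log_norm_sub_const R).abs :
        CircleIntegrable (fun z => |Real.log ‖z - u‖|) 0 R).const_mul _
    have hIs : CircleIntegrable (∑ u ∈ s, fun z => |(D u : ℝ)| * |Real.log ‖z - u‖|) 0 R :=
      CircleIntegrable.sum s hIu
    have hle : Real.circleAverage (fun ζ => |Real.log ‖g ζ‖|) 0 R
        ≤ Real.circleAverage ((fun z => |Real.log ‖h z‖|)
          + ∑ u ∈ s, fun z => |(D u : ℝ)| * |Real.log ‖z - u‖|) 0 R := by
      refine Real.circleAverage_mono_codiscreteWithin hR0.ne' hIg (hIh.add hIs) ?_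
      rw [abs_of_pos hR0]
      filter_upwards [hlog'] with z hz
      have hsum : (∑ᶠ u, fun z : ℂ => (D u : ℝ) * Real.log ‖z - u‖) z
          = ∑ u ∈ s, (D u : ℝ) * Real.log ‖z - u‖ := by
        rw [finsum_eq_sum_of_support_subset (s := s), Finset.sum_apply]
        intro u hu
        rw [hs, hDfin.coe_toFinset]
        intro hu0
        exact hu (by ext; simp [hu0])
      have h2 : Real.log ‖h z‖ = ∑ u ∈ s, (D u : ℝ) * Real.log ‖z - u‖ + Real.log ‖g z‖ := by
        rw [← hsum]; exact hz
      have h3 : Real.log ‖g z‖ = Real.log ‖h z‖ - ∑ u ∈ s, (D u : ℝ) * Real.log ‖z - u‖ := by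
        linarith
      rw [h3, Pi.add_apply, Finset.sum_apply]
      refine (abs_sub _ _).trans (add_le_add le_rfl ?_)
      refine (Finset.abs_sum_le_sum_abs _ _).trans (Finset.sum_le_sum fun u _ => ?_)
      rw [abs_mul]
    refine hle.trans ?_
    rw [Real.circleAverage_add hIh hIs, circleAverage_abs_log_norm hh, Real.circleAverage_sum hIu,
      Finset.sum_mul]
    refine add_le_add le_rfl (Finset.sum_le_sum fun u hu => ?_)
    have h4 : (fun z => |(D u : ℝ)| * |Real.log ‖z - u‖|)
        = |(D u : ℝ)| • fun z => |Real.log ‖z - u‖| := by ext; simp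
    rw [h4, Real.circleAverage_smul, smul_eq_mul]
    exact mul_le_mul_of_nonneg_left (circleAverage_abs_log_norm_sub_le hR (hsR u hu)) (abs_nonneg _)
  · have hEqb := codiscreteWithin_mono Metric.ball_subset_closedBall hEq
    have hfin : ∀ᶠ z in codiscreteWithin (Metric.ball (0 : ℂ) R), z ∉ s := by
      have : ((s : Set ℂ)ᶜ) ∈ codiscreteWithin (Set.univ : Set ℂ) := by
        rw [← codiscrete]; exact s.finite_toSet.compl_mem_codiscrete
      exact codiscreteWithin_mono (Set.subset_univ _) this
    filter_upwards [eventuallyEq_nhds_of_eventuallyEq_codiscreteWithin Metric.isOpen_ball hEqb,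
      hfin, self_mem_codiscreteWithin _] with z hz hzs hzb
    have hprod : (∏ᶠ u, (fun x : ℂ => x - u) ^ D u) = ∏ u ∈ s, (fun x : ℂ => (x - u) ^ D u) := by
      rw [finprod_eq_prod_of_mulSupport_subset (s := s)]
      · rfl
      · rw [hs, hDfin.coe_toFinset, Function.FactorizedRational.mulSupport]
    have hne : ∀ u ∈ s, (z - u) ^ D u ≠ 0 := fun u hu =>
      zpow_ne_zero _ (sub_ne_zero.2 fun h => hzs (h ▸ hu))
    have hdiff : ∀ u ∈ s, DifferentiableAt ℂ (fun x : ℂ => (x - u) ^ D u) z := fun u hu =>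
      DifferentiableAt.zpow (by fun_prop) (Or.inl (sub_ne_zero.2 fun h => hzs (h ▸ hu)))
    have hzc := Metric.ball_subset_closedBall hzb
    have h1 : logDeriv h z = ∑ u ∈ s, (D u : ℂ) * (z - u)⁻¹ + logDeriv g z := by
      have h2 : h =ᶠ[𝓝 z] fun x => (∏ u ∈ s, (x - u) ^ D u) * g x := by
        refine hz.trans (Eventually.of_forall fun x => ?_)
        rw [hprod, Pi.smul_apply', Finset.prod_apply, smul_eq_mul]
      have h3 : logDeriv h z = logDeriv (fun x => (∏ u ∈ s, (x - u) ^ D u) * g x) z := by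
        rw [logDeriv_apply, logDeriv_apply, h2.deriv_eq, h2.self_of_nhds]
      rw [h3, logDeriv_mul z (Finset.prod_ne_zero_iff.2 hne) (hg0' z hzc)
        (DifferentiableAt.fun_finsetProd hdiff) (hg z hzc).differentiableAt,
        logDeriv_prod (f := fun u x => (x - u) ^ D u) hne hdiff]
      congr 1
      refine Finset.sum_congr rfl fun u hu => ?_
      rw [logDeriv_fun_zpow (by fun_prop), logDeriv_apply]
      simp [div_eq_mul_inv]
    rw [h1]
    refine (norm_add_le _ _).trans (add_le_add ?_ (norm_logDeriv_le_of_ne_zero hg hg0' hzb))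
    refine (norm_sum_le _ _).trans (Finset.sum_le_sum fun u _ => ?_)
    rw [norm_mul, norm_inv, Complex.norm_intCast]

theorem posLog_le_two_mul_log_one_add {x y : ℝ} (hx : 0 ≤ x) (hy : 0 ≤ y) (h : x ≤ (1 + y) ^ 2) :
    Real.posLog x ≤ 2 * Real.log (1 + y) := by
  refine (Real.posLog_le_posLog hx h).trans (le_of_eq ?_)
  rw [Real.posLog_pow, Real.posLog_eq_log (by rw [abs_of_nonneg] <;> linarith)]
  norm_num

/-- The mean of `log⁺` of the logarithmic derivative, estimated through square roots: they turn the
poles on the circle into integrable singularities, and `log` is concave. Here `n` counts the zeros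
and poles in the disc of radius `R`. -/
theorem exists_proximity_logDeriv_le : ∃ C : ℝ, 0 ≤ C ∧ ∀ h : ℂ → ℂ, Meromorphic h →
    (∀ z, meromorphicOrderAt h z ≠ ⊤) → ∀ r R R' : ℝ, 1 ≤ r → r < R → R < R' →
    ∃ n A : ℝ, 0 ≤ n ∧ 0 ≤ A ∧
      n * Real.log (R' / R)
        ≤ ValueDistribution.logCounting h 0 R' + ValueDistribution.logCounting h ⊤ R' ∧
      A ≤ ValueDistribution.proximity h ⊤ R + ValueDistribution.proximity h⁻¹ ⊤ R
        + n * (2 * Real.log (2 * R)) ∧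
      ValueDistribution.proximity (logDeriv h) ⊤ r
        ≤ 2 * Real.log (1 + (C * n + √(2 * R / (R - r) ^ 2 * A))) := by
  obtain ⟨C, hC, hCr⟩ := exists_circleAverage_norm_sub_rpow_le
  refine ⟨C, hC, fun h hh htop r R R' hr hrR hRR => ?_⟩
  obtain ⟨s, d, A, hd, hA, h1, h2, h3⟩ := exists_norm_logDeriv_le hh htop (hr.trans hrR.le) hRR
  have hd0 : ∀ u ∈ s, 0 ≤ d u := fun u hu => zero_le_one.trans (hd u hu)
  have hn : 0 ≤ ∑ u ∈ s, d u := Finset.sum_nonneg hd0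
  refine ⟨∑ u ∈ s, d u, A, hn, hA, h1, h2, ?_⟩
  set B := 2 * R / (R - r) ^ 2 * A with hB
  have hB0 : 0 ≤ B := mul_nonneg (div_nonneg (by linarith) (sq_nonneg _)) hA
  have hr0 : (0 : ℝ) < r := by linarith
  set Y : ℂ → ℝ := fun z => ∑ u ∈ s, d u * ‖z - u‖ ^ (-(1 / 2) : ℝ) + √B with hY
  have hYs : ∀ z, 0 ≤ ∑ u ∈ s, d u * ‖z - u‖ ^ (-(1 / 2) : ℝ) := fun z =>
    Finset.sum_nonneg fun u hu => mul_nonneg (hd0 u hu) (by positivity)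
  have hY0 : ∀ z, 0 ≤ Y z := fun z => add_nonneg (hYs z) (Real.sqrt_nonneg _)
  have hYsq : ∀ z, ∑ u ∈ s, d u * ‖z - u‖⁻¹ + B ≤ (1 + Y z) ^ 2 := by
    intro z
    have h4 : ∑ u ∈ s, d u * ‖z - u‖⁻¹ ≤ (∑ u ∈ s, d u * ‖z - u‖ ^ (-(1 / 2) : ℝ)) ^ 2 := by
      refine le_trans (Finset.sum_le_sum fun u hu => ?_)
        (Finset.sum_sq_le_sq_sum_of_nonneg fun u hu => mul_nonneg (hd0 u hu) (by positivity))
      have h5 : (‖z - u‖ ^ (-(1 / 2) : ℝ)) ^ 2 = ‖z - u‖⁻¹ := by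
        rw [← Real.rpow_natCast, ← Real.rpow_mul (norm_nonneg _)]
        norm_num
        rw [Real.rpow_neg_one]
      rw [mul_pow, h5]
      exact mul_le_mul_of_nonneg_right (by nlinarith [hd u hu]) (by positivity)
    have h6 := Real.sq_sqrt hB0
    have h7 := mul_nonneg (hYs z) (Real.sqrt_nonneg B)
    have h8 := hYs z
    have h9 := Real.sqrt_nonneg B
    simp only [hY]
    nlinarith
  set M : ℝ := 1 + (C * ∑ u ∈ s, d u + √B) with hM
  have hM0 : 0 < M := by positivity
  have hIu : ∀ u ∈ s, CircleIntegrable (fun z => d u * ‖z - u‖ ^ (-(1 / 2) : ℝ)) 0 r :=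
    fun u _ => (hCr r hr u).1.const_mul _
  have hIsum : CircleIntegrable (∑ u ∈ s, fun z => d u * ‖z - u‖ ^ (-(1 / 2) : ℝ)) 0 r :=
    CircleIntegrable.sum s hIu
  have hYeq : Y = (∑ u ∈ s, fun z => d u * ‖z - u‖ ^ (-(1 / 2) : ℝ)) + fun _ => √B := by
    ext z; simp [hY]
  have hIc : ∀ c : ℝ, CircleIntegrable (fun _ : ℂ => c) 0 r := fun c => circleIntegrable_const c 0 r
  have hIY : CircleIntegrable Y 0 r := by rw [hYeq]; exact hIsum.add (hIc _)
  have hYavg : Real.circleAverage Y 0 r ≤ C * ∑ u ∈ s, d u + √B := by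
    rw [hYeq, Real.circleAverage_add hIsum (hIc _), Real.circleAverage_const,
      Real.circleAverage_sum hIu, Finset.mul_sum]
    refine add_le_add (Finset.sum_le_sum fun u hu => ?_) le_rfl
    have h4 : (fun z => d u * ‖z - u‖ ^ (-(1 / 2) : ℝ))
        = d u • fun z : ℂ => ‖z - u‖ ^ (-(1 / 2) : ℝ) := by ext; simp
    rw [h4, Real.circleAverage_smul, smul_eq_mul, mul_comm]
    exact mul_le_mul_of_nonneg_right (hCr r hr u).2 (hd0 u hu)
  -- Jensen's inequality for `log`, through the tangent of `log` at the point `M`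
  have hpt : (fun z => Real.posLog ‖logDeriv h z‖) ≤ᶠ[codiscreteWithin (Metric.sphere 0 |r|)]
      ((2 * M⁻¹) • Y + fun _ => 2 * Real.log M + 2 * (M⁻¹ - 1)) := by
    have hsub : Metric.sphere (0 : ℂ) |r| ⊆ Metric.ball 0 R := fun z hz => by
      rw [abs_of_pos hr0, mem_sphere_zero_iff_norm] at hz
      rw [mem_ball_zero_iff, hz]; exact hrR
    filter_upwards [codiscreteWithin_mono hsub h3, self_mem_codiscreteWithin _] with z hz hzr
    rw [abs_of_pos hr0, mem_sphere_zero_iff_norm] at hzr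
    rw [hzr] at hz
    have h4 := posLog_le_two_mul_log_one_add (norm_nonneg _) (hY0 z) (hz.trans (hYsq z))
    have h5 : 0 < (1 + Y z) / M := div_pos (by linarith [hY0 z]) hM0
    have h6 := Real.log_le_sub_one_of_pos h5
    rw [Real.log_div (by linarith [hY0 z]) hM0.ne', div_eq_inv_mul] at h6
    simp only [Pi.add_apply, Pi.smul_apply, smul_eq_mul]
    linarith
  have hIr : CircleIntegrable ((2 * M⁻¹) • Y) 0 r := hIY.const_mul _
  rw [ValueDistribution.proximity_top]
  refine (Real.circleAverage_mono_codiscreteWithin hr0.ne'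
    hh.logDeriv.meromorphicOn.circleIntegrable_posLog_norm (hIr.add (hIc _)) hpt).trans ?_
  rw [Real.circleAverage_add hIr (hIc _), Real.circleAverage_const, Real.circleAverage_smul,
    smul_eq_mul]
  have h7 : 2 * M⁻¹ * Real.circleAverage Y 0 r ≤ 2 * M⁻¹ * (M - 1) :=
    mul_le_mul_of_nonneg_left (by rw [hM]; linarith) (by positivity)
  have h8 : M⁻¹ * M = 1 := inv_mul_cancel₀ hM0.ne'
  nlinarith

/-- The estimate for the logarithmic derivative at the radii `R = r + 1 / (2 t)` and
`R' = r + 1 / t`, for a bound `t` of the characteristic: `n` is at most of the order `r t ^ 2`, and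
the square root at most of the order `r ^ 3 t ^ 4`. -/
theorem two_mul_log_one_add_le {C c r t n A : ℝ} (hC : 0 ≤ C) (hc0 : 0 ≤ c) (hr : 1 ≤ r)
    (ht2 : 2 ≤ t) (hn : 0 ≤ n) (hA : 0 ≤ A)
    (h4 : n * Real.log ((r + 1 / t) / (r + 1 / t / 2)) ≤ (4 + c) * t)
    (h2 : A ≤ (4 + c) * t + n * (2 * Real.log (2 * (r + 1 / t / 2)))) :
    2 * Real.log (1 + (C * n + √(2 * (r + 1 / t / 2) / (r + 1 / t / 2 - r) ^ 2 * A)))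
      ≤ 2 * Real.log (2 + 4 * C * (4 + c) + 528 * (4 + c)) + 6 * Real.log r
        + 8 * Real.log t := by
  have hr0 : (0 : ℝ) < r := by linarith
  have ht0 : (0 : ℝ) < t := by linarith
  have hδ1 : 1 / t ≤ 1 := by rw [div_le_one ht0]; linarith
  have hδ0 : 0 < 1 / t := by positivity
  obtain ⟨R, hR⟩ : ∃ R, R = r + 1 / t / 2 := ⟨_, rfl⟩
  obtain ⟨R', hR'⟩ : ∃ R', R' = r + 1 / t := ⟨_, rfl⟩
  rw [← hR, ← hR'] at h4
  rw [← hR] at h2 ⊢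
  have hR0 : 0 < R := by linarith
  have hR'0 : 0 < R' := by linarith
  have hlog : 1 / (4 * t * r) ≤ Real.log (R' / R) := by
    have h5 : 1 - R / R' ≤ Real.log (R' / R) := by
      have h6 := Real.log_le_sub_one_of_pos (show 0 < R / R' by positivity)
      have h7 : Real.log (R' / R) = -Real.log (R / R') := by rw [← Real.log_inv, inv_div]
      linarith
    refine le_trans ?_ h5
    rw [le_sub_comm, div_le_iff₀ hR'0]
    have h6 : 1 / (4 * t * r) * R' ≤ 1 / t / 2 := by
      calc 1 / (4 * t * r) * R' ≤ 1 / (4 * t * r) * (2 * r) := by gcongr; linarith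
        _ = 1 / t / 2 := by field_simp; norm_num
    linarith
  have h5 : n ≤ 4 * (4 + c) * r * t ^ 2 := by
    have h6 : n * (1 / (4 * t * r)) ≤ (4 + c) * t :=
      (mul_le_mul_of_nonneg_left hlog hn).trans h4
    rw [mul_one_div, div_le_iff₀ (by positivity)] at h6
    linarith
  have hr2 : 1 ≤ r ^ 2 := one_le_pow₀ hr
  have ht1 : t ≤ t ^ 2 := le_self_pow₀ (by linarith) two_ne_zero
  have h6 : A ≤ 33 * (4 + c) * r ^ 2 * t ^ 2 := by
    have h7 : Real.log (2 * R) ≤ 4 * r := (Real.log_le_self (by linarith)).trans (by linarith)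
    have h8 : n * (2 * Real.log (2 * R)) ≤ n * (8 * r) :=
      mul_le_mul_of_nonneg_left (by linarith) hn
    have h9 : n * (8 * r) ≤ 4 * (4 + c) * r * t ^ 2 * (8 * r) :=
      mul_le_mul_of_nonneg_right h5 (by linarith)
    have h10 : (4 + c) * t ≤ (4 + c) * (r ^ 2 * t ^ 2) := by
      refine mul_le_mul_of_nonneg_left (ht1.trans ?_) (by linarith)
      exact le_mul_of_one_le_left (by positivity) hr2
    linarith
  have h7 : 2 * R / (R - r) ^ 2 * A ≤ 528 * (4 + c) * r ^ 3 * t ^ 4 := by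
    have h8 : R - r = 1 / t / 2 := by linarith
    have h9 : 2 * R / (R - r) ^ 2 = 8 * R * t ^ 2 := by rw [h8]; field_simp; norm_num
    rw [h9]
    calc 8 * R * t ^ 2 * A ≤ 8 * (2 * r) * t ^ 2 * (33 * (4 + c) * r ^ 2 * t ^ 2) := by
          gcongr; linarith
      _ = 528 * (4 + c) * r ^ 3 * t ^ 4 := by ring
  have hsq : √(2 * R / (R - r) ^ 2 * A) ≤ 1 + 528 * (4 + c) * r ^ 3 * t ^ 4 := by
    have h8 : 0 ≤ 528 * (4 + c) * r ^ 3 * t ^ 4 := by positivity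
    refine Real.sqrt_le_iff.2 ⟨by linarith, h7.trans ?_⟩
    exact (le_add_of_nonneg_left zero_le_one).trans (le_self_pow₀ (by linarith) two_ne_zero)
  have hr3 : 1 ≤ r ^ 3 := one_le_pow₀ hr
  have ht4 : 1 ≤ t ^ 4 := one_le_pow₀ (by linarith)
  have h8 : 1 + (C * n + √(2 * R / (R - r) ^ 2 * A))
      ≤ (2 + 4 * C * (4 + c) + 528 * (4 + c)) * (r ^ 3 * t ^ 4) := by
    have h9 : C * n ≤ 4 * C * (4 + c) * (r ^ 3 * t ^ 4) := by
      calc C * n ≤ C * (4 * (4 + c) * r * t ^ 2) := mul_le_mul_of_nonneg_left h5 hC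
        _ = 4 * C * (4 + c) * (r ^ 1 * t ^ 2) := by ring
        _ ≤ 4 * C * (4 + c) * (r ^ 3 * t ^ 4) := by
          have : 1 ≤ t := by linarith
          gcongr <;> norm_num
    have h10 : 1 ≤ r ^ 3 * t ^ 4 := one_le_mul_of_one_le_of_one_le hr3 ht4
    linarith
  have h9 := Real.log_le_log (by positivity) h8
  rw [Real.log_mul (by positivity) (by positivity), Real.log_mul (by positivity) (by positivity),
    Real.log_pow, Real.log_pow] at h9
  push_cast at h9
  linarith

/-- **Lemma on the logarithmic derivative**. The estimate on a disc is applied with the radii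
`r + 1 / (2 T)` and `r + 1 / T`, at which `T` is at most doubled by Borel's lemma. -/
theorem exists_eventually_proximity_logDeriv_le {h : ℂ → ℂ} (hh : Meromorphic h)
    (htop : ∀ z, meromorphicOrderAt h z ≠ ⊤) : ∃ K : ℝ, ∀ᶠ r in nevFilter,
      ValueDistribution.proximity (logDeriv h) ⊤ r
        ≤ K + 6 * Real.log r + 8 * Real.log (ValueDistribution.characteristic h ⊤ r + 2) := by
  obtain ⟨C, hC, hmain⟩ := exists_proximity_logDeriv_le
  obtain ⟨c, hc⟩ : ∃ c, c = max |Real.log ‖h 0‖| |Real.log ‖meromorphicTrailingCoeffAt h 0‖| :=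
    ⟨_, rfl⟩
  have hc0 : 0 ≤ c := hc ▸ le_max_of_le_left (abs_nonneg _)
  have hTmono : MonotoneOn (fun r => ValueDistribution.characteristic h ⊤ r + 2) (Set.Ici 1) :=
    fun x hx y hy hxy => add_le_add ((ValueDistribution.characteristic_monotoneOn hh)
      (Set.mem_Ioi.2 (zero_lt_one.trans_le (Set.mem_Ici.1 hx)))
      (Set.mem_Ioi.2 (zero_lt_one.trans_le (Set.mem_Ici.1 hy))) hxy) le_rfl
  have hT2 : ∀ r ≥ 1, 2 ≤ ValueDistribution.characteristic h ⊤ r + 2 := fun r hr => by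
    have := ValueDistribution.characteristic_nonneg (f := h) (a := ⊤) hr
    linarith
  refine ⟨2 * Real.log (2 + 4 * C * (4 + c) + 528 * (4 + c)),
    eventually_nevFilter_of_measure_lt_top
      (measure_borel_exceptional_lt_top hTmono fun r hr => one_le_two.trans (hT2 r hr)) ?_⟩
  filter_upwards [eventually_ge_atTop 1] with r hr hrE
  obtain ⟨t, ht⟩ : ∃ t, t = ValueDistribution.characteristic h ⊤ r + 2 := ⟨_, rfl⟩
  have ht2 : 2 ≤ t := ht ▸ hT2 r hr
  have hδ : ValueDistribution.characteristic h ⊤ (r + 1 / t) + 2 ≤ 2 * t := by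
    by_contra hcon
    refine hrE ⟨hr, ?_⟩
    rw [ht] at hcon
    exact not_le.1 hcon
  have hδ0 : 0 < 1 / t := by positivity
  have hR1 : 1 ≤ r + 1 / t / 2 := by linarith
  have hR'1 : 1 ≤ r + 1 / t := by linarith
  obtain ⟨n, A, hn, hA, h1, h2, h3⟩ := hmain h hh htop r (r + 1 / t / 2) (r + 1 / t) hr
    (by linarith) (by linarith)
  have hTR := hTmono hR1 hR'1 (by linarith)
  have hinv : ∀ ρ, ValueDistribution.characteristic h⁻¹ ⊤ ρ
      ≤ ValueDistribution.characteristic h ⊤ ρ + c := fun ρ => by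
    have := (abs_le.1 (ValueDistribution.characteristic_sub_characteristic_inv_le (R := ρ) hh)).1
    linarith
  have hp : ∀ (w : ℂ → ℂ) ρ, 1 ≤ ρ → ValueDistribution.proximity w ⊤ ρ
      ≤ ValueDistribution.characteristic w ⊤ ρ := fun w ρ hρ =>
    le_add_of_nonneg_right (ValueDistribution.logCounting_nonneg hρ)
  have hl : ∀ (w : ℂ → ℂ) ρ, ValueDistribution.logCounting w ⊤ ρ
      ≤ ValueDistribution.characteristic w ⊤ ρ := fun w ρ =>
    le_add_of_nonneg_left (ValueDistribution.proximity_nonneg ρ)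
  have hct : c ≤ c * t := le_mul_of_one_le_right hc0 (by linarith)
  simp only at hTR
  refine h3.trans (ht ▸ two_mul_log_one_add_le hC hc0 hr ht2 hn hA ?_ ?_)
  · rw [← ValueDistribution.logCounting_inv] at h1
    linarith [hinv (r + 1 / t), hl h (r + 1 / t), hl h⁻¹ (r + 1 / t)]
  · linarith [hinv (r + 1 / t / 2), hp h _ hR1, hp h⁻¹ _ hR1]

/-! ### Comparison of characteristics and removal of poles -/

theorem logCounting_top_le_nsmul_of_divisor {u v : ℂ → ℂ} (n : ℕ)
    (h : ∀ z, (MeromorphicOn.divisor u Set.univ z)⁻ ≤ n * (MeromorphicOn.divisor v Set.univ z)⁻)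
    {r : ℝ} (hr : 1 ≤ r) :
    ValueDistribution.logCounting u ⊤ r ≤ n * ValueDistribution.logCounting v ⊤ r := by
  rw [ValueDistribution.logCounting_top, ValueDistribution.logCounting_top, ← nsmul_eq_mul,
    ← Pi.smul_apply, ← map_nsmul]
  refine Function.locallyFinsuppWithin.logCounting_le (fun z => ?_) hr
  simpa using h z

theorem eventually_nhdsNE_of_codiscrete {p : ℂ → Prop} (h : ∀ᶠ w in codiscrete ℂ, p w) (z : ℂ) :
    ∀ᶠ w in 𝓝[≠] z, p w := by
  have := mem_codiscreteWithin_iff_forall_mem_nhdsNE.1 h z (Set.mem_univ z)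
  rwa [Set.compl_univ, Set.union_empty] at this

/-- A meromorphic function that is dominated by a multiple of `max 1 ‖v‖` has at each of its poles
at most the multiplicity of `v`. -/
theorem meromorphicOrderAt_le_of_norm_le {u v : ℂ → ℂ} {z : ℂ} {C : ℝ} (hu : MeromorphicAt u z)
    (hv : MeromorphicAt v z) (h : ∀ᶠ w in 𝓝[≠] z, ‖u w‖ ≤ C * max 1 ‖v w‖)
    (hneg : meromorphicOrderAt u z < 0) : meromorphicOrderAt v z ≤ meromorphicOrderAt u z := by
  have hu' := tendsto_norm_atTop_iff_cobounded.2 (tendsto_cobounded_of_meromorphicOrderAt_neg hneg)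
  have h1 : ∀ᶠ w in 𝓝[≠] z, ‖u w‖ ≤ C * ‖v w‖ := by
    filter_upwards [h, hu'.eventually_gt_atTop (max C 0)] with w h2 h3
    have hC : 0 < C := by
      by_contra hC
      have : C * max 1 ‖v w‖ ≤ 0 :=
        mul_nonpos_of_nonpos_of_nonneg (not_lt.1 hC) (le_max_of_le_left zero_le_one)
      linarith [le_max_right C 0]
    rcases le_total ‖v w‖ 1 with h4 | h4
    · rw [max_eq_left h4] at h2; linarith [le_max_left C 0]
    · rwa [max_eq_right h4] at h2
  -- `u / v` is bounded near `z`, hence has no pole there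
  have hq : ¬ meromorphicOrderAt (u / v) z < 0 := by
    intro hlt
    have h2 := (tendsto_norm_atTop_iff_cobounded.2
      (tendsto_cobounded_of_meromorphicOrderAt_neg hlt)).eventually_gt_atTop (max C 0)
    obtain ⟨w, hw1, hw2⟩ := (h1.and h2).exists
    rw [Pi.div_apply, norm_div] at hw2
    rcases eq_or_ne ‖v w‖ 0 with h0 | h0
    · rw [h0, div_zero] at hw2; linarith [le_max_right C 0]
    · rw [lt_div_iff₀ (lt_of_le_of_ne (norm_nonneg _) h0.symm)] at hw2
      have := mul_le_mul_of_nonneg_right (le_max_left C 0) (norm_nonneg (v w))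
      linarith
  rw [meromorphicOrderAt_div hu hv, not_lt] at hq
  have hv0 : meromorphicOrderAt v z ≠ ⊤ := by
    intro h0
    rw [meromorphicOrderAt_eq_top_iff] at h0
    obtain ⟨w, hw1, hw2, hw3⟩ := (h1.and (h0.and (hu'.eventually_gt_atTop 0))).exists
    rw [hw2, norm_zero, mul_zero] at hw1
    linarith
  generalize meromorphicOrderAt v z = a at *
  generalize meromorphicOrderAt u z = b at *
  lift a to ℤ using hv0
  lift b to ℤ using hneg.ne_top
  norm_cast at *
  omega

/-- Functions of comparable size have comparable characteristics. -/
theorem characteristic_le_of_norm_le {u v : ℂ → ℂ} {C : ℝ} (hC : 1 ≤ C) (hu : Meromorphic u)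
    (hv : Meromorphic v) (h : ∀ᶠ w in codiscrete ℂ, ‖u w‖ ≤ C * max 1 ‖v w‖) {r : ℝ} (hr : 1 ≤ r) :
    ValueDistribution.characteristic u ⊤ r
      ≤ ValueDistribution.characteristic v ⊤ r + Real.log C := by
  have hN : ValueDistribution.logCounting u ⊤ r ≤ ValueDistribution.logCounting v ⊤ r := by
    have := logCounting_top_le_nsmul_of_divisor (u := u) (v := v) 1 (fun z => ?_) hr
    · simpa using this
    rw [MeromorphicOn.divisor_apply hu.meromorphicOn (Set.mem_univ z),
      MeromorphicOn.divisor_apply hv.meromorphicOn (Set.mem_univ z), Nat.cast_one, one_mul]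
    rcases le_or_gt 0 (meromorphicOrderAt u z) with h0 | h0
    · rw [negPart_eq_zero.2 (by simpa using h0)]
      exact negPart_nonneg _
    · have h1 := meromorphicOrderAt_le_of_norm_le (hu z) (hv z)
        (eventually_nhdsNE_of_codiscrete h z) h0
      refine negPart_anti ?_
      exact WithTop.untop₀_le_untop₀ h0.ne_top h1
  have hm : ValueDistribution.proximity u ⊤ r
      ≤ ValueDistribution.proximity v ⊤ r + Real.log C := by
    rw [ValueDistribution.proximity_top, ValueDistribution.proximity_top,
      ← Real.circleAverage_const (Real.log C) (0 : ℂ) r, ← Real.circleAverage_add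
        hv.meromorphicOn.circleIntegrable_posLog_norm (circleIntegrable_const _ _ _)]
    refine Real.circleAverage_mono_codiscreteWithin (by linarith)
      hu.meromorphicOn.circleIntegrable_posLog_norm
      (hv.meromorphicOn.circleIntegrable_posLog_norm.add (circleIntegrable_const _ _ _)) ?_
    filter_upwards [codiscreteWithin_mono (Set.subset_univ _) h] with w hw
    have h1 := Real.posLog_le_posLog (norm_nonneg _) hw
    refine h1.trans (Real.posLog_mul.trans ?_)
    rw [add_comm, Real.posLog_eq_log (x := C) (by rwa [abs_of_nonneg (by linarith)])]
    refine add_le_add_left ?_ _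
    rcases le_total ‖v w‖ 1 with h4 | h4
    · rw [max_eq_left h4, Real.posLog_one]; exact Real.posLog_nonneg
    · rw [max_eq_right h4]
  have hs : ∀ w : ℂ → ℂ, ValueDistribution.characteristic w ⊤ r
    = ValueDistribution.proximity w ⊤ r + ValueDistribution.logCounting w ⊤ r := fun _ => rfl
  rw [hs, hs]
  linarith

theorem exists_abs_characteristic_inv_sub_le {h : ℂ → ℂ} (hh : Meromorphic h) :
    ∃ C, ∀ r, |ValueDistribution.characteristic h ⊤ r
      - ValueDistribution.characteristic h⁻¹ ⊤ r| ≤ C :=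
  ⟨_, fun r => ValueDistribution.characteristic_sub_characteristic_inv_le (R := r) hh⟩

/-- A meromorphic function without poles agrees off a discrete set with an entire function. -/
theorem exists_differentiable_eventuallyEq {h : ℂ → ℂ} (hh : Meromorphic h)
    (h0 : ∀ z, 0 ≤ meromorphicOrderAt h z) :
    ∃ E : ℂ → ℂ, Differentiable ℂ E ∧ h =ᶠ[codiscrete ℂ] E := by
  refine ⟨toMeromorphicNFOn h Set.univ, fun z => ?_,
    toMeromorphicNFOn_eqOn_codiscrete hh.meromorphicOn⟩
  have h1 := (meromorphicNFOn_toMeromorphicNFOn h Set.univ) (Set.mem_univ z)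
  refine (h1.meromorphicOrderAt_nonneg_iff_analyticAt.1 ?_).differentiableAt
  rw [meromorphicOrderAt_toMeromorphicNFOn hh.meromorphicOn (Set.mem_univ z)]
  exact h0 z

theorem analyticAt_polynomial_eval (q : Polynomial ℂ) (z : ℂ) :
    AnalyticAt ℂ (fun z => q.eval z) z := by
  simpa using (analyticAt_id (𝕜 := ℂ) (z := z)).aeval_polynomial q

/-- A meromorphic function with finitely many poles is the quotient of an entire function and
a polynomial. -/
theorem exists_polynomial_mul_eventuallyEq {h : ℂ → ℂ} (hh : Meromorphic h)
    (hfin : {z | meromorphicOrderAt h z < 0}.Finite) :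
    ∃ q : Polynomial ℂ, q ≠ 0 ∧ ∃ E : ℂ → ℂ, Differentiable ℂ E ∧
      (fun z => q.eval z * h z) =ᶠ[codiscrete ℂ] E := by
  -- the poles are removed one at a time
  suffices H : ∀ s : Finset ℂ, ∀ h : ℂ → ℂ, Meromorphic h →
      (∀ z, meromorphicOrderAt h z < 0 → z ∈ s) →
      ∃ q : Polynomial ℂ, q ≠ 0 ∧ ∃ E : ℂ → ℂ, Differentiable ℂ E ∧
      (fun z => q.eval z * h z) =ᶠ[codiscrete ℂ] E from
    H hfin.toFinset h hh fun z hz => by simpa using hz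
  intro s
  induction s using Finset.induction_on with
  | empty =>
    intro h hh hs
    obtain ⟨E, hE, hE'⟩ := exists_differentiable_eventuallyEq hh fun z => by
      by_contra hz; simpa using hs z (not_le.1 hz)
    exact ⟨1, one_ne_zero, E, hE, by simpa using hE'⟩
  | insert u s _ ih =>
    intro h hh hs
    set n := (-(meromorphicOrderAt h u).untop₀).toNat with hn
    have hpm : ∀ z, AnalyticAt ℂ ((fun z : ℂ => z - u) ^ n) z := fun z => by fun_prop
    have hord : meromorphicOrderAt ((fun z : ℂ => z - u) ^ n) u = n :=
      meromorphicOrderAt_pow_id_sub_const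
    have hm : Meromorphic ((fun z : ℂ => z - u) ^ n * h) := fun z =>
      (hpm z).meromorphicAt.mul (hh z)
    obtain ⟨q, hq, E, hE, hqE⟩ := ih _ hm fun z hz => by
      rw [meromorphicOrderAt_mul (hpm z).meromorphicAt (hh z)] at hz
      rcases eq_or_ne z u with rfl | hzu
      · exfalso
        rw [hord] at hz
        generalize meromorphicOrderAt h z = a at *
        cases a with
        | top => simp at hz
        | coe a =>
          simp only [WithTop.untop₀_coe] at hn
          norm_cast at hz
          omega
      · refine (Finset.mem_insert.1 (hs z ?_)).resolve_left hzu
        by_contra h0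
        exact absurd hz (not_lt.2 (add_nonneg (hpm z).meromorphicOrderAt_nonneg (not_lt.1 h0)))
    refine ⟨q * (Polynomial.X - Polynomial.C u) ^ n,
      mul_ne_zero hq (pow_ne_zero _ (Polynomial.X_sub_C_ne_zero u)), E, hE, ?_⟩
    filter_upwards [hqE] with z hz
    rw [← hz]
    simp [mul_assoc]

/-! ### Values of functions that are not rational -/

/-- A meromorphic function of the form `p / q` with polynomials `p` and `q`. -/
def IsRational (h : ℂ → ℂ) : Prop :=
  ∃ p q : Polynomial ℂ, q ≠ 0 ∧ MerEq h fun z => p.eval z / q.eval z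

theorem exists_norm_polynomial_eval_le (q : Polynomial ℂ) :
    ∃ C : ℝ, 0 ≤ C ∧ ∀ z : ℂ, 1 ≤ ‖z‖ → ‖q.eval z‖ ≤ C * ‖z‖ ^ q.natDegree := by
  refine ⟨∑ i ∈ Finset.range (q.natDegree + 1), ‖q.coeff i‖,
    Finset.sum_nonneg fun _ _ => norm_nonneg _, fun z hz => ?_⟩
  rw [Polynomial.eval_eq_sum_range, Finset.sum_mul]
  refine (norm_sum_le _ _).trans (Finset.sum_le_sum fun i hi => ?_)
  rw [norm_mul, norm_pow]
  gcongr
  exact Nat.lt_succ_iff.1 (Finset.mem_range.1 hi)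

/-- An entire function of polynomial growth is a polynomial, by Cauchy's estimates. -/
theorem exists_polynomial_of_norm_le {E : ℂ → ℂ} (hE : Differentiable ℂ E) {C ρ : ℝ} {n : ℕ}
    (h : ∀ z : ℂ, ρ < ‖z‖ → ‖E z‖ ≤ C * ‖z‖ ^ n) : ∃ p : Polynomial ℂ, ∀ z, E z = p.eval z := by
  have hzero : ∀ k, n < k → iteratedDeriv k E 0 = 0 := fun k hk => by
    have h1 : ∀ᶠ R : ℝ in atTop, ‖iteratedDeriv k E 0‖ ≤ k.factorial * C * (R ^ n / R ^ k) := by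
      filter_upwards [eventually_gt_atTop ρ, eventually_gt_atTop 0] with R hR hR0
      refine (Complex.norm_iteratedDeriv_le_of_forall_mem_sphere_norm_le k hR0 hE.diffContOnCl
        (C := C * R ^ n) fun z hz => ?_).trans (le_of_eq (by ring))
      rw [mem_sphere_zero_iff_norm] at hz
      rw [← hz]
      exact h z (hz ▸ hR)
    have h2 : Tendsto (fun R : ℝ => k.factorial * C * (R ^ n / R ^ k)) atTop (𝓝 0) := by
      simpa using (tendsto_pow_div_pow_atTop_zero (𝕜 := ℝ) hk).const_mul (k.factorial * C)
    exact norm_le_zero_iff.1 (ge_of_tendsto h2 h1)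
  refine ⟨∑ k ∈ Finset.range (n + 1),
    Polynomial.C ((k.factorial : ℂ)⁻¹ * iteratedDeriv k E 0) * Polynomial.X ^ k, fun z => ?_⟩
  rw [← Complex.taylorSeries_eq_of_entire' 0 z hE, tsum_eq_sum (s := Finset.range (n + 1))]
  · simp [Polynomial.eval_finsetSum]
  · intro k hk
    rw [hzero k (by simpa using hk)]
    simp

/-- A meromorphic function that is bounded near infinity is rational: after multiplication by a
polynomial it becomes an entire function of polynomial growth. -/
theorem isRational_of_norm_le {h : ℂ → ℂ} (hh : Meromorphic h) {C ρ : ℝ}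
    (hb : ∀ᶠ z in codiscrete ℂ, ρ < ‖z‖ → ‖h z‖ ≤ C) : IsRational h := by
  have hfin : {z | meromorphicOrderAt h z < 0}.Finite := by
    have h1 : {z | meromorphicOrderAt h z < 0} ⊆
        (MeromorphicOn.divisor h (Metric.closedBall (0 : ℂ) ρ)).support := by
      intro z hz
      have hzρ : z ∈ Metric.closedBall (0 : ℂ) ρ := by
        rw [mem_closedBall_zero_iff]
        by_contra hcon
        have h2 : ∀ᶠ w in 𝓝[≠] z, ρ < ‖w‖ :=
          (continuous_norm.continuousAt.eventually (lt_mem_nhds (not_le.1 hcon))).filter_mono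
            nhdsWithin_le_nhds
        have h3 := (tendsto_norm_atTop_iff_cobounded.2
          (tendsto_cobounded_of_meromorphicOrderAt_neg hz)).eventually_gt_atTop C
        obtain ⟨w, hw1, hw2, hw3⟩ :=
          ((eventually_nhdsNE_of_codiscrete hb z).and (h2.and h3)).exists
        exact absurd (hw1 hw2) (not_le.2 hw3)
      rw [Function.mem_support, MeromorphicOn.divisor_apply hh.meromorphicOn hzρ]
      intro h0
      rcases WithTop.untop₀_eq_zero.1 h0 with h0 | h0
      · rw [Set.mem_ofPred_eq, h0] at hz; exact lt_irrefl _ hz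
      · rw [Set.mem_ofPred_eq, h0] at hz; exact absurd hz (by simp)
    exact (Function.locallyFinsuppWithin.finiteSupport _ (isCompact_closedBall 0 ρ)).subset h1
  obtain ⟨q, hq, E, hE, hqE⟩ := exists_polynomial_mul_eventuallyEq hh hfin
  obtain ⟨D, hD, hqD⟩ := exists_norm_polynomial_eval_le q
  obtain ⟨p, hp⟩ := exists_polynomial_of_norm_le (C := D * max C 0) (ρ := max ρ 1)
    (n := q.natDegree) hE fun z hz => by
      have h1 : ∀ᶠ w in 𝓝[≠] z, ‖E w‖ ≤ D * max C 0 * ‖w‖ ^ q.natDegree := by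
        have h2 : ∀ᶠ w in 𝓝[≠] z, max ρ 1 < ‖w‖ :=
          (continuous_norm.continuousAt.eventually (lt_mem_nhds hz)).filter_mono
            nhdsWithin_le_nhds
        filter_upwards [h2, eventually_nhdsNE_of_codiscrete hb z,
          eventually_nhdsNE_of_codiscrete hqE z] with w hw1 hw2 hw3
        rw [← hw3, norm_mul]
        calc ‖q.eval w‖ * ‖h w‖ ≤ (D * ‖w‖ ^ q.natDegree) * max C 0 := by
              gcongr
              · exact hqD w ((le_max_right _ _).trans hw1.le)
              · exact (hw2 ((le_max_left _ _).trans_lt hw1)).trans (le_max_left _ _)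
          _ = _ := by ring
      have h3 : Tendsto (fun w => ‖E w‖) (𝓝[≠] z) (𝓝 ‖E z‖) :=
        (hE.continuous.norm.tendsto z).mono_left nhdsWithin_le_nhds
      have h4 : Tendsto (fun w : ℂ => D * max C 0 * ‖w‖ ^ q.natDegree) (𝓝[≠] z)
          (𝓝 (D * max C 0 * ‖z‖ ^ q.natDegree)) :=
        ((by fun_prop : Continuous fun w : ℂ => D * max C 0 * ‖w‖ ^ q.natDegree).tendsto z).mono_left
          nhdsWithin_le_nhds
      exact le_of_tendsto_of_tendsto h3 h4 h1
  refine ⟨p, q, hq, ?_⟩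
  have hq0 : ∀ᶠ z in codiscrete ℂ, q.eval z ≠ 0 := by
    have := (Polynomial.finite_setOfPred_isRoot hq)
    filter_upwards [this.compl_mem_codiscrete] with z hz h0
    exact hz h0
  filter_upwards [hqE, hq0] with z hz hz0
  rw [eq_div_iff hz0, ← hp, ← hz, mul_comm]

theorem merEq_zero_of_meromorphicOrderAt_eq_top {h : ℂ → ℂ} (hh : Meromorphic h) {z₀ : ℂ}
    (h0 : meromorphicOrderAt h z₀ = ⊤) : MerEq h 0 := by
  have h1 : ∀ z, meromorphicOrderAt h z = ⊤ := fun z => by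
    by_contra hz
    exact hh.meromorphicOn.meromorphicOrderAt_ne_top_of_isPreconnected (U := Set.univ)
      isPreconnected_univ (Set.mem_univ z) (Set.mem_univ z₀) hz h0
  refine mem_codiscreteWithin_iff_forall_mem_nhdsNE.2 fun z _ => ?_
  rw [Set.compl_univ, Set.union_empty]
  exact meromorphicOrderAt_eq_top_iff.1 (h1 z)

theorem meromorphicOrderAt_ne_top_of_not_merEq {h : ℂ → ℂ} (hh : Meromorphic h)
    (h0 : ¬ MerEq h 0) (z : ℂ) : meromorphicOrderAt h z ≠ ⊤ :=
  fun hz => h0 (merEq_zero_of_meromorphicOrderAt_eq_top hh hz)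

theorem isRational_of_merEq_const {h : ℂ → ℂ} {c : ℂ} (hc : MerEq h fun _ => c) : IsRational h :=
  ⟨Polynomial.C c, 1, one_ne_zero, by simpa using hc⟩

/-- If `1 / (g - w)` is rational, so is `g`. -/
theorem IsRational.of_inv_sub {g : ℂ → ℂ} {w : ℂ} (h : IsRational fun z => (g z - w)⁻¹) :
    IsRational g := by
  obtain ⟨p, q, hq, hpq⟩ := h
  rcases eq_or_ne p 0 with rfl | hp
  · refine isRational_of_merEq_const (c := w) ?_
    filter_upwards [hpq] with z hz
    simpa [sub_eq_zero] using hz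
  · refine ⟨Polynomial.C w * p + q, p, hp, ?_⟩
    have hp0 : ∀ᶠ z in codiscrete ℂ, p.eval z ≠ 0 := by
      filter_upwards [(Polynomial.finite_setOfPred_isRoot hp).compl_mem_codiscrete] with z hz h0
      exact hz h0
    filter_upwards [hpq, hp0] with z hz hz0
    rw [inv_eq_iff_eq_inv, inv_div] at hz
    rw [eq_add_of_sub_eq hz]
    simp [add_div, hz0, add_comm]

/-- Casorati–Weierstrass at infinity and Baire: a meromorphic function that is not rational takes
some value infinitely often. -/
theorem exists_infinite_merZeros {g : ℂ → ℂ} (hg : Meromorphic g) (hrat : ¬ IsRational g) :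
    ∃ c : ℂ, (merZeros fun z => g z - c).Infinite := by
  set U : Set ℂ := {z | AnalyticAt ℂ g z} with hU
  have hUopen : IsOpen U := isOpen_analyticAt ℂ g
  have hUcod : U ∈ codiscrete ℂ := hg.meromorphicOn.analyticAt_mem_codiscreteWithin
  have hgc : ∀ c, Meromorphic fun z => g z - c := fun c => hg.sub fun z => MeromorphicAt.const c z
  have hopen : ∀ n : ℕ, IsOpen (g '' {z ∈ U | (n : ℝ) < ‖z‖}) := fun n => by
    rw [isOpen_iff_mem_nhds]
    rintro _ ⟨z, ⟨hzU, hzn⟩, rfl⟩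
    rcases (show AnalyticAt ℂ g z from hzU).eventually_constant_or_nhds_le_map_nhds with h | h
    · refine absurd (isRational_of_merEq_const (c := g z) ?_) hrat
      have h1 : meromorphicOrderAt (fun w => g w - g z) z = ⊤ := by
        rw [meromorphicOrderAt_eq_top_iff]
        exact (h.filter_mono nhdsWithin_le_nhds).mono fun w hw => sub_eq_zero.2 hw
      filter_upwards [merEq_zero_of_meromorphicOrderAt_eq_top (hgc _) h1] with w hw
      exact sub_eq_zero.1 hw
    · refine h (image_mem_map ?_)
      exact (hUopen.inter (isOpen_lt continuous_const continuous_norm)).mem_nhds ⟨hzU, hzn⟩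
  have hdense : ∀ n : ℕ, Dense (g '' {z ∈ U | (n : ℝ) < ‖z‖}) := fun n => by
    rw [Metric.dense_iff]
    intro w ε hε
    by_contra hempty
    refine hrat (IsRational.of_inv_sub (w := w) (isRational_of_norm_le (C := ε⁻¹) (ρ := n)
      (hgc w).inv ?_))
    filter_upwards [hUcod] with z hz hzn
    rw [norm_inv]
    refine inv_anti₀ hε ?_
    by_contra hlt
    exact hempty ⟨g z, by simpa [dist_eq_norm] using hlt, z, ⟨hz, hzn⟩, rfl⟩
  obtain ⟨c, hc⟩ := (dense_iInter_of_isOpen_nat hopen hdense).nonempty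
  refine ⟨c, fun hfin => ?_⟩
  obtain ⟨B, hB⟩ := hfin.isBounded.exists_norm_le
  obtain ⟨n, hn⟩ := exists_nat_gt B
  obtain ⟨z, ⟨hzU, hzn⟩, hz⟩ := Set.mem_iInter.1 hc n
  refine absurd (hB z ?_) (not_le.2 (hn.trans hzn))
  rw [merZeros, Set.mem_ofPred_eq, ← tendsto_zero_iff_meromorphicOrderAt_pos (hgc c z)]
  have h1 : Tendsto (fun z => g z - c) (𝓝 z) (𝓝 (g z - c)) :=
    ((show AnalyticAt ℂ g z from hzU).continuousAt).sub continuousAt_const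
  rw [hz, sub_self] at h1
  exact h1.mono_left nhdsWithin_le_nhds

/-! ### Growth of compositions -/

theorem Meromorphic.comp_differentiable {g f : ℂ → ℂ} (hg : Meromorphic g)
    (hf : Differentiable ℂ f) : Meromorphic (fun z => g (f z)) := fun z =>
  (hg (f z)).comp_analyticAt (hf.analyticAt z)

theorem exists_pow_norm_le_max_norm_prod (Z : Finset ℂ) :
    ∃ C : ℝ, 1 ≤ C ∧ ∀ w : ℂ, ‖w‖ ^ Z.card ≤ C * max 1 ‖∏ a ∈ Z, (w - a)‖ := by
  obtain ⟨B, hB⟩ := Z.finite_toSet.isBounded.exists_norm_le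
  have hB1 : 1 ≤ max B 1 := le_max_right _ _
  have hm1 : ∀ w : ℂ, 1 ≤ max 1 ‖∏ a ∈ Z, (w - a)‖ := fun w => le_max_left _ _
  refine ⟨(2 * max B 1) ^ Z.card, one_le_pow₀ (by linarith), fun w => ?_⟩
  rcases le_total ‖w‖ (2 * max B 1) with h | h
  · exact (pow_le_pow_left₀ (norm_nonneg w) h _).trans
      (le_mul_of_one_le_right (by positivity) (hm1 w))
  · have h1 : ∏ a ∈ Z, ‖w‖ ≤ ∏ a ∈ Z, (2 * max B 1) * ‖w - a‖ := by
      refine Finset.prod_le_prod (fun _ _ => norm_nonneg _) fun a ha => ?_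
      have h2 := norm_sub_norm_le w a
      have h3 : ‖a‖ ≤ max B 1 := (hB a ha).trans (le_max_left _ _)
      have h4 : ‖w‖ ≤ 2 * ‖w - a‖ := by linarith
      have h5 := mul_le_mul_of_nonneg_right hB1 (norm_nonneg (w - a))
      linarith
    rw [Finset.prod_const, Finset.prod_mul_distrib, Finset.prod_const, ← norm_prod] at h1
    exact h1.trans (mul_le_mul_of_nonneg_left (le_max_right _ _) (by positivity))

/-- A zero of `u` at `a` dominates a simple one. -/
theorem exists_norm_inv_sub_le {u : ℂ → ℂ} {a : ℂ} (hu : MeromorphicAt u a)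
    (h0 : 0 < meromorphicOrderAt u a) (htop : meromorphicOrderAt u a ≠ ⊤) :
    ∃ D : ℝ, 0 ≤ D ∧ ∀ᶠ w in 𝓝[≠] a, ‖(w - a)⁻¹‖ ≤ D * ‖(u w)⁻¹‖ := by
  have hid : MeromorphicAt (fun w : ℂ => w - a) a := by fun_prop
  have h1 : 0 ≤ meromorphicOrderAt (u / fun w : ℂ => w - a) a := by
    have h2 : meromorphicOrderAt (fun w : ℂ => w - a) a = 1 := meromorphicOrderAt_id_sub_const
    rw [meromorphicOrderAt_div hu hid, h2]
    generalize meromorphicOrderAt u a = o at *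
    lift o to ℤ using htop
    have h3 : 0 < o := by exact_mod_cast h0
    have h4 : (0 : ℤ) ≤ o - 1 := by omega
    exact_mod_cast h4
  obtain ⟨L, hL⟩ := tendsto_nhds_of_meromorphicOrderAt_nonneg (hu.div hid) h1
  refine ⟨‖L‖ + 1, by positivity, ?_⟩
  filter_upwards [hL.norm.eventually_lt_const (lt_add_one _),
    (meromorphicOrderAt_ne_top_iff_eventually_ne_zero hu).1 htop] with w hw1 hw2
  have h3 : (w - a)⁻¹ = (u w / (w - a)) * (u w)⁻¹ := by field_simp
  rw [h3, norm_mul]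
  exact mul_le_mul_of_nonneg_right hw1.le (norm_nonneg _)

theorem exists_norm_inv_prod_le {u : ℂ → ℂ} (hu : Meromorphic u) (hu0 : ¬ MerEq u 0)
    (Z : Finset ℂ) (hZ : ∀ a ∈ Z, 0 < meromorphicOrderAt u a) :
    ∃ C : ℝ, 1 ≤ C ∧ ∀ w : ℂ, ‖(∏ a ∈ Z, (w - a))⁻¹‖ ≤ C * max 1 ‖(u w)⁻¹‖ := by
  induction Z using Finset.induction_on with
  | empty => exact ⟨1, le_rfl, fun w => by simp⟩
  | insert a Z ha ih =>
    obtain ⟨C, hC, h⟩ := ih fun b hb => hZ b (Finset.mem_insert_of_mem hb)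
    obtain ⟨D, hD, hnear⟩ := exists_norm_inv_sub_le (hu a) (hZ a (Finset.mem_insert_self a Z))
      (meromorphicOrderAt_ne_top_of_not_merEq hu hu0 a)
    have hcont : ContinuousAt (fun w => (∏ b ∈ Z, (w - b))⁻¹) a := by
      refine ContinuousAt.inv₀ (by fun_prop) (Finset.prod_ne_zero_iff.2 fun b hb => ?_)
      rw [sub_ne_zero]
      rintro rfl
      exact ha hb
    set K := ‖(∏ b ∈ Z, (a - b))⁻¹‖ + 1 with hK
    have hK' : ∀ᶠ w in 𝓝[≠] a, ‖(∏ b ∈ Z, (w - b))⁻¹‖ < K :=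
      (hcont.norm.eventually_lt_const (lt_add_one _)).filter_mono nhdsWithin_le_nhds
    obtain ⟨δ, hδ, hball⟩ := Metric.mem_nhdsWithin_iff.1 (hnear.and hK')
    have hδ0 : 0 < δ⁻¹ := inv_pos.2 hδ
    have hK0 : 0 ≤ K := by positivity
    refine ⟨1 + D * K + δ⁻¹ * C, by nlinarith [mul_nonneg hD hK0], fun w => ?_⟩
    have hm : 1 ≤ max 1 ‖(u w)⁻¹‖ := le_max_left _ _
    rw [Finset.prod_insert ha, mul_inv, norm_mul]
    rcases eq_or_ne w a with rfl | hwa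
    · rw [sub_self, inv_zero, norm_zero, zero_mul]
      positivity
    by_cases hw : w ∈ Metric.ball a δ
    · obtain ⟨h1, h2⟩ := hball ⟨hw, hwa⟩
      calc ‖(w - a)⁻¹‖ * ‖(∏ b ∈ Z, (w - b))⁻¹‖ ≤ (D * max 1 ‖(u w)⁻¹‖) * K := by
            gcongr
            exact h1.trans (mul_le_mul_of_nonneg_left (le_max_right _ _) hD)
        _ = D * K * max 1 ‖(u w)⁻¹‖ := by ring
        _ ≤ _ := by
          gcongr
          linarith [mul_pos hδ0 (zero_lt_one.trans_le hC)]
    · have h1 : ‖(w - a)⁻¹‖ ≤ δ⁻¹ := by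
        rw [norm_inv]
        exact inv_anti₀ hδ (by simpa [dist_eq_norm] using hw)
      calc ‖(w - a)⁻¹‖ * ‖(∏ b ∈ Z, (w - b))⁻¹‖ ≤ δ⁻¹ * (C * max 1 ‖(u w)⁻¹‖) := by
            gcongr
            exact h w
        _ = δ⁻¹ * C * max 1 ‖(u w)⁻¹‖ := by ring
        _ ≤ _ := by
          gcongr
          linarith [mul_nonneg hD hK0]

/-- If `g` is not rational, the characteristic of `g ∘ f` outgrows every multiple of the one of
the entire function `f`. For zeros `a₁, …, aₘ` of `g - c`, the function `1 / (g - c)` dominates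
`1 / q` with `q = ∏ (z - aⱼ)`, and `q ∘ f` is comparable to `f ^ m`. -/
theorem exists_mul_characteristic_le_comp {f g : ℂ → ℂ} (hf : Differentiable ℂ f)
    (hg : Meromorphic g) (hrat : ¬ IsRational g) (m : ℕ) :
    ∃ C, ∀ r, 1 ≤ r → m * ValueDistribution.characteristic f ⊤ r
      ≤ ValueDistribution.characteristic (fun z => g (f z)) ⊤ r + C := by
  obtain ⟨c, hc⟩ := exists_infinite_merZeros hg hrat
  obtain ⟨Z, hZ, hcard⟩ := hc.exists_subset_card_eq m
  have hgc : Meromorphic fun z => g z - c := hg.sub fun z => MeromorphicAt.const c z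
  have hgc0 : ¬ MerEq (fun z => g z - c) 0 := fun h0 =>
    hrat (isRational_of_merEq_const (c := c) (h0.mono fun z hz => sub_eq_zero.1 hz))
  obtain ⟨C₁, hC₁, h₁⟩ := exists_pow_norm_le_max_norm_prod Z
  obtain ⟨C₂, hC₂, h₂⟩ := exists_norm_inv_prod_le hgc hgc0 Z fun a ha => hZ ha
  have hfm : Meromorphic f := fun z => (hf.analyticAt z).meromorphicAt
  have hq : Differentiable ℂ fun z => ∏ a ∈ Z, (f z - a) := by fun_prop
  have hqm : Meromorphic fun z => ∏ a ∈ Z, (f z - a) := fun z => (hq.analyticAt z).meromorphicAt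
  have hgf := hg.comp_differentiable hf
  have hgfc := hgc.comp_differentiable hf
  obtain ⟨C₃, h₃⟩ := exists_abs_characteristic_inv_sub_le hqm
  obtain ⟨C₄, h₄⟩ := exists_abs_characteristic_inv_sub_le hgfc
  refine ⟨Real.log C₁ + C₃ + Real.log C₂ + C₄ + Real.log (1 + ‖c‖), fun r hr => ?_⟩
  have e1 := characteristic_le_of_norm_le (u := f ^ m) hC₁ (fun z => (hfm z).pow m) hqm
    (Eventually.of_forall fun w => by simpa [hcard] using h₁ (f w)) hr
  have e2 := characteristic_le_of_norm_le hC₂ hqm.inv hgfc.inv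
    (Eventually.of_forall fun w => h₂ (f w)) hr
  have e3 := characteristic_le_of_norm_le (C := 1 + ‖c‖) (by linarith [norm_nonneg c]) hgfc hgf
    (Eventually.of_forall fun w => (norm_sub_le _ _).trans (by
      nlinarith [le_max_left 1 ‖g (f w)‖, le_max_right 1 ‖g (f w)‖, norm_nonneg c])) hr
  rw [ValueDistribution.characteristic_pow_top hfm, Pi.smul_apply, nsmul_eq_mul] at e1
  linarith [(abs_le.1 (h₃ r)).2, (abs_le.1 (h₄ r)).1]

/-! ### The differential field of meromorphic functions -/

theorem meromorphic_fun_const (c : ℂ) : Meromorphic fun _ : ℂ => c := fun z =>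
  MeromorphicAt.const c z

theorem Differentiable.meromorphic {f : ℂ → ℂ} (hf : Differentiable ℂ f) : Meromorphic f :=
  fun z => (hf.analyticAt z).meromorphicAt

/-- The algebra of functions that are meromorphic on the plane. -/
def merAlgebra : Subalgebra ℂ (ℂ → ℂ) where
  carrier := {f | Meromorphic f}
  mul_mem' := fun hf hg z => (hf z).mul (hg z)
  add_mem' := fun hf hg z => (hf z).add (hg z)
  algebraMap_mem' := fun c z => MeromorphicAt.const c z

/-- The functions that vanish off a closed discrete set. -/
def merIdeal : Ideal merAlgebra where
  carrier := {f | MerEq f 0}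
  zero_mem' := show MerEq (0 : ℂ → ℂ) 0 from EventuallyEq.refl _ _
  add_mem' := fun {f g} hf hg => by
    have hf' : MerEq (f : ℂ → ℂ) 0 := hf
    have hg' : MerEq (g : ℂ → ℂ) 0 := hg
    change MerEq ((f : ℂ → ℂ) + g) 0
    have := EventuallyEq.add hf' hg'
    rwa [add_zero] at this
  smul_mem' := fun c f hf => by
    have hf' : MerEq (f : ℂ → ℂ) 0 := hf
    change MerEq ((c : ℂ → ℂ) * f) 0
    have := EventuallyEq.mul (EventuallyEq.refl _ (c : ℂ → ℂ)) hf'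
    rwa [mul_zero] at this

instance : merIdeal.IsMaximal := by
  refine Ideal.isMaximal_iff.2 ⟨fun h => ?_, fun J x hJ hx hxJ => ?_⟩
  · obtain ⟨z, hz⟩ := (eventually_nhdsNE_of_codiscrete (p := fun _ => (1 : ℂ) = 0) h 0).exists
    exact one_ne_zero hz
  · have hxi : Meromorphic (x : ℂ → ℂ)⁻¹ := Meromorphic.inv x.2
    have h1 : (⟨_, hxi⟩ * x - 1 : merAlgebra) ∈ merIdeal := by
      have h2 : ∀ᶠ z in codiscrete ℂ, (x : ℂ → ℂ) z ≠ 0 :=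
        (show MeromorphicOn (x : ℂ → ℂ) Set.univ from fun z _ =>
          x.2 z).eventually_codiscreteWithin_apply_ne_zero fun z _ =>
            meromorphicOrderAt_ne_top_of_not_merEq x.2 hx z
      filter_upwards [h2] with z hz
      change ((x : ℂ → ℂ) z)⁻¹ * (x : ℂ → ℂ) z - 1 = 0
      rw [inv_mul_cancel₀ hz, sub_self]
    have h3 := J.sub_mem (J.mul_mem_left ⟨_, hxi⟩ hxJ) (hJ h1)
    simpa using h3

/-- The field of meromorphic functions on the plane, functions that agree off a closed discrete
set being identified. -/
abbrev Mer : Type := merAlgebra ⧸ merIdeal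

noncomputable instance : Field Mer := Ideal.Quotient.field merIdeal

namespace Mer

/-- The class of a meromorphic function. -/
noncomputable def mk (f : ℂ → ℂ) (hf : Meromorphic f) : Mer := Ideal.Quotient.mk merIdeal ⟨f, hf⟩

theorem mk_eq_mk {f g : ℂ → ℂ} {hf : Meromorphic f} {hg : Meromorphic g} :
    mk f hf = mk g hg ↔ MerEq f g := by
  rw [mk, mk, Ideal.Quotient.eq]
  refine ⟨fun h => ?_, fun h => ?_⟩
  · exact Eventually.mono h fun z hz => sub_eq_zero.1 hz
  · exact Eventually.mono h fun z hz => sub_eq_zero.2 hz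

theorem mk_eq_zero {f : ℂ → ℂ} {hf : Meromorphic f} : mk f hf = 0 ↔ MerEq f 0 :=
  Ideal.Quotient.eq_zero_iff_mem

theorem exists_mk_eq (x : Mer) : ∃ f hf, mk f hf = x := by
  obtain ⟨⟨f, hf⟩, rfl⟩ := Ideal.Quotient.mk_surjective x
  exact ⟨f, hf, rfl⟩

theorem mk_add {f g : ℂ → ℂ} (hf : Meromorphic f) (hg : Meromorphic g) :
    mk (f + g) (hf.add hg) = mk f hf + mk g hg := rfl

theorem mk_sub {f g : ℂ → ℂ} (hf : Meromorphic f) (hg : Meromorphic g) :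
    mk (f - g) (hf.sub hg) = mk f hf - mk g hg := rfl

theorem mk_mul {f g : ℂ → ℂ} (hf : Meromorphic f) (hg : Meromorphic g) :
    mk (f * g) (hf.mul hg) = mk f hf * mk g hg := rfl

theorem mk_const (c : ℂ) : mk (fun _ => c) (meromorphic_fun_const c)
    = algebraMap ℂ Mer c := rfl

theorem mk_inv {f : ℂ → ℂ} (hf : Meromorphic f) : mk f⁻¹ hf.inv = (mk f hf)⁻¹ := by
  by_cases h0 : mk f hf = 0
  · rw [h0, inv_zero, mk_eq_zero]
    filter_upwards [mk_eq_zero.1 h0] with z hz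
    simp [hz]
  · refine eq_inv_of_mul_eq_one_left ?_
    rw [← mk_mul]
    have h2 : ∀ᶠ z in codiscrete ℂ, f z ≠ 0 :=
      hf.meromorphicOn.eventually_codiscreteWithin_apply_ne_zero fun z _ =>
        meromorphicOrderAt_ne_top_of_not_merEq hf (fun h => h0 (mk_eq_zero.2 h)) z
    refine (mk_eq_mk (hg := meromorphic_fun_const 1)).2 ?_
    filter_upwards [h2] with z hz
    simp [hz]

theorem mk_div {f g : ℂ → ℂ} (hf : Meromorphic f) (hg : Meromorphic g) :
    mk (f / g) (hf.div hg) = mk f hf / mk g hg := by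
  rw [div_eq_mul_inv (mk f hf), ← mk_inv hg, ← mk_mul hf hg.inv]
  exact mk_eq_mk.2 (Eventually.of_forall fun z => div_eq_mul_inv (f z) (g z))

/-- A representative of an element of `Mer`. -/
noncomputable def rep (x : Mer) : ℂ → ℂ := (exists_mk_eq x).choose

theorem meromorphic_rep (x : Mer) : Meromorphic x.rep := (exists_mk_eq x).choose_spec.choose

theorem mk_rep (x : Mer) : mk x.rep x.meromorphic_rep = x := (exists_mk_eq x).choose_spec.choose_spec

theorem rep_mk {f : ℂ → ℂ} (hf : Meromorphic f) : MerEq (mk f hf).rep f :=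
  mk_eq_mk.1 (mk_rep (mk f hf))

theorem rep_ne_top {x : Mer} (hx : x ≠ 0) (z : ℂ) : meromorphicOrderAt x.rep z ≠ ⊤ :=
  meromorphicOrderAt_ne_top_of_not_merEq x.meromorphic_rep
    (fun h => hx (by rw [← mk_rep x]; exact mk_eq_zero.2 h)) z

end Mer

theorem MerEq.deriv {f g : ℂ → ℂ} (h : MerEq f g) : MerEq (deriv f) (deriv g) := by
  filter_upwards [eventuallyEq_nhds_of_eventuallyEq_codiscreteWithin isOpen_univ h] with z hz
  exact hz.deriv_eq

namespace Mer

theorem mk_deriv_congr {f g : ℂ → ℂ} (hf : Meromorphic f) (hg : Meromorphic g)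
    (h : mk f hf = mk g hg) : mk (deriv f) hf.deriv = mk (deriv g) hg.deriv :=
  mk_eq_mk.2 (mk_eq_mk.1 h).deriv

/-- Differentiation of meromorphic functions. It does not depend on the representatives, because
functions that agree off a closed discrete set have the same germs off such a set. -/
noncomputable def D : Derivation ℂ Mer Mer :=
  Derivation.mk'
    { toFun := fun x => mk (deriv x.rep) x.meromorphic_rep.deriv
      map_add' := fun x y => by
        rw [mk_deriv_congr (x + y).meromorphic_rep (x.meromorphic_rep.add y.meromorphic_rep)
          (by rw [mk_rep, mk_add x.meromorphic_rep y.meromorphic_rep, mk_rep, mk_rep])]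
        refine mk_eq_mk.2 ?_
        filter_upwards [x.meromorphic_rep.meromorphicOn.analyticAt_mem_codiscreteWithin,
          y.meromorphic_rep.meromorphicOn.analyticAt_mem_codiscreteWithin] with z hx hy
        exact deriv_add hx.differentiableAt hy.differentiableAt
      map_smul' := fun c x => by
        have hc := meromorphic_fun_const c
        rw [mk_deriv_congr (c • x).meromorphic_rep (hc.mul x.meromorphic_rep)
          (by rw [mk_rep, mk_mul hc x.meromorphic_rep, mk_rep, mk_const, Algebra.smul_def]),
          RingHom.id_apply, Algebra.smul_def, ← mk_const]
        exact mk_eq_mk.2 (Eventually.of_forall fun z => deriv_const_mul_field c) }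
    fun x y => by
      change mk (deriv (x * y).rep) _ = x * mk (deriv y.rep) _ + y * mk (deriv x.rep) _
      rw [mk_deriv_congr (x * y).meromorphic_rep (x.meromorphic_rep.mul y.meromorphic_rep)
        (by rw [mk_rep, mk_mul x.meromorphic_rep y.meromorphic_rep, mk_rep, mk_rep])]
      conv_rhs =>
        enter [1, 1]
        rw [← mk_rep x]
      conv_rhs =>
        enter [2, 1]
        rw [← mk_rep y]
      refine mk_eq_mk.2 ?_
      filter_upwards [x.meromorphic_rep.meromorphicOn.analyticAt_mem_codiscreteWithin,
        y.meromorphic_rep.meromorphicOn.analyticAt_mem_codiscreteWithin] with z hx hy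
      rw [deriv_mul hx.differentiableAt hy.differentiableAt]
      change _ = x.rep z * deriv y.rep z + y.rep z * deriv x.rep z
      ring

theorem D_mk {f : ℂ → ℂ} (hf : Meromorphic f) : D (mk f hf) = mk (deriv f) hf.deriv :=
  mk_deriv_congr _ hf (mk_rep _)

/-- Derivatives vanish only for constants: the poles form a countable set, whose complement is
connected. -/
theorem exists_algebraMap_eq_of_D_eq_zero {x : Mer} (hx : D x = 0) :
    ∃ c : ℂ, x = algebraMap ℂ Mer c := by
  have hd : MerEq (deriv x.rep) 0 := by
    rw [← mk_eq_zero (hf := x.meromorphic_rep.deriv), ← D_mk x.meromorphic_rep, mk_rep, hx]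
  set U := {z | AnalyticAt ℂ x.rep z} with hU
  have hUo : IsOpen U := isOpen_analyticAt ℂ _
  have hUc : IsPreconnected U := by
    have h1 : (Uᶜ).Countable := x.meromorphic_rep.countable_compl_analyticAt
    have h2 := h1.isPathConnected_compl_of_one_lt_rank (by
      rw [Complex.rank_real_complex]; norm_num)
    rw [compl_compl] at h2
    exact h2.isConnected.isPreconnected
  have hd0 : ∀ z ∈ U, deriv x.rep z = 0 := fun z hz => by
    have h1 : Tendsto (deriv x.rep) (𝓝[≠] z) (𝓝 (deriv x.rep z)) :=
      (show AnalyticAt ℂ x.rep z from hz).deriv.continuousAt.mono_left nhdsWithin_le_nhds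
    refine tendsto_nhds_unique h1 (tendsto_const_nhds.congr' ?_)
    exact (eventually_nhdsNE_of_codiscrete hd z).mono fun w hw => hw.symm
  obtain ⟨c, hc⟩ := hUo.exists_is_const_of_deriv_eq_zero hUc
    (fun z hz => (show AnalyticAt ℂ x.rep z from hz).differentiableAt.differentiableWithinAt) hd0
  refine ⟨c, ?_⟩
  rw [← mk_rep x, ← mk_const]
  refine mk_eq_mk.2 ?_
  filter_upwards [x.meromorphic_rep.meromorphicOn.analyticAt_mem_codiscreteWithin] with z hz
  exact hc z hz

/-! ### The characteristic on the field of meromorphic functions -/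

/-- The proximity function of a meromorphic function. -/
noncomputable def m (x : Mer) : ℝ → ℝ := ValueDistribution.proximity x.rep ⊤

/-- The counting function of the poles of a meromorphic function. -/
noncomputable def N (x : Mer) : ℝ → ℝ := ValueDistribution.logCounting x.rep ⊤

/-- The Nevanlinna characteristic of a meromorphic function. -/
noncomputable def T (x : Mer) : ℝ → ℝ := nevT x.rep

theorem T_eq (x : Mer) (r : ℝ) : x.T r = x.m r + x.N r := rfl

theorem m_nonneg (x : Mer) (r : ℝ) : 0 ≤ x.m r := ValueDistribution.proximity_nonneg r

theorem N_nonneg (x : Mer) {r : ℝ} (hr : 1 ≤ r) : 0 ≤ x.N r :=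
  ValueDistribution.logCounting_nonneg hr

theorem T_nonneg (x : Mer) {r : ℝ} (hr : 1 ≤ r) : 0 ≤ x.T r :=
  add_nonneg (x.m_nonneg r) (x.N_nonneg hr)

theorem m_mk {f : ℂ → ℂ} (hf : Meromorphic f) {r : ℝ} (hr : r ≠ 0) :
    (mk f hf).m r = ValueDistribution.proximity f ⊤ r :=
  ValueDistribution.proximity_congr_codiscrete (rep_mk hf) hr

theorem N_mk {f : ℂ → ℂ} (hf : Meromorphic f) :
    (mk f hf).N = ValueDistribution.logCounting f ⊤ :=
  congrFun (ValueDistribution.logCounting_congr_codiscrete (rep_mk hf)) ⊤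

theorem T_mk {f : ℂ → ℂ} (hf : Meromorphic f) {r : ℝ} (hr : r ≠ 0) :
    (mk f hf).T r = nevT f r := by
  rw [T_eq, m_mk hf hr, N_mk hf]; rfl

theorem T_algebraMap (c : ℂ) {r : ℝ} (hr : r ≠ 0) : (algebraMap ℂ Mer c).T r = Real.posLog ‖c‖ := by
  rw [← mk_const, T_mk _ hr, nevT, ValueDistribution.characteristic, Pi.add_apply]
  simp

theorem m_add_le (x y : Mer) {r : ℝ} (hr : 1 ≤ r) : (x + y).m r ≤ x.m r + y.m r + Real.log 2 := by
  have hr0 : r ≠ 0 := by linarith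
  conv_lhs => rw [← mk_rep x, ← mk_rep y, ← mk_add, m_mk _ hr0]
  exact ValueDistribution.proximity_add_top_le x.meromorphic_rep y.meromorphic_rep r

theorem m_mul_le (x y : Mer) {r : ℝ} (hr : 1 ≤ r) : (x * y).m r ≤ x.m r + y.m r := by
  have hr0 : r ≠ 0 := by linarith
  conv_lhs => rw [← mk_rep x, ← mk_rep y, ← mk_mul, m_mk _ hr0]
  exact ValueDistribution.proximity_mul_top_le x.meromorphic_rep y.meromorphic_rep r

theorem T_zero {r : ℝ} (hr : r ≠ 0) : (0 : Mer).T r = 0 := by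
  rw [← map_zero (algebraMap ℂ Mer), T_algebraMap _ hr]; simp

theorem T_add_le (x y : Mer) {r : ℝ} (hr : 1 ≤ r) : (x + y).T r ≤ x.T r + y.T r + Real.log 2 := by
  have hr0 : r ≠ 0 := by linarith
  conv_lhs => rw [← mk_rep x, ← mk_rep y, ← mk_add, T_mk _ hr0]
  exact ValueDistribution.characteristic_add_top_le x.meromorphic_rep y.meromorphic_rep hr

theorem T_mul_le (x y : Mer) {r : ℝ} (hr : 1 ≤ r) : (x * y).T r ≤ x.T r + y.T r := by
  have hr0 : r ≠ 0 := by linarith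
  rcases eq_or_ne x 0 with rfl | hx
  · rw [zero_mul, T_zero hr0]; linarith [y.T_nonneg hr]
  rcases eq_or_ne y 0 with rfl | hy
  · rw [mul_zero, T_zero hr0]; linarith [x.T_nonneg hr]
  conv_lhs => rw [← mk_rep x, ← mk_rep y, ← mk_mul, T_mk _ hr0]
  exact ValueDistribution.characteristic_mul_top_le hr x.meromorphic_rep (rep_ne_top hx)
    y.meromorphic_rep (rep_ne_top hy)

theorem N_mul_le {x y : Mer} (hx : x ≠ 0) (hy : y ≠ 0) {r : ℝ} (hr : 1 ≤ r) :
    (x * y).N r ≤ x.N r + y.N r := by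
  conv_lhs => rw [← mk_rep x, ← mk_rep y, ← mk_mul, N_mk]
  exact ValueDistribution.logCounting_mul_top_le hr x.meromorphic_rep (rep_ne_top hx)
    y.meromorphic_rep (rep_ne_top hy)

theorem exists_T_inv_le (x : Mer) : ∃ C, ∀ r, 1 ≤ r → x⁻¹.T r ≤ x.T r + C := by
  obtain ⟨C, hC⟩ := exists_abs_characteristic_inv_sub_le x.meromorphic_rep
  refine ⟨C, fun r hr => ?_⟩
  have hr0 : r ≠ 0 := by linarith
  conv_lhs => rw [← mk_rep x, ← mk_inv, T_mk _ hr0]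
  have := (abs_le.1 (hC r)).1
  change _ ≤ ValueDistribution.characteristic x.rep ⊤ r + C
  change ValueDistribution.characteristic _ ⊤ r ≤ _
  linarith

/-- Differentiation raises the order of a pole by one, hence at most doubles it. -/
theorem N_D_le (x : Mer) {r : ℝ} (hr : 1 ≤ r) : (D x).N r ≤ 2 * x.N r := by
  conv_lhs => rw [← mk_rep x, D_mk, N_mk]
  refine logCounting_top_le_nsmul_of_divisor (v := x.rep) 2 (fun z => ?_) hr
  have hx := x.meromorphic_rep
  rw [MeromorphicOn.divisor_apply hx.deriv.meromorphicOn (Set.mem_univ z),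
    MeromorphicOn.divisor_apply hx.meromorphicOn (Set.mem_univ z)]
  rcases lt_or_ge (meromorphicOrderAt x.rep z) 0 with h | h
  · obtain ⟨n, hn⟩ := WithTop.ne_top_iff_exists.1 h.ne_top
    have hn0 : n < 0 := by rw [← hn] at h; exact_mod_cast h
    rw [meromorphicOrderAt_deriv_eq_sub_one (by exact_mod_cast hn0.ne) hn.symm, ← hn,
      WithTop.untop₀_coe, WithTop.untop₀_coe, negPart_eq_neg.2 (by omega),
      negPart_eq_neg.2 (by omega)]
    push_cast
    omega
  · have h1 := (hx z).meromorphicOrderAt_nonneg_iff_analyticAt_toMeromorphicNFAt.1 h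
    have h2 : 0 ≤ meromorphicOrderAt (deriv x.rep) z := by
      rw [meromorphicOrderAt_congr (hx z).eq_nhdsNE_toMeromorphicNFAt.nhdsNE_deriv]
      exact h1.deriv.meromorphicOrderAt_nonneg
    rw [negPart_eq_zero.2 (WithTop.untop₀_nonneg.2 h2)]
    exact mul_nonneg (by positivity) (negPart_nonneg _)

/-- The lemma on the logarithmic derivative. -/
theorem exists_eventually_m_D_div_le {x : Mer} (hx : x ≠ 0) : ∃ K : ℝ, ∀ᶠ r in nevFilter,
    (D x / x).m r ≤ K + 6 * Real.log r + 8 * Real.log (x.T r + 2) := by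
  obtain ⟨K, hK⟩ := exists_eventually_proximity_logDeriv_le x.meromorphic_rep (rep_ne_top hx)
  refine ⟨K, ?_⟩
  filter_upwards [hK, nevFilter_le_atTop (eventually_ge_atTop 1)] with r h hr
  have hr0 : r ≠ 0 := by linarith
  conv_lhs => rw [← mk_rep x, D_mk, ← mk_div, m_mk _ hr0]
  exact h

theorem N_mk_eq_zero_of_differentiable {f : ℂ → ℂ} (hf : Differentiable ℂ f) :
    (mk f hf.meromorphic).N = 0 := by
  rw [N_mk, ValueDistribution.logCounting_top, negPart_eq_zero.2]
  · exact map_zero _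
  · exact MeromorphicOn.AnalyticOnNhd.divisor_nonneg fun z _ => hf.analyticAt z

end Mer

/-! ### Differentially algebraic elements -/

section DifferentialAlgebra

variable {R K M : Type*} [CommRing R] [Field K] [Field M] [Algebra R M] [Algebra K M]

/-- The elements of `M` that are algebraic over the field generated by `K` and `s`. The ring
generated by `K` and `s` serves as the base, over which the same elements are algebraic. -/
noncomputable def algHull (K : Type*) {M : Type*} [Field K] [Field M] [Algebra K M] (s : Set M) :
    Subalgebra (Algebra.adjoin K s) M :=
  Subalgebra.algebraicClosure (Algebra.adjoin K s) M

theorem coe_algHull (s : Set M) :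
    (algHull K s : Set M) = (AlgebraicIndependent.matroid K M).closure s :=
  (AlgebraicIndependent.matroid_closure_eq).symm

theorem subset_algHull (s : Set M) : s ⊆ algHull K s := by
  rw [coe_algHull]
  exact Matroid.subset_closure _ _ (Set.subset_univ _)

theorem algHull_subset_algHull {s t : Set M} (h : s ⊆ algHull K t) :
    (algHull K s : Set M) ⊆ algHull K t := by
  rw [coe_algHull] at h ⊢
  rw [coe_algHull]
  exact Matroid.closure_subset_closure_of_subset_closure h

theorem algebraMap_mem_algHull (s : Set M) (c : K) : algebraMap K M c ∈ algHull K s :=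
  (algHull K s).algebraMap_mem (algebraMap K (Algebra.adjoin K s) c)

theorem inv_mem_algHull {s : Set M} {x : M} (hx : x ∈ algHull K s) : x⁻¹ ∈ algHull K s :=
  IsAlgebraic.inv (show IsAlgebraic _ x from hx)

variable {δ : Derivation R M M}

theorem aeval_mem_algHull {s : Set M} {x : M} (hx : x ∈ algHull K s)
    (p : Polynomial (Algebra.adjoin K s)) : Polynomial.aeval x p ∈ algHull K s := by
  rw [Polynomial.aeval_eq_sum_range]
  exact sum_mem fun i _ => (algHull K s).smul_mem (pow_mem hx i) _

/-- Differentiation of an algebraic relation expresses the derivative of an algebraic element. -/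
theorem derivation_mem_algHull [CharZero M]
    (hK : ∀ c : K, δ (algebraMap K M c) ∈ Set.range (algebraMap K M))
    {s : Set M} (hs : ∀ y ∈ s, δ y ∈ algHull K s) {x : M} (hx : x ∈ algHull K s) :
    δ x ∈ algHull K s := by
  have hA : ∀ a ∈ Algebra.adjoin K s, δ a ∈ algHull K s := fun a ha => by
    induction ha using Algebra.adjoin_induction with
    | mem y hy => exact hs y hy
    | algebraMap c =>
      obtain ⟨d, hd⟩ := hK c
      rw [← hd]
      exact algebraMap_mem_algHull s d
    | add a b _ _ ha hb => rw [map_add]; exact add_mem ha hb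
    | mul a b ha' hb' ha hb =>
      rw [Derivation.leibniz]
      exact add_mem ((algHull K s).smul_mem hb (⟨a, ha'⟩ : Algebra.adjoin K s))
        ((algHull K s).smul_mem ha (⟨b, hb'⟩ : Algebra.adjoin K s))
  have hδ : ∀ p : Polynomial (Algebra.adjoin K s), ∃ y ∈ algHull K s,
      δ (Polynomial.aeval x p) = y + Polynomial.aeval x (Polynomial.derivative p) * δ x := by
    intro p
    induction p using Polynomial.induction_on' with
    | add p q hp hq =>
      obtain ⟨y, hy, h1⟩ := hp
      obtain ⟨z, hz, h2⟩ := hq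
      refine ⟨y + z, add_mem hy hz, ?_⟩
      rw [map_add, map_add, h1, h2, map_add, map_add]
      ring
    | monomial n a =>
      refine ⟨x ^ n * δ a, mul_mem (pow_mem hx n) (hA a a.2), ?_⟩
      rw [Polynomial.aeval_monomial, Polynomial.derivative_monomial, Polynomial.aeval_monomial,
        Derivation.leibniz, Derivation.leibniz_pow]
      simp only [smul_eq_mul, nsmul_eq_mul, map_mul, map_natCast]
      change (a : M) * _ + x ^ n * δ (a : M) = _ + (a : M) * _ * _ * _
      ring
  -- the relation is replaced by its derivative until the latter does not hold at `x`
  suffices H : ∀ n, ∀ p : Polynomial (Algebra.adjoin K s), p.natDegree = n → p ≠ 0 →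
      Polynomial.aeval x p = 0 → δ x ∈ algHull K s by
    obtain ⟨p, hp, hpx⟩ := (show IsAlgebraic (Algebra.adjoin K s) x from hx)
    exact H _ p rfl hp hpx
  intro n
  induction n using Nat.strong_induction_on with
  | _ n ih =>
    intro p hn hp hpx
    by_cases h0 : Polynomial.aeval x (Polynomial.derivative p) = 0
    · have hdeg : p.natDegree ≠ 0 := fun h => by
        rw [Polynomial.eq_C_of_natDegree_eq_zero h, Polynomial.aeval_C] at hpx
        have h1 : p.coeff 0 = 0 := by
          rwa [FaithfulSMul.algebraMap_eq_zero_iff] at hpx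
        rw [Polynomial.eq_C_of_natDegree_eq_zero h, h1, Polynomial.C_0] at hp
        exact hp rfl
      have : CharZero (Algebra.adjoin K s) :=
        (algebraMap (Algebra.adjoin K s) M).charZero
      exact ih _ (hn ▸ Polynomial.natDegree_derivative_lt hdeg) _ rfl
        (fun h => hdeg (Polynomial.derivative_eq_zero.1 h)) h0
    · obtain ⟨y, hy, h1⟩ := hδ p
      rw [hpx, map_zero] at h1
      have h2 : δ x = -y * (Polynomial.aeval x (Polynomial.derivative p))⁻¹ := by
        rw [eq_mul_inv_iff_mul_eq₀ h0]
        linear_combination -h1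
      rw [h2]
      exact mul_mem (neg_mem hy) (inv_mem_algHull (aeval_mem_algHull hx _))

/-- An element of a differential field `M` is differentially algebraic over `K` if it is algebraic
over a finitely generated extension of `K` whose algebraic closure in `M` is stable under
differentiation. -/
def IsDiffAlgebraic (K : Type*) [Field K] [Algebra K M] (δ : Derivation R M M) (x : M) : Prop :=
  ∃ s : Set M, s.Finite ∧ (∀ y ∈ s, δ y ∈ algHull K s) ∧ x ∈ algHull K s

namespace IsDiffAlgebraic

theorem of_algebraMap (c : K) : IsDiffAlgebraic K δ (algebraMap K M c) :=
  ⟨∅, Set.finite_empty, by simp, algebraMap_mem_algHull _ c⟩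

theorem exists_common {x y : M} (hx : IsDiffAlgebraic K δ x) (hy : IsDiffAlgebraic K δ y) :
    ∃ s : Set M, s.Finite ∧ (∀ y ∈ s, δ y ∈ algHull K s) ∧ x ∈ algHull K s ∧ y ∈ algHull K s := by
  obtain ⟨s, hs, hδs, hxs⟩ := hx
  obtain ⟨t, ht, hδt, hyt⟩ := hy
  have h1 : (algHull K s : Set M) ⊆ algHull K (s ∪ t) :=
    algHull_subset_algHull (Set.subset_union_left.trans (subset_algHull _))
  have h2 : (algHull K t : Set M) ⊆ algHull K (s ∪ t) :=
    algHull_subset_algHull (Set.subset_union_right.trans (subset_algHull _))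
  exact ⟨s ∪ t, hs.union ht, fun z hz => hz.elim (fun hz => h1 (hδs z hz)) fun hz => h2 (hδt z hz),
    h1 hxs, h2 hyt⟩

theorem add {x y : M} (hx : IsDiffAlgebraic K δ x) (hy : IsDiffAlgebraic K δ y) :
    IsDiffAlgebraic K δ (x + y) := by
  obtain ⟨s, hs, hδ, h1, h2⟩ := hx.exists_common hy
  exact ⟨s, hs, hδ, add_mem h1 h2⟩

theorem mul {x y : M} (hx : IsDiffAlgebraic K δ x) (hy : IsDiffAlgebraic K δ y) :
    IsDiffAlgebraic K δ (x * y) := by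
  obtain ⟨s, hs, hδ, h1, h2⟩ := hx.exists_common hy
  exact ⟨s, hs, hδ, mul_mem h1 h2⟩

theorem neg {x : M} (hx : IsDiffAlgebraic K δ x) : IsDiffAlgebraic K δ (-x) := by
  obtain ⟨s, hs, hδ, h1⟩ := hx
  exact ⟨s, hs, hδ, neg_mem h1⟩

theorem sub {x y : M} (hx : IsDiffAlgebraic K δ x) (hy : IsDiffAlgebraic K δ y) :
    IsDiffAlgebraic K δ (x - y) := by
  rw [sub_eq_add_neg]; exact hx.add hy.neg

theorem inv {x : M} (hx : IsDiffAlgebraic K δ x) : IsDiffAlgebraic K δ x⁻¹ := by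
  obtain ⟨s, hs, hδ, h1⟩ := hx
  exact ⟨s, hs, hδ, inv_mem_algHull h1⟩

theorem div {x y : M} (hx : IsDiffAlgebraic K δ x) (hy : IsDiffAlgebraic K δ y) :
    IsDiffAlgebraic K δ (x / y) := by
  rw [div_eq_mul_inv]; exact hx.mul hy.inv

/-- An element whose derivative is algebraic over the element itself and a finitely generated
differential extension is differentially algebraic. -/
theorem of_derivation_mem {x : M} {s : Set M} (hs : s.Finite)
    (hδs : ∀ y ∈ s, δ y ∈ algHull K s) (hx : δ x ∈ algHull K (insert x s)) :
    IsDiffAlgebraic K δ x := by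
  refine ⟨insert x s, hs.insert x, ?_, subset_algHull _ (Set.mem_insert x s)⟩
  rintro y (rfl | hy)
  · exact hx
  · exact algHull_subset_algHull ((Set.subset_insert _ _).trans (subset_algHull _)) (hδs y hy)

theorem of_derivation {x : M} (hx : IsDiffAlgebraic K δ (δ x)) : IsDiffAlgebraic K δ x := by
  obtain ⟨s, hs, hδ, h1⟩ := hx
  exact of_derivation_mem hs hδ
    (algHull_subset_algHull ((Set.subset_insert _ _).trans (subset_algHull _)) h1)

theorem of_logDeriv {x : M} (hx0 : x ≠ 0) (hx : IsDiffAlgebraic K δ (δ x / x)) :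
    IsDiffAlgebraic K δ x := by
  obtain ⟨s, hs, hδ, h1⟩ := hx
  refine of_derivation_mem hs hδ ?_
  rw [← div_mul_cancel₀ (δ x) hx0]
  exact mul_mem (algHull_subset_algHull ((Set.subset_insert _ _).trans (subset_algHull _)) h1)
    (subset_algHull _ (Set.mem_insert x s))

theorem of_mem_algHull_singleton {x y : M} (hy : IsDiffAlgebraic K δ y)
    (hx : x ∈ algHull K {y}) : IsDiffAlgebraic K δ x := by
  obtain ⟨s, hs, hδ, h1⟩ := hy
  exact ⟨s, hs, hδ, algHull_subset_algHull (Set.singleton_subset_iff.2 h1) hx⟩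

theorem of_iterate {x : M} (k : ℕ) (hx : IsDiffAlgebraic K δ (δ^[k] x)) :
    IsDiffAlgebraic K δ x := by
  induction k with
  | zero => exact hx
  | succ k ih =>
    rw [Function.iterate_succ_apply'] at hx
    exact ih hx.of_derivation

theorem derivation [CharZero M] {x : M}
    (hK : ∀ c : K, δ (algebraMap K M c) ∈ Set.range (algebraMap K M))
    (hx : IsDiffAlgebraic K δ x) : IsDiffAlgebraic K δ (δ x) := by
  obtain ⟨s, hs, hδ, h1⟩ := hx
  exact ⟨s, hs, hδ, derivation_mem_algHull hK hδ h1⟩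

theorem iterate [CharZero M] {x : M}
    (hK : ∀ c : K, δ (algebraMap K M c) ∈ Set.range (algebraMap K M))
    (hx : IsDiffAlgebraic K δ x) (k : ℕ) : IsDiffAlgebraic K δ (δ^[k] x) := by
  induction k with
  | zero => exact hx
  | succ k ih =>
    rw [Function.iterate_succ_apply']
    exact ih.derivation hK

/-- If some derivative is algebraic over the preceding ones, then these generate, up to algebraic
extension, a differential field. -/
theorem of_not_algebraicIndependent {x : M}
    (hx : ¬ AlgebraicIndependent K fun j : ℕ => δ^[j] x) : IsDiffAlgebraic K δ x := by
  by_contra hDA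
  have htr : ∀ n : ℕ, Transcendental (Algebra.adjoin K ((fun j : ℕ => δ^[j] x) '' Set.Iio n))
      (δ^[n] x) := by
    intro n hn
    have hmem : ∀ j ≤ n, δ^[j] x ∈ algHull K ((fun j : ℕ => δ^[j] x) '' Set.Iio n) := by
      intro j hj
      rcases hj.lt_or_eq with hj | rfl
      · exact subset_algHull _ ⟨j, hj, rfl⟩
      · exact hn
    refine hDA ⟨_, (Set.finite_Iio n).image _, ?_, hmem 0 n.zero_le⟩
    rintro _ ⟨j, hj, rfl⟩
    simp only [← Function.iterate_succ_apply' (⇑δ)]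
    exact hmem (j + 1) hj
  have hind : ∀ n : ℕ, AlgebraicIndepOn K (fun j : ℕ => δ^[j] x) (Set.Iio n) := by
    intro n
    induction n with
    | zero =>
      rw [show Set.Iio 0 = (∅ : Set ℕ) by simp]
      exact algebraicIndependent_empty_type_iff.2 (algebraMap K M).injective
    | succ n ih =>
      rw [show Set.Iio (n + 1) = insert n (Set.Iio n) by ext; simp]
      exact ih.insert (htr n)
  refine hx (algebraicIndependent_of_finite_type fun t ht => ?_)
  obtain ⟨n, hn⟩ := ht.bddAbove
  exact (hind (n + 1)).mono fun j hj => Nat.lt_succ_of_le (hn hj)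

/-- All derivatives of `x` lie in an extension of finite transcendence degree. -/
theorem not_algebraicIndependent [CharZero M] {x : M}
    (hK : ∀ c : K, δ (algebraMap K M c) ∈ Set.range (algebraMap K M))
    (hx : IsDiffAlgebraic K δ x) : ¬ AlgebraicIndependent K fun j : ℕ => δ^[j] x := by
  intro hind
  obtain ⟨s, hs, hδ, h1⟩ := hx
  have hmem : ∀ j, δ^[j] x ∈ algHull K s := by
    intro j
    induction j with
    | zero => exact h1
    | succ j ih =>
      rw [Function.iterate_succ_apply']
      exact derivation_mem_algHull hK hδ ih
  have h2 : (AlgebraicIndependent.matroid K M).Indep (Set.range fun j : ℕ => δ^[j] x) :=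
    AlgebraicIndependent.matroid_indep_iff.2 hind.coe_range
  have h3 := h2.encard_le_eRk_of_subset (X := algHull K s) (by rintro _ ⟨j, rfl⟩; exact hmem j)
  rw [coe_algHull, Matroid.eRk_closure_eq,
    (Set.infinite_range_of_injective hind.injective).encard_eq] at h3
  exact absurd (h3.trans (Matroid.eRk_le_encard _ s)) (not_le.2 hs.encard_lt_top)

theorem pow {x : M} (hx : IsDiffAlgebraic K δ x) (n : ℕ) : IsDiffAlgebraic K δ (x ^ n) := by
  obtain ⟨s, hs, hδ, h1⟩ := hx
  exact ⟨s, hs, hδ, pow_mem h1 n⟩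

theorem aeval {x : M} (hx : IsDiffAlgebraic K δ x) (p : Polynomial K) :
    IsDiffAlgebraic K δ (Polynomial.aeval x p) := by
  induction p using Polynomial.induction_on' with
  | add p q hp hq => rw [map_add]; exact hp.add hq
  | monomial n c => rw [Polynomial.aeval_monomial]; exact (of_algebraMap c).mul (hx.pow n)

end IsDiffAlgebraic

/-- The value `y` of a nonconstant rational function at `x` determines `x` up to algebraic
dependence. -/
theorem mem_algHull_singleton_of_mul_aeval_eq {k : Type*} [Field k] [Algebra k M] (φ : k →+* K)
    (hφ : ∀ c, algebraMap K M (φ c) = algebraMap k M c) {p q : Polynomial k} (hq : q ≠ 0)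
    (hpq : ∀ c : k, p ≠ Polynomial.C c * q) {x y : M}
    (hxy : y * Polynomial.aeval x q = Polynomial.aeval x p) : x ∈ algHull K {y} := by
  have hyB : y ∈ Algebra.adjoin K ({y} : Set M) := Algebra.subset_adjoin rfl
  let ψ : k →+* Algebra.adjoin K ({y} : Set M) := (algebraMap K _).comp φ
  have hψ : ∀ c, algebraMap (Algebra.adjoin K ({y} : Set M)) M (ψ c) = algebraMap k M c :=
    fun c => hφ c
  have hψ' : (algebraMap (Algebra.adjoin K ({y} : Set M)) M).comp ψ = algebraMap k M :=
    RingHom.ext hψ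
  refine ⟨p.map ψ - Polynomial.C ⟨y, hyB⟩ * q.map ψ, fun h0 => ?_, ?_⟩
  · have hcoeff : ∀ i, algebraMap k M (p.coeff i) = y * algebraMap k M (q.coeff i) := fun i => by
      have h1 := congrArg (fun P => algebraMap (Algebra.adjoin K ({y} : Set M)) M
        (Polynomial.coeff P i)) h0
      simp only [Polynomial.coeff_sub, Polynomial.coeff_map, Polynomial.coeff_C_mul, map_sub,
        map_mul, hψ, Polynomial.coeff_zero, map_zero] at h1
      exact sub_eq_zero.1 h1
    have hlead : algebraMap k M q.leadingCoeff ≠ 0 := by simpa using hq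
    have hy : y = algebraMap k M (p.coeff q.natDegree / q.leadingCoeff) := by
      rw [map_div₀, eq_div_iff hlead]
      exact (hcoeff _).symm
    refine hpq (p.coeff q.natDegree / q.leadingCoeff) (Polynomial.ext fun i => ?_)
    refine (algebraMap k M).injective ?_
    rw [Polynomial.coeff_C_mul, map_mul, ← hy, hcoeff]
  · have haeval : ∀ r : Polynomial k, Polynomial.aeval x (r.map ψ) = Polynomial.aeval x r :=
      fun r => by rw [Polynomial.aeval_def, Polynomial.eval₂_map, hψ', Polynomial.aeval_def]
    rw [map_sub, map_mul, Polynomial.aeval_C, haeval, haeval, ← hxy]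
    exact sub_self _

end DifferentialAlgebra

/-! ### Small functions -/

theorem isLittleO_of_eventually_le {l : Filter ℝ} {φ ψ T : ℝ → ℝ} (h0 : ∀ᶠ r in l, 0 ≤ φ r)
    (h : ∀ᶠ r in l, φ r ≤ ψ r) (hψ : ψ =o[l] T) : φ =o[l] T := by
  refine IsBigO.trans_isLittleO (IsBigO.of_bound 1 ?_) hψ
  filter_upwards [h0, h] with r h1 h2
  rw [Real.norm_of_nonneg h1, Real.norm_of_nonneg (h1.trans h2), one_mul]
  exact h2

theorem isBigO_of_eventually_le {l : Filter ℝ} {φ ψ T : ℝ → ℝ} (h0 : ∀ᶠ r in l, 0 ≤ φ r)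
    (h : ∀ᶠ r in l, φ r ≤ ψ r) (hψ : ψ =O[l] T) : φ =O[l] T := by
  refine IsBigO.trans (IsBigO.of_bound 1 ?_) hψ
  filter_upwards [h0, h] with r h1 h2
  rw [Real.norm_of_nonneg h1, Real.norm_of_nonneg (h1.trans h2), one_mul]
  exact h2

theorem eventually_one_le_nevFilter : ∀ᶠ r in nevFilter, (1 : ℝ) ≤ r :=
  nevFilter_le_atTop (eventually_ge_atTop 1)

theorem isLittleO_const_nevFilter {T : ℝ → ℝ} (hT : Real.log =o[nevFilter] T) (c : ℝ) :
    (fun _ : ℝ => c) =o[nevFilter] T :=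
  ((isLittleO_const_left.2 (Or.inr (tendsto_norm_atTop_atTop.comp
    (Real.tendsto_log_atTop)))).mono nevFilter_le_atTop).trans hT

theorem tendsto_norm_nevFilter {T : ℝ → ℝ} (hT : Real.log =o[nevFilter] T) :
    Tendsto (fun r => ‖T r‖) nevFilter atTop := by
  refine tendsto_atTop_mono' _ ?_ (Real.tendsto_log_atTop.mono_left nevFilter_le_atTop)
  filter_upwards [hT.bound one_pos] with r hr
  rw [one_mul] at hr
  exact (le_abs_self _).trans hr

/-- The logarithm of a quantity of order `T` is of smaller order than `T`. -/
theorem isLittleO_log_add_two {T φ : ℝ → ℝ} (hT : Real.log =o[nevFilter] T)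
    (hφ : φ =O[nevFilter] T) (h0 : ∀ᶠ r in nevFilter, 0 ≤ φ r) :
    (fun r => Real.log (φ r + 2)) =o[nevFilter] T := by
  obtain ⟨C, hC, hφC⟩ := hφ.exists_pos
  have h1 : Tendsto (fun r => C * ‖T r‖ + 2) nevFilter atTop :=
    tendsto_atTop_add_const_right _ _ ((tendsto_norm_nevFilter hT).const_mul_atTop hC)
  have h2 : (fun r => Real.log (C * ‖T r‖ + 2)) =o[nevFilter] fun r => C * ‖T r‖ + 2 :=
    Real.isLittleO_log_id_atTop.comp_tendsto h1
  have h3 : (fun r => C * ‖T r‖ + 2) =O[nevFilter] T :=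
    ((isBigO_refl T nevFilter).norm_left.const_mul_left C).add
      (isLittleO_const_nevFilter hT 2).isBigO
  refine isLittleO_of_eventually_le ?_ ?_ (h2.trans_isBigO h3)
  · filter_upwards [h0] with r hr
    exact Real.log_nonneg (by linarith)
  · filter_upwards [h0, hφC.bound] with r hr hr'
    rw [Real.norm_of_nonneg hr] at hr'
    exact Real.log_le_log (by linarith) (by linarith)

namespace Mer

theorem eventually_T_nonneg (x : Mer) : ∀ᶠ r in nevFilter, 0 ≤ x.T r :=
  eventually_one_le_nevFilter.mono fun _ hr => x.T_nonneg hr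

variable {T : ℝ → ℝ}

theorem isLittleO_T_algebraMap (hT : Real.log =o[nevFilter] T) (c : ℂ) :
    (algebraMap ℂ Mer c).T =o[nevFilter] T :=
  (isLittleO_const_nevFilter hT (Real.posLog ‖c‖)).congr'
    (eventually_one_le_nevFilter.mono fun r hr => (T_algebraMap c (by linarith)).symm)
    EventuallyEq.rfl

theorem neg_eq_algebraMap_mul (x : Mer) : -x = algebraMap ℂ Mer (-1) * x := by
  rw [RingHom.map_neg, RingHom.map_one, neg_one_mul]

/-- The field of the meromorphic functions whose characteristic is `o(T)`. -/
noncomputable def smallField (T : ℝ → ℝ) (hT : Real.log =o[nevFilter] T) : Subfield Mer where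
  carrier := {x | x.T =o[nevFilter] T}
  mul_mem' := fun {x y} hx hy => isLittleO_of_eventually_le (eventually_T_nonneg _)
    (eventually_one_le_nevFilter.mono fun _ hr => T_mul_le x y hr)
    ((show x.T =o[nevFilter] T from hx).add hy)
  one_mem' := by
    have := isLittleO_T_algebraMap hT 1
    rwa [map_one] at this
  add_mem' := fun {x y} hx hy => isLittleO_of_eventually_le (eventually_T_nonneg _)
    (eventually_one_le_nevFilter.mono fun _ hr => T_add_le x y hr)
    (((show x.T =o[nevFilter] T from hx).add hy).add (isLittleO_const_nevFilter hT _))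
  zero_mem' := by
    have := isLittleO_T_algebraMap hT 0
    rwa [map_zero] at this
  neg_mem' := fun {x} hx => by
    have h1 := isLittleO_of_eventually_le (eventually_T_nonneg _)
      (eventually_one_le_nevFilter.mono fun _ hr => T_mul_le (algebraMap ℂ Mer (-1)) x hr)
      ((isLittleO_T_algebraMap hT (-1)).add (show x.T =o[nevFilter] T from hx))
    rwa [← neg_eq_algebraMap_mul] at h1
  inv_mem' := fun x hx => by
    obtain ⟨C, hC⟩ := exists_T_inv_le x
    exact isLittleO_of_eventually_le (eventually_T_nonneg _)
      (eventually_one_le_nevFilter.mono hC)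
      ((show x.T =o[nevFilter] T from hx).add (isLittleO_const_nevFilter hT C))

/-- The field of the meromorphic functions whose characteristic is `O(T)`. -/
noncomputable def bigField (T : ℝ → ℝ) (hT : Real.log =o[nevFilter] T) : Subfield Mer where
  carrier := {x | x.T =O[nevFilter] T}
  mul_mem' := fun {x y} hx hy => isBigO_of_eventually_le (eventually_T_nonneg _)
    (eventually_one_le_nevFilter.mono fun _ hr => T_mul_le x y hr)
    ((show x.T =O[nevFilter] T from hx).add hy)
  one_mem' := (smallField T hT).one_mem.isBigO
  add_mem' := fun {x y} hx hy => isBigO_of_eventually_le (eventually_T_nonneg _)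
    (eventually_one_le_nevFilter.mono fun _ hr => T_add_le x y hr)
    (((show x.T =O[nevFilter] T from hx).add hy).add (isLittleO_const_nevFilter hT _).isBigO)
  zero_mem' := (smallField T hT).zero_mem.isBigO
  neg_mem' := fun {x} hx => by
    have h1 := isBigO_of_eventually_le (eventually_T_nonneg _)
      (eventually_one_le_nevFilter.mono fun _ hr => T_mul_le (algebraMap ℂ Mer (-1)) x hr)
      ((isLittleO_T_algebraMap hT (-1)).isBigO.add (show x.T =O[nevFilter] T from hx))
    rwa [← neg_eq_algebraMap_mul] at h1
  inv_mem' := fun x hx => by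
    obtain ⟨C, hC⟩ := exists_T_inv_le x
    exact isBigO_of_eventually_le (eventually_T_nonneg _)
      (eventually_one_le_nevFilter.mono hC)
      ((show x.T =O[nevFilter] T from hx).add (isLittleO_const_nevFilter hT C).isBigO)

variable {hT : Real.log =o[nevFilter] T}

theorem mem_smallField {x : Mer} : x ∈ smallField T hT ↔ x.T =o[nevFilter] T := Iff.rfl

theorem mem_bigField {x : Mer} : x ∈ bigField T hT ↔ x.T =O[nevFilter] T := Iff.rfl

theorem smallField_le_bigField : smallField T hT ≤ bigField T hT := fun _ hx =>
  IsLittleO.isBigO hx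

theorem isLittleO_m_of_mem_smallField {x : Mer} (hx : x ∈ smallField T hT) :
    x.m =o[nevFilter] T :=
  isLittleO_of_eventually_le (Eventually.of_forall x.m_nonneg)
    (eventually_one_le_nevFilter.mono fun _ hr => le_add_of_nonneg_right (x.N_nonneg hr)) hx

/-- The ring of the meromorphic functions whose proximity function is `o(T)`. -/
noncomputable def proxRing (T : ℝ → ℝ) (hT : Real.log =o[nevFilter] T) : Subring Mer where
  carrier := {x | x.m =o[nevFilter] T}
  mul_mem' := fun {x y} hx hy => isLittleO_of_eventually_le (Eventually.of_forall (m_nonneg _))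
    (eventually_one_le_nevFilter.mono fun _ hr => m_mul_le x y hr)
    ((show x.m =o[nevFilter] T from hx).add hy)
  one_mem' := isLittleO_m_of_mem_smallField (smallField T hT).one_mem
  add_mem' := fun {x y} hx hy => isLittleO_of_eventually_le (Eventually.of_forall (m_nonneg _))
    (eventually_one_le_nevFilter.mono fun _ hr => m_add_le x y hr)
    (((show x.m =o[nevFilter] T from hx).add hy).add (isLittleO_const_nevFilter hT _))
  zero_mem' := isLittleO_m_of_mem_smallField (smallField T hT).zero_mem
  neg_mem' := fun {x} hx => by
    have h1 := isLittleO_of_eventually_le (Eventually.of_forall (m_nonneg _))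
      (eventually_one_le_nevFilter.mono fun _ hr => m_mul_le (-1) x hr)
      ((isLittleO_m_of_mem_smallField (hT := hT) (neg_mem (smallField T hT).one_mem)).add
        (show x.m =o[nevFilter] T from hx))
    rwa [neg_one_mul] at h1

theorem mem_proxRing {x : Mer} : x ∈ proxRing T hT ↔ x.m =o[nevFilter] T := Iff.rfl

theorem mem_proxRing_of_mem_smallField {x : Mer} (hx : x ∈ smallField T hT) :
    x ∈ proxRing T hT :=
  isLittleO_m_of_mem_smallField hx

theorem algebraMap_mem_smallField (c : ℂ) : algebraMap ℂ Mer c ∈ smallField T hT :=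
  isLittleO_T_algebraMap hT c

theorem D_div_mem_proxRing {x : Mer} (hx : x ∈ bigField T hT) : D x / x ∈ proxRing T hT := by
  rcases eq_or_ne x 0 with rfl | hx0
  · rw [div_zero]; exact zero_mem _
  obtain ⟨K, hK⟩ := exists_eventually_m_D_div_le hx0
  refine isLittleO_of_eventually_le (Eventually.of_forall (m_nonneg _)) hK ?_
  exact ((isLittleO_const_nevFilter hT K).add (hT.const_mul_left 6)).add
    ((isLittleO_log_add_two hT hx (eventually_T_nonneg x)).const_mul_left 8)

theorem T_D_le {x : Mer} (hx : x ≠ 0) {r : ℝ} (hr : 1 ≤ r) :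
    (D x).T r ≤ (D x / x).m r + 2 * x.T r := by
  have h1 := m_mul_le (D x / x) x hr
  rw [div_mul_cancel₀ _ hx] at h1
  rw [T_eq, T_eq]
  linarith [N_D_le x hr, x.m_nonneg r]

theorem D_mem_smallField {x : Mer} (hx : x ∈ smallField T hT) : D x ∈ smallField T hT := by
  rcases eq_or_ne x 0 with rfl | hx0
  · rw [map_zero]; exact zero_mem _
  exact isLittleO_of_eventually_le (eventually_T_nonneg _)
    (eventually_one_le_nevFilter.mono fun _ hr => T_D_le hx0 hr)
    ((mem_proxRing.1 (D_div_mem_proxRing (smallField_le_bigField hx))).add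
      (IsLittleO.const_mul_left hx 2))

theorem D_mem_bigField {x : Mer} (hx : x ∈ bigField T hT) : D x ∈ bigField T hT := by
  rcases eq_or_ne x 0 with rfl | hx0
  · rw [map_zero]; exact zero_mem _
  exact isBigO_of_eventually_le (eventually_T_nonneg _)
    (eventually_one_le_nevFilter.mono fun _ hr => T_D_le hx0 hr)
    ((mem_proxRing.1 (D_div_mem_proxRing hx)).isBigO.add (IsBigO.const_mul_left hx 2))

theorem D_iterate_mem_smallField {x : Mer} (hx : x ∈ smallField T hT) (k : ℕ) :
    D^[k] x ∈ smallField T hT := by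
  induction k with
  | zero => exact hx
  | succ k ih => rw [Function.iterate_succ_apply']; exact D_mem_smallField ih

theorem D_iterate_mem_bigField {x : Mer} (hx : x ∈ bigField T hT) (k : ℕ) :
    D^[k] x ∈ bigField T hT := by
  induction k with
  | zero => exact hx
  | succ k ih => rw [Function.iterate_succ_apply']; exact D_mem_bigField ih

theorem D_iterate_div_mem_proxRing {x : Mer} (hx : x ∈ bigField T hT) (k : ℕ) :
    D^[k] x / x ∈ proxRing T hT := by
  induction k with
  | zero =>
    rcases eq_or_ne x 0 with rfl | hx0
    · simp
    · rw [Function.iterate_zero_apply, div_self hx0]; exact one_mem _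
  | succ k ih =>
    rw [Function.iterate_succ_apply']
    rcases eq_or_ne (D^[k] x) 0 with h0 | h0
    · rw [h0, map_zero, zero_div]; exact zero_mem _
    · rw [← div_mul_div_cancel₀ h0]
      exact mul_mem (D_div_mem_proxRing (D_iterate_mem_bigField hx k)) ih

/-! ### Expansion around small functions -/

/-- Where `h` is large its inverse is small, and where `h` is small a polynomial in `h` is
controlled by its coefficients. -/
theorem m_inv_le_of_eq_sum {h : Mer} {n : ℕ} {a : ℕ → Mer}
    (ha : h⁻¹ = ∑ i ∈ Finset.range n, a i * h ^ i) {r : ℝ} (hr : 1 ≤ r) :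
    h⁻¹.m r ≤ ∑ i ∈ Finset.range n, (a i).m r + Real.log n := by
  have hr0 : r ≠ 0 := by linarith
  let h' : merAlgebra := ⟨h.rep, h.meromorphic_rep⟩
  let a' : ℕ → merAlgebra := fun i => ⟨(a i).rep, (a i).meromorphic_rep⟩
  have hh : Ideal.Quotient.mk merIdeal h' = h := mk_rep h
  have haa : ∀ i, Ideal.Quotient.mk merIdeal (a' i) = a i := fun i => mk_rep (a i)
  have h1 : h⁻¹ = Ideal.Quotient.mk merIdeal (∑ i ∈ Finset.range n, a' i * h' ^ i) := by
    rw [map_sum, ha]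
    refine Finset.sum_congr rfl fun i _ => ?_
    rw [map_mul, map_pow, hh, haa]
  have h2 : MerEq h.rep⁻¹ (∑ i ∈ Finset.range n, a' i * h' ^ i : merAlgebra) := by
    refine (mk_eq_mk (hf := h.meromorphic_rep.inv)
      (hg := (∑ i ∈ Finset.range n, a' i * h' ^ i : merAlgebra).2)).1 ?_
    rw [mk_inv h.meromorphic_rep, mk_rep]
    exact h1
  have h3 : h⁻¹.m r = ValueDistribution.proximity h.rep⁻¹ ⊤ r := by
    have := m_mk h.meromorphic_rep.inv hr0
    rwa [mk_inv h.meromorphic_rep, mk_rep] at this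
  have hI : ∀ i ∈ Finset.range n,
      CircleIntegrable (fun z => Real.posLog ‖(a i).rep z‖) 0 r := fun i _ =>
    (a i).meromorphic_rep.meromorphicOn.circleIntegrable_posLog_norm
  have hIs : CircleIntegrable (∑ i ∈ Finset.range n, fun z => Real.posLog ‖(a i).rep z‖) 0 r :=
    CircleIntegrable.sum _ hI
  have h4 : ∑ i ∈ Finset.range n, (a i).m r + Real.log n = Real.circleAverage
      ((∑ i ∈ Finset.range n, fun z => Real.posLog ‖(a i).rep z‖) + fun _ => Real.log n) 0 r := by
    rw [Real.circleAverage_add hIs (circleIntegrable_const _ _ _), Real.circleAverage_const,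
      Real.circleAverage_sum hI]
    simp [m, ValueDistribution.proximity_top]
  rw [h3, h4, ValueDistribution.proximity_top]
  refine Real.circleAverage_mono_codiscreteWithin hr0
    h.meromorphic_rep.inv.meromorphicOn.circleIntegrable_posLog_norm
    (hIs.add (circleIntegrable_const _ _ _)) ?_
  filter_upwards [codiscreteWithin_mono (Set.subset_univ _) h2] with z hz
  have hlog : 0 ≤ Real.log n := Real.log_natCast_nonneg n
  simp only [Pi.add_apply, Finset.sum_apply]
  rcases le_total ‖h.rep z‖ 1 with h5 | h5
  · have h6 : h.rep⁻¹ z = ∑ i ∈ Finset.range n, (a i).rep z * h.rep z ^ i := by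
      rw [hz]; simp [a', h']
    have h7 : ‖h.rep⁻¹ z‖ ≤ ∑ i ∈ Finset.range n, ‖(a i).rep z‖ := by
      rw [h6]
      refine (norm_sum_le _ _).trans (Finset.sum_le_sum fun i _ => ?_)
      rw [norm_mul, norm_pow]
      exact mul_le_of_le_one_right (norm_nonneg _) (pow_le_one₀ (norm_nonneg _) h5)
    refine (Real.posLog_le_posLog (norm_nonneg _) h7).trans ?_
    have h8 := Real.posLog_sum (Finset.range n) (fun i => ‖(a i).rep z‖)
    rw [Finset.card_range] at h8
    linarith
  · have h6 : Real.posLog ‖h.rep⁻¹ z‖ = 0 := by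
      rw [Real.posLog_eq_zero_iff, Pi.inv_apply, norm_inv, abs_inv, abs_norm]
      exact inv_le_one_of_one_le₀ h5
    rw [h6]
    exact add_nonneg (Finset.sum_nonneg fun _ _ => Real.posLog_nonneg) hlog

theorem inv_mem_proxRing_of_eval₂ {h : Mer} (A : Polynomial (proxRing T hT))
    (hA : h⁻¹ = A.eval₂ (proxRing T hT).subtype h) : h⁻¹ ∈ proxRing T hT := by
  rw [Polynomial.eval₂_eq_sum_range] at hA
  refine isLittleO_of_eventually_le (Eventually.of_forall (m_nonneg _))
    (eventually_one_le_nevFilter.mono fun r hr => m_inv_le_of_eq_sum hA hr) ?_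
  refine IsLittleO.add ?_ (isLittleO_const_nevFilter hT _)
  exact (IsLittleO.sum fun i _ => mem_proxRing.1 (A.coeff i).2).congr_left fun r =>
    Finset.sum_apply r _ _

/-- **Mokhon'ko's lemma**. If a polynomial relation holds at `y + h l`, but not at the small
functions `y`, then the mean `m(r, 1 / h)` is `o(T)`. Expansion in powers of `h` has the nonzero
constant term `P(y)`; division by `h P(y)` expresses `h⁻¹` as a polynomial in `h`. -/
theorem inv_mem_proxRing_of_aeval {K : Subfield Mer} (hK : K ≤ smallField T hT)
    (P : MvPolynomial ℕ K) {x y l : ℕ → Mer} {h : Mer} (hh : h ≠ 0)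
    (hy : ∀ j, y j ∈ smallField T hT) (hl : ∀ j, l j ∈ proxRing T hT)
    (hx : ∀ j, x j = y j + h * l j) (hPx : MvPolynomial.aeval x P = 0)
    (hPy : MvPolynomial.aeval y P ≠ 0) : h⁻¹ ∈ proxRing T hT := by
  let i : K →+* proxRing T hT :=
    { toFun := fun c => ⟨c, mem_proxRing_of_mem_smallField (hK c.2)⟩
      map_one' := rfl
      map_mul' := fun _ _ => rfl
      map_zero' := rfl
      map_add' := fun _ _ => rfl }
  let y' : ℕ → proxRing T hT := fun j => ⟨y j, mem_proxRing_of_mem_smallField (hy j)⟩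
  let l' : ℕ → proxRing T hT := fun j => ⟨l j, hl j⟩
  let Q : Polynomial (proxRing T hT) := P.eval₂ (Polynomial.C.comp i)
    fun j => Polynomial.C (y' j) + Polynomial.X * Polynomial.C (l' j)
  have hQ : ∀ t : Mer, Q.eval₂ (proxRing T hT).subtype t
      = MvPolynomial.aeval (fun j => y j + t * l j) P := by
    intro t
    rw [← Polynomial.coe_eval₂RingHom, MvPolynomial.hom_eval₂, MvPolynomial.aeval_def]
    congr 1
    · ext c; simp [i]; rfl
    · ext j; simp [y', l']; exact mul_comm _ _
  have hQh : Q.eval₂ (proxRing T hT).subtype h = 0 := by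
    rw [hQ, ← hPx]; congr 2; ext j; rw [hx]
  have hQ0 : ((Q.coeff 0 : proxRing T hT) : Mer) = MvPolynomial.aeval y P := by
    have := hQ 0
    rw [Polynomial.eval₂_at_zero] at this
    simpa using this
  have hinv : (MvPolynomial.aeval y P)⁻¹ ∈ smallField T hT := by
    refine inv_mem ?_
    rw [MvPolynomial.aeval_def, MvPolynomial.eval₂_eq]
    exact sum_mem fun m _ => mul_mem (hK (P.coeff m).2) (prod_mem fun j _ => pow_mem (hy j) _)
  refine inv_mem_proxRing_of_eval₂
    (-Polynomial.C ⟨_, mem_proxRing_of_mem_smallField hinv⟩ * Q.divX) ?_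
  have hdiv := congrArg (Polynomial.eval₂ (proxRing T hT).subtype h) (Polynomial.divX_mul_X_add Q)
  rw [hQh, Polynomial.eval₂_add, Polynomial.eval₂_mul, Polynomial.eval₂_X, Polynomial.eval₂_C] at hdiv
  rw [Polynomial.eval₂_mul, Polynomial.eval₂_neg, Polynomial.eval₂_C]
  change _ + ((Q.coeff 0 : proxRing T hT) : Mer) = 0 at hdiv
  rw [hQ0] at hdiv
  change _ = -(MvPolynomial.aeval y P)⁻¹ * _
  field_simp
  linear_combination hdiv

end Mer

/-! ### Hypertranscendence and differentially algebraic elements -/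

namespace Mer

instance : CharZero Mer := charZero_of_injective_algebraMap (algebraMap ℂ Mer).injective

theorem mk_mem_smallField_iff {F f : ℂ → ℂ} {hF : Real.log =o[nevFilter] nevT F}
    (hf : Meromorphic f) : mk f hf ∈ smallField (nevT F) hF ↔ f ∈ smallFunctions F := by
  rw [mem_smallField, smallFunctions, Set.mem_ofPred_eq, isNevS_iff_isLittleO]
  have h : (mk f hf).T =ᶠ[nevFilter] nevT f :=
    eventually_one_le_nevFilter.mono fun r hr => T_mk hf (by linarith)
  exact ⟨fun h1 => ⟨hf, h1.congr' h EventuallyEq.rfl⟩, fun h1 => h1.2.congr' h.symm EventuallyEq.rfl⟩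

theorem meromorphic_iteratedDeriv {f : ℂ → ℂ} (hf : Meromorphic f) (k : ℕ) :
    Meromorphic (iteratedDeriv k f) := by
  rw [iteratedDeriv_eq_iterate]; exact hf.iterated_deriv

theorem D_iterate_mk {f : ℂ → ℂ} (hf : Meromorphic f) (k : ℕ) :
    D^[k] (mk f hf) = mk (iteratedDeriv k f) (meromorphic_iteratedDeriv hf k) := by
  induction k with
  | zero => simp
  | succ k ih =>
    rw [Function.iterate_succ_apply', ih, D_mk, mk_eq_mk, iteratedDeriv_succ]
    exact EventuallyEq.rfl

/-- A differential polynomial with meromorphic coefficients, evaluated in the field `Mer`. -/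
theorem exists_mk_evalDiff {P : MvPolynomial ℕ (ℂ → ℂ)} (hP : ∀ I, Meromorphic (P.coeff I))
    {w : ℂ → ℂ} (hw : Meromorphic w) : ∃ P' : MvPolynomial ℕ Mer,
      (∀ I, P'.coeff I = mk (P.coeff I) (hP I)) ∧
      (MerEq (evalDiff P w) 0 ↔ MvPolynomial.eval (fun j => D^[j] (mk w hw)) P' = 0) := by
  obtain ⟨P₀, rfl⟩ : ∃ P₀ : MvPolynomial ℕ merAlgebra,
      MvPolynomial.map (merAlgebra.val : merAlgebra →+* (ℂ → ℂ)) P₀ = P := by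
    refine MvPolynomial.mem_range_map_iff_coeffs_subset.2 ?_
    intro c hc
    obtain ⟨I, _, rfl⟩ := MvPolynomial.mem_coeffs_iff.1 hc
    exact ⟨⟨_, hP I⟩, rfl⟩
  refine ⟨P₀.map (Ideal.Quotient.mk merIdeal), fun I => ?_, ?_⟩
  · rw [MvPolynomial.coeff_map, mk]
    congr 1
  · let x : ℕ → merAlgebra := fun j => ⟨iteratedDeriv j w, meromorphic_iteratedDeriv hw j⟩
    have h1 : evalDiff (MvPolynomial.map (merAlgebra.val : merAlgebra →+* (ℂ → ℂ)) P₀) w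
        = (MvPolynomial.eval x P₀ : merAlgebra) := by
      rw [evalDiff, MvPolynomial.eval_map]
      exact (MvPolynomial.eval₂_comp (merAlgebra.val : merAlgebra →+* (ℂ → ℂ)) x P₀).symm
    have h2 : MvPolynomial.eval (fun j => D^[j] (mk w hw)) (P₀.map (Ideal.Quotient.mk merIdeal))
        = Ideal.Quotient.mk merIdeal (MvPolynomial.eval x P₀) := by
      rw [MvPolynomial.eval_map, MvPolynomial.eval₂_comp]
      congr 1
      funext j
      exact D_iterate_mk hw j
    rw [h1, h2]
    exact (Ideal.Quotient.eq_zero_iff_mem (I := merIdeal)).symm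

/-- Hypertranscendence in terms of polynomials over the field `Mer`. -/
theorem eval_ne_zero_of_hypertranscendental {S : Set (ℂ → ℂ)} (h0 : (0 : ℂ → ℂ) ∈ S) {w : ℂ → ℂ}
    (hw : Hypertranscendental S w) {P : MvPolynomial ℕ Mer} (hP : ∀ I, (P.coeff I).rep ∈ S)
    (hP0 : P ≠ 0) : MvPolynomial.eval (fun j => D^[j] (mk w hw.1)) P ≠ 0 := by
  classical
  let Q : MvPolynomial ℕ (ℂ → ℂ) := ∑ I ∈ P.support, MvPolynomial.monomial I (P.coeff I).rep
  have hQ : ∀ I, Q.coeff I = if I ∈ P.support then (P.coeff I).rep else 0 := fun I => by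
    simp [Q, MvPolynomial.coeff_sum, MvPolynomial.coeff_monomial]
  have hQS : HasCoeffsIn S Q := fun I => by
    rw [hQ]
    split_ifs
    · exact hP I
    · exact h0
  have hQm : ∀ I, Meromorphic (Q.coeff I) := fun I => by
    rw [hQ]
    split_ifs
    · exact meromorphic_rep _
    · exact meromorphic_fun_const 0
  obtain ⟨P', hP', hiff⟩ := exists_mk_evalDiff hQm hw.1
  have hPP : P' = P := by
    refine MvPolynomial.ext _ _ fun I => ?_
    rw [hP', ← mk_rep (P.coeff I), mk_eq_mk, hQ]
    split_ifs with hI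
    · exact EventuallyEq.rfl
    · rw [MvPolynomial.notMem_support_iff.1 hI]
      exact (mk_eq_zero.1 (mk_rep 0)).symm
  rw [hPP] at hiff
  rw [Ne, ← hiff]
  refine hw.2 Q hQS ?_
  obtain ⟨I, hI⟩ := MvPolynomial.ne_zero_iff.1 hP0
  refine ⟨I, fun h => hI ?_⟩
  rw [← hPP, hP', mk_eq_zero]
  exact h

theorem D_algebraMap_mem_range {T : ℝ → ℝ} {hT : Real.log =o[nevFilter] T}
    (c : smallField T hT) : D (algebraMap (smallField T hT) Mer c) ∈
      Set.range (algebraMap (smallField T hT) Mer) :=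
  ⟨⟨_, D_mem_smallField c.2⟩, rfl⟩

theorem not_isDiffAlgebraic_of_hypertranscendental {F f : ℂ → ℂ}
    {hF : Real.log =o[nevFilter] nevT F} (hf : Hypertranscendental (smallFunctions F) f) :
    ¬ IsDiffAlgebraic (smallField (nevT F) hF) D (mk f hf.1) := by
  intro hDA
  have hnot := hDA.not_algebraicIndependent D_algebraMap_mem_range
  rw [algebraicIndependent_iff] at hnot
  push Not at hnot
  obtain ⟨P, hP, hP0⟩ := hnot
  rw [MvPolynomial.aeval_def, MvPolynomial.eval₂_eq_eval_map] at hP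
  have h0 : (0 : ℂ → ℂ) ∈ smallFunctions F :=
    (mk_mem_smallField_iff (hF := hF) (meromorphic_fun_const 0)).1
      (smallField (nevT F) hF).zero_mem
  refine eval_ne_zero_of_hypertranscendental h0 hf (fun I => ?_) ?_ hP
  · rw [MvPolynomial.coeff_map, ← mk_mem_smallField_iff (hF := hF) (meromorphic_rep _), mk_rep]
    exact (P.coeff I).2
  · exact (map_ne_zero_iff _
      (MvPolynomial.map_injective _ (algebraMap (smallField (nevT F) hF) Mer).injective)).2 hP0

/-- An algebraic differential equation with small coefficients, as a polynomial over the field of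
small functions. -/
theorem exists_mvPolynomial_smallField {F : ℂ → ℂ} {hF : Real.log =o[nevFilter] nevT F}
    {P : MvPolynomial ℕ (ℂ → ℂ)} (hP : HasCoeffsIn (smallFunctions F) P) {w : ℂ → ℂ}
    (hw : Meromorphic w) (h0 : MerEq (evalDiff P w) 0) :
    ∃ Q : MvPolynomial ℕ (smallField (nevT F) hF),
      (∀ I, Q.coeff I = 0 ↔ MerEq (P.coeff I) 0) ∧
        MvPolynomial.aeval (fun j => D^[j] (mk w hw)) Q = 0 := by
  obtain ⟨P', hP', hiff⟩ := exists_mk_evalDiff (fun I => (hP I).1) hw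
  obtain ⟨Q, rfl⟩ : ∃ Q, MvPolynomial.map (algebraMap (smallField (nevT F) hF) Mer) Q = P' := by
    refine MvPolynomial.mem_range_map_iff_coeffs_subset.2 ?_
    intro c hc
    obtain ⟨I, _, rfl⟩ := MvPolynomial.mem_coeffs_iff.1 hc
    refine ⟨⟨_, ?_⟩, rfl⟩
    change MvPolynomial.coeff I P' ∈ smallField (nevT F) hF
    rw [hP']
    exact (mk_mem_smallField_iff _).2 (hP I)
  refine ⟨Q, fun I => ?_, ?_⟩
  · rw [← mk_eq_zero (hf := (hP I).1), ← hP', MvPolynomial.coeff_map,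
      map_eq_zero_iff _ (algebraMap (smallField (nevT F) hF) Mer).injective]
  · rw [MvPolynomial.aeval_def, MvPolynomial.eval₂_eq_eval_map]
    exact hiff.1 h0

theorem hypertranscendental_of_not_isDiffAlgebraic {F w : ℂ → ℂ}
    (hF : Real.log =o[nevFilter] nevT F) (hw : Meromorphic w)
    (h : ¬ IsDiffAlgebraic (smallField (nevT F) hF) D (mk w hw)) :
    Hypertranscendental (smallFunctions F) w := by
  refine ⟨hw, fun P hP ⟨I, hI⟩ h0 => h (IsDiffAlgebraic.of_not_algebraicIndependent fun hind => ?_)⟩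
  obtain ⟨Q, hQ, hQ0⟩ := exists_mvPolynomial_smallField (hF := hF) hP hw h0
  rw [algebraicIndependent_iff] at hind
  exact hI ((hQ I).1 (by rw [hind Q hQ0, MvPolynomial.coeff_zero]))

theorem algebraMap_rep_mem_smallFunctions (F : ℂ → ℂ) {c : ℂ} (hc : ‖c‖ ≤ 1) :
    (algebraMap ℂ Mer c).rep ∈ smallFunctions F := by
  refine ⟨meromorphic_rep _, isNevS_iff_isLittleO.2 ?_⟩
  refine (isLittleO_zero _ _).congr' ?_ EventuallyEq.rfl
  filter_upwards [eventually_one_le_nevFilter] with r hr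
  change 0 = (algebraMap ℂ Mer c).T r
  rw [T_algebraMap c (by linarith), eq_comm, Real.posLog_eq_zero_iff, abs_norm]
  exact hc

/-- A hypertranscendental function satisfies no differential equation with constant coefficients,
whatever the growth of `F`. The constants of modulus at most `1` have zero characteristic, and thus
are always small; relations with arbitrary constant coefficients reduce to these by scaling. -/
theorem not_isDiffAlgebraic_complex {F f : ℂ → ℂ}
    (hf : Hypertranscendental (smallFunctions F) f) : ¬ IsDiffAlgebraic ℂ D (mk f hf.1) := by
  intro hDA
  have hnot := hDA.not_algebraicIndependent fun c => ⟨0, by simp⟩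
  rw [algebraicIndependent_iff] at hnot
  push Not at hnot
  obtain ⟨P, hP, hP0⟩ := hnot
  obtain ⟨B, hB⟩ := P.coeffs.finite_toSet.isBounded.exists_norm_le
  have hB0 : 0 < max B 1 := zero_lt_one.trans_le (le_max_right _ _)
  set b : ℂ := ((max B 1 : ℝ) : ℂ)⁻¹ with hb
  have hb0 : b ≠ 0 := inv_ne_zero (by exact_mod_cast hB0.ne')
  have h0 : (0 : ℂ → ℂ) ∈ smallFunctions F := by
    refine ⟨meromorphic_fun_const 0, isNevS_iff_isLittleO.2 ?_⟩
    refine (isLittleO_zero _ _).congr' ?_ EventuallyEq.rfl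
    filter_upwards with r
    change 0 = ValueDistribution.characteristic (fun _ : ℂ => (0 : ℂ)) ⊤ r
    simp [ValueDistribution.characteristic]
  refine eval_ne_zero_of_hypertranscendental h0 hf
    (P := MvPolynomial.map (algebraMap ℂ Mer) (MvPolynomial.C b * P)) (fun I => ?_) ?_ ?_
  · rw [MvPolynomial.coeff_map, MvPolynomial.coeff_C_mul]
    refine algebraMap_rep_mem_smallFunctions F ?_
    rcases eq_or_ne (P.coeff I) 0 with h | h
    · simp [h]
    · have h1 : ‖P.coeff I‖ ≤ max B 1 := (hB _ (MvPolynomial.coeff_mem_coeffs I h)).trans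
        (le_max_left _ _)
      rw [norm_mul, hb, norm_inv, Complex.norm_real, Real.norm_of_nonneg hB0.le,
        inv_mul_le_one₀ hB0]
      exact h1
  · refine (map_ne_zero_iff _ (MvPolynomial.map_injective _ (algebraMap ℂ Mer).injective)).2 ?_
    exact mul_ne_zero (MvPolynomial.C_ne_zero.2 hb0) hP0
  · rw [← MvPolynomial.eval₂_eq_eval_map, ← MvPolynomial.aeval_def, map_mul, hP, mul_zero]

/-- Composition with a polynomial is its evaluation in the field `Mer`. -/
theorem mk_polynomial_eval {f : ℂ → ℂ} (hf : Meromorphic f) (p : Polynomial ℂ) :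
    ∃ h : Meromorphic fun z => p.eval (f z),
      mk (fun z => p.eval (f z)) h = Polynomial.aeval (mk f hf) p := by
  let f' : merAlgebra := ⟨f, hf⟩
  have h1 : ((Polynomial.aeval f' p : merAlgebra) : ℂ → ℂ) = fun z => p.eval (f z) := by
    have h2 := Polynomial.aeval_algHom_apply merAlgebra.val f' p
    funext z
    have h3 := Polynomial.aeval_algHom_apply (Pi.evalAlgHom ℂ (fun _ : ℂ => ℂ) z) f p
    change merAlgebra.val (Polynomial.aeval f' p) z = _
    rw [← h2]
    change Pi.evalAlgHom ℂ (fun _ : ℂ => ℂ) z (Polynomial.aeval f p) = _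
    rw [← h3]
    rfl
  have h4 : Meromorphic fun z => p.eval (f z) := h1 ▸ (Polynomial.aeval f' p : merAlgebra).2
  refine ⟨h4, ?_⟩
  have h5 := Polynomial.aeval_algHom_apply (Ideal.Quotient.mkₐ ℂ merIdeal) f' p
  have h6 : mk (fun z => p.eval (f z)) h4
      = Ideal.Quotient.mkₐ ℂ merIdeal (Polynomial.aeval f' p) := by
    rw [mk]
    exact congrArg (Ideal.Quotient.mk merIdeal) (Subtype.ext h1.symm)
  rw [h6, ← h5]
  rfl

theorem isDiffAlgebraic_of_isRational {F : ℂ → ℂ} (hF : Meromorphic F) (h : IsRational F) :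
    IsDiffAlgebraic ℂ D (mk F hF) := by
  obtain ⟨p, q, hq, hpq⟩ := h
  have hid : Meromorphic fun z : ℂ => z := differentiable_id.meromorphic
  have hZ : IsDiffAlgebraic ℂ D (mk (fun z => z) hid) := by
    refine IsDiffAlgebraic.of_derivation ?_
    have h1 : D (mk (fun z => z) hid) = algebraMap ℂ Mer 1 := by
      rw [D_mk, ← mk_const, mk_eq_mk]
      exact Eventually.of_forall fun z => by simp
    rw [h1]
    exact .of_algebraMap 1
  obtain ⟨hp', hp⟩ := mk_polynomial_eval hid p
  obtain ⟨hq', hq⟩ := mk_polynomial_eval hid q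
  have h2 : mk F hF = mk _ hp' / mk _ hq' := by
    rw [← mk_div, mk_eq_mk]
    exact hpq
  rw [h2, hp, hq]
  exact (hZ.aeval p).div (hZ.aeval q)

end Mer

/-- A function that exceeds every multiple of the unbounded function `φ`, up to constants, has
larger order. -/
theorem isLittleO_of_forall_mul_le {l : Filter ℝ} {φ T : ℝ → ℝ} (hφ : Tendsto φ l atTop)
    (h : ∀ m : ℕ, ∃ C, ∀ᶠ r in l, m * φ r ≤ T r + C) : φ =o[l] T := by
  refine isLittleO_iff.2 fun c hc => ?_
  obtain ⟨m, hm⟩ := exists_nat_ge c⁻¹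
  obtain ⟨C, hC⟩ := h (m + 1)
  filter_upwards [hC, hφ.eventually_ge_atTop (max C 0)] with r h1 h2
  have h3 : C ≤ φ r := (le_max_left _ _).trans h2
  have h4 : 0 ≤ φ r := (le_max_right _ _).trans h2
  have h5 : c⁻¹ * φ r ≤ T r := by
    push_cast at h1
    linarith [mul_le_mul_of_nonneg_right hm h4]
  rw [Real.norm_of_nonneg h4]
  have h6 := (h5.trans (le_abs_self _))
  rwa [inv_mul_le_iff₀ hc] at h6

theorem log_le_characteristic_id {r : ℝ} (hr : 1 ≤ r) :
    Real.log r ≤ ValueDistribution.characteristic (fun z : ℂ => z) ⊤ r := by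
  have h1 : ValueDistribution.proximity (fun z : ℂ => z) ⊤ r = Real.log r := by
    rw [ValueDistribution.proximity_top,
      Real.circleAverage_congr_sphere (f₂ := fun _ => Real.log r), Real.circleAverage_const]
    intro z hz
    rw [mem_sphere_zero_iff_norm] at hz
    change Real.posLog ‖z‖ = Real.log r
    rw [hz, abs_of_nonneg (by linarith), Real.posLog_eq_log (by rwa [abs_of_nonneg (by linarith)])]
  rw [← h1]
  exact le_add_of_nonneg_right (ValueDistribution.logCounting_nonneg hr)

/-- The case of the identity in `exists_mul_characteristic_le_comp`: the characteristic of a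
function that is not rational outgrows every multiple of `log r`. -/
theorem isLittleO_log_nevT {F : ℂ → ℂ} (hF : Meromorphic F) (hrat : ¬ IsRational F) :
    Real.log =o[nevFilter] nevT F := by
  refine isLittleO_of_forall_mul_le (Real.tendsto_log_atTop.mono_left nevFilter_le_atTop)
    fun m => ?_
  obtain ⟨C, hC⟩ := exists_mul_characteristic_le_comp differentiable_id hF hrat m
  refine ⟨C, eventually_one_le_nevFilter.mono fun r hr => le_trans ?_ (hC r hr)⟩
  exact mul_le_mul_of_nonneg_left (log_le_characteristic_id hr) m.cast_nonneg

/-! ### Compositions, products and sums -/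

namespace Mer

theorem D_iterate_sub (x y : Mer) (k : ℕ) : D^[k] (x - y) = D^[k] x - D^[k] y :=
  iterate_map_sub D k x y

theorem D_iterate_add (x y : Mer) (k : ℕ) : D^[k] (x + y) = D^[k] x + D^[k] y :=
  iterate_map_add D k x y

variable {T : ℝ → ℝ} {hT : Real.log =o[nevFilter] T}

/-- If `v` satisfies a differential equation and the small function `u` satisfies none, then
`m(r, 1 / h) = o(T)` for every `h` that divides `v - u` and its derivatives up to factors of small
proximity. -/
theorem inv_mem_proxRing_of_isDiffAlgebraic {K : Subfield Mer} (hK : K ≤ smallField T hT)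
    (hDK : ∀ c : K, D (algebraMap K Mer c) ∈ Set.range (algebraMap K Mer)) {u v h : Mer}
    (hv : IsDiffAlgebraic K D v) (hu : ¬ IsDiffAlgebraic K D u) (huT : u ∈ smallField T hT)
    (hl : ∀ j, D^[j] (v - u) / h ∈ proxRing T hT) : h⁻¹ ∈ proxRing T hT := by
  rcases eq_or_ne h 0 with rfl | hh
  · rw [inv_zero]; exact zero_mem _
  have hnot := hv.not_algebraicIndependent hDK
  rw [algebraicIndependent_iff] at hnot
  push Not at hnot
  obtain ⟨P, hP, hP0⟩ := hnot
  refine inv_mem_proxRing_of_aeval hK P hh (y := fun j => D^[j] u)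
    (fun j => D_iterate_mem_smallField huT j) hl (fun j => ?_) hP fun hPu => hP0 ?_
  · rw [mul_div_cancel₀ _ hh, D_iterate_sub, add_sub_cancel]
  · by_contra hne
    exact hu (IsDiffAlgebraic.of_not_algebraicIndependent fun hind =>
      hne ((algebraicIndependent_iff.1 hind) P hPu))

/-- The deficiency is a lower limit over all `r`, so it suffices that the quotient tends to zero
outside a set of finite measure. -/
theorem deficiency_le_zero {a G : ℂ → ℂ} (ha : Meromorphic a) (hG : Meromorphic G)
    {hT : Real.log =o[nevFilter] nevT G}
    (h : (mk G hG - mk a ha)⁻¹ ∈ proxRing (nevT G) hT) : deficiency a G ≤ 0 := by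
  have h1 : Tendsto (fun r => nevProx a G r / nevT G r) nevFilter (𝓝 0) := by
    refine ((mem_proxRing.1 h).congr' ?_ EventuallyEq.rfl).tendsto_div_nhds_zero
    filter_upwards [eventually_one_le_nevFilter] with r hr
    rw [← mk_sub hG ha, ← mk_inv, m_mk _ (by linarith)]
    rfl
  have h2 : Tendsto (fun r => ((nevProx a G r / nevT G r : ℝ) : EReal)) nevFilter (𝓝 0) :=
    (continuous_coe_real_ereal.tendsto 0).comp h1
  rw [deficiency, ← h2.liminf_eq]
  exact liminf_le_liminf_of_le nevFilter_le_atTop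

theorem eventually_nevT_ne_zero {T : ℝ → ℝ} (hT : Real.log =o[nevFilter] T) :
    ∀ᶠ r in nevFilter, T r ≠ 0 := by
  filter_upwards [(tendsto_norm_nevFilter hT).eventually_gt_atTop 0] with r hr
  exact norm_pos_iff.1 hr

/-- No function with `log r = o(T)` is small against its own characteristic `T`. -/
theorem mk_not_mem_smallField {G : ℂ → ℂ} (hG : Meromorphic G)
    {hT : Real.log =o[nevFilter] nevT G} : mk G hG ∉ smallField (nevT G) hT := fun h => by
  have h1 := ((mk_mem_smallField_iff hG).1 h).2
  rw [isNevS_iff_isLittleO] at h1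
  exact isLittleO_irrefl (eventually_nevT_ne_zero hT).frequently h1

theorem mk_mem_bigField {G : ℂ → ℂ} (hG : Meromorphic G)
    (hT : Real.log =o[nevFilter] nevT G) : mk G hG ∈ bigField (nevT G) hT :=
  EventuallyEq.isBigO (eventually_one_le_nevFilter.mono fun r hr => T_mk hG (by linarith))

theorem smallField_le_smallField {T₁ T₂ : ℝ → ℝ} {h₁ : Real.log =o[nevFilter] T₁}
    {h₂ : Real.log =o[nevFilter] T₂} (h : T₁ =O[nevFilter] T₂) :
    smallField T₁ h₁ ≤ smallField T₂ h₂ := fun _ hx =>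
  (mem_smallField.1 hx).trans_isBigO h

end Mer

open Mer

theorem mk_ne_zero_of_hypertranscendental {F f : ℂ → ℂ}
    (hyp : Hypertranscendental (smallFunctions F) f) : mk f hyp.1 ≠ 0 := fun h0 => by
  refine not_isDiffAlgebraic_complex hyp ?_
  rw [h0, ← map_zero (algebraMap ℂ Mer)]
  exact .of_algebraMap 0

theorem not_isRational_of_hypertranscendental {F f : ℂ → ℂ}
    (hyp : Hypertranscendental (smallFunctions F) f) : ¬ IsRational f := fun h =>
  not_isDiffAlgebraic_complex hyp (isDiffAlgebraic_of_isRational hyp.1 h)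

theorem not_isRational_logDeriv {f : ℂ → ℂ}
    (hyp : Hypertranscendental (smallFunctions fun z => deriv f z / f z) f) :
    ¬ IsRational fun z => deriv f z / f z := fun h => by
  refine not_isDiffAlgebraic_complex hyp
    (.of_logDeriv (mk_ne_zero_of_hypertranscendental hyp) ?_)
  rw [D_mk, ← mk_div]
  exact isDiffAlgebraic_of_isRational _ h

theorem nevT_logDeriv_isBigO {f : ℂ → ℂ} (hf : Meromorphic f)
    (hlog : Real.log =o[nevFilter] nevT f) :
    nevT (fun z => deriv f z / f z) =O[nevFilter] nevT f := by
  have h1 := mk_mem_bigField hf hlog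
  have h2 := div_mem (D_mem_bigField h1) h1
  rw [D_mk, ← mk_div, mem_bigField] at h2
  exact h2.congr' (eventually_one_le_nevFilter.mono fun r hr => T_mk _ (by linarith))
    EventuallyEq.rfl

theorem tendsto_nevT {f : ℂ → ℂ} (hlog : Real.log =o[nevFilter] nevT f) :
    Tendsto (nevT f) nevFilter atTop := by
  refine (tendsto_norm_nevFilter hlog).congr' (eventually_one_le_nevFilter.mono fun r hr => ?_)
  exact Real.norm_of_nonneg (ValueDistribution.characteristic_nonneg hr)

/-- If `f` is not differentially algebraic, no nonconstant rational function of `f` is. -/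
theorem not_isDiffAlgebraic_aeval_div {K : Subfield Mer} (hK : ∀ c : ℂ, algebraMap ℂ Mer c ∈ K)
    {x : Mer} (hx : ¬ IsDiffAlgebraic K D x) {p q : Polynomial ℂ} (hq : q ≠ 0)
    (hpq : ∀ c : ℂ, p ≠ Polynomial.C c * q) (hqx : Polynomial.aeval x q ≠ 0) :
    ¬ IsDiffAlgebraic K D (Polynomial.aeval x p / Polynomial.aeval x q) := fun h => by
  let φ : ℂ →+* K := (algebraMap ℂ Mer).codRestrict K hK
  exact hx (h.of_mem_algHull_singleton (mem_algHull_singleton_of_mul_aeval_eq φ (fun _ => rfl) hq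
    hpq (div_mul_cancel₀ _ hqx)))

theorem aeval_ne_zero_of_not_isDiffAlgebraic {x : Mer} (hx : ¬ IsDiffAlgebraic ℂ D x)
    {q : Polynomial ℂ} (hq : q ≠ 0) : Polynomial.aeval x q ≠ 0 := fun h0 => by
  refine hx ⟨∅, Set.finite_empty, by simp, ?_⟩
  exact IsAlgebraic.extendScalars (R := ℂ) (algebraMap ℂ _).injective ⟨q, hq, h0⟩

/-- The preimage of a closed discrete set under a nonconstant entire function is closed and
discrete. -/
theorem merEq_comp {u v f : ℂ → ℂ} (h : MerEq u v) (hf : Differentiable ℂ f)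
    (hfc : ∀ c, ¬ MerEq f fun _ => c) : MerEq (fun z => u (f z)) fun z => v (f z) := by
  have hfa : AnalyticOnNhd ℂ f Set.univ := fun z _ => hf.analyticAt z
  refine hfa.preimage_mem_codiscreteWithin (fun z _ hz => ?_)
    (codiscreteWithin_mono (Set.subset_univ _) h)
  obtain ⟨c, hc⟩ := eventuallyConst_iff_exists_eventuallyEq.1 hz
  refine hfc c ?_
  have h1 : Meromorphic fun w => f w - c := hf.meromorphic.sub (meromorphic_fun_const c)
  have h2 : meromorphicOrderAt (fun w => f w - c) z = ⊤ := by
    rw [meromorphicOrderAt_eq_top_iff]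
    exact (hc.filter_mono nhdsWithin_le_nhds).mono fun w hw => sub_eq_zero.2 hw
  exact (merEq_zero_of_meromorphicOrderAt_eq_top h1 h2).mono fun w hw => sub_eq_zero.1 hw

/-- A rational function `g` makes `f` algebraic over `g ∘ f`. If `g` is not rational, then `g ∘ f`
is compared with `R ∘ f`, which is small. The place of a deficiency assumption is taken by a bound for
the poles of `1 / (g ∘ f - R ∘ f)`, which are among the zeros of a polynomial in `f`. -/
theorem hypertranscendental_comp {f g : ℂ → ℂ} (hf : Differentiable ℂ f) (hg : Meromorphic g)
    (hyp : Hypertranscendental (smallFunctions fun z => deriv f z / f z) f)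
    (hgc : ¬ ∃ c : ℂ, MerEq g fun _ => c) {R : RatFunc ℂ} (hR : ∀ c : ℂ, R ≠ RatFunc.C c)
    (hfin : (merZeros fun z => g z - ratFun R z).Finite) :
    Hypertranscendental (smallFunctions fun z => deriv f z / f z) fun z => g (f z) := by
  have hfm := hyp.1
  have hFm : Meromorphic fun z => deriv f z / f z := hfm.deriv.div hfm
  have hF := isLittleO_log_nevT hFm (not_isRational_logDeriv hyp)
  have hlogf := isLittleO_log_nevT hfm (not_isRational_of_hypertranscendental hyp)
  have hDA := not_isDiffAlgebraic_of_hypertranscendental (hF := hF) hyp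
  have hDAC := not_isDiffAlgebraic_complex hyp
  have hfc : ∀ c, ¬ MerEq f fun _ => c := fun c hc =>
    not_isRational_of_hypertranscendental hyp (isRational_of_merEq_const hc)
  have hw := hg.comp_differentiable hf
  refine hypertranscendental_of_not_isDiffAlgebraic hF hw fun hwDA => ?_
  by_cases hrat : IsRational g
  · obtain ⟨p, q, hq, hpq⟩ := hrat
    obtain ⟨hp', hp⟩ := mk_polynomial_eval hfm p
    obtain ⟨hq', hqe⟩ := mk_polynomial_eval hfm q
    have h1 : mk _ hw = Polynomial.aeval (mk f hfm) p / Polynomial.aeval (mk f hfm) q := by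
      rw [← hp, ← hqe, ← mk_div, mk_eq_mk]
      exact merEq_comp hpq hf hfc
    rw [h1] at hwDA
    refine not_isDiffAlgebraic_aeval_div (fun c => algebraMap_mem_smallField c) hDA hq
      (fun c hc => hgc ⟨c, ?_⟩) (aeval_ne_zero_of_not_isDiffAlgebraic hDAC hq) hwDA
    filter_upwards [hpq, (Polynomial.finite_setOfPred_isRoot hq).compl_mem_codiscrete] with z hz h0
    rw [hz, hc, Polynomial.eval_mul, Polynomial.eval_C]
    exact mul_div_cancel_right₀ c h0
  -- now the characteristic of `g ∘ f` outgrows the one of `f`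
  have hTf : nevT f =o[nevFilter] nevT fun z => g (f z) :=
    isLittleO_of_forall_mul_le (tendsto_nevT hlogf) fun m => by
      obtain ⟨C, hC⟩ := exists_mul_characteristic_le_comp hf hg hrat m
      exact ⟨C, eventually_one_le_nevFilter.mono hC⟩
  have hT : Real.log =o[nevFilter] nevT fun z => g (f z) := hlogf.trans hTf
  have hK : smallField _ hF ≤ smallField _ hT :=
    smallField_le_smallField ((nevT_logDeriv_isBigO hfm hlogf).trans hTf.isBigO)
  have hfT : mk f hfm ∈ smallField _ hT := (mk_mem_smallField_iff hfm).2
    ⟨hfm, isNevS_iff_isLittleO.2 hTf⟩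
  have haeval : ∀ p : Polynomial ℂ, Polynomial.aeval (mk f hfm) p ∈ smallField _ hT := fun p => by
    rw [Polynomial.aeval_eq_sum_range]
    refine sum_mem fun i _ => ?_
    rw [Algebra.smul_def]
    exact mul_mem (algebraMap_mem_smallField _) (pow_mem hfT i)
  obtain ⟨hn', hn⟩ := mk_polynomial_eval hfm R.num
  obtain ⟨hd', hd⟩ := mk_polynomial_eval hfm R.denom
  have hRm : Meromorphic (ratFun R) := by
    have h1 : ratFun R = fun z => R.num.eval z / R.denom.eval z := by
      funext z
      simp [ratFun, RatFunc.eval, Polynomial.eval₂_id]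
    rw [h1]
    exact fun z => (analyticAt_polynomial_eval _ z).meromorphicAt.div
      (analyticAt_polynomial_eval _ z).meromorphicAt
  set u : Mer := Polynomial.aeval (mk f hfm) R.num / Polynomial.aeval (mk f hfm) R.denom with hu
  have hRf : mk _ (hRm.comp_differentiable hf) = u := by
    rw [hu, ← hn, ← hd, ← mk_div, mk_eq_mk]
    refine Eventually.of_forall fun z => ?_
    simp [ratFun, RatFunc.eval, Polynomial.eval₂_id]
  have huT : u ∈ smallField _ hT := div_mem (haeval _) (haeval _)
  have huDA : ¬ IsDiffAlgebraic (smallField _ hF) D u :=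
    not_isDiffAlgebraic_aeval_div (fun c => algebraMap_mem_smallField c) hDA R.denom_ne_zero
      (fun c hc => hR c (by
        rw [← RatFunc.num_div_denom R, hc, map_mul, RatFunc.algebraMap_C]
        exact mul_div_cancel_right₀ _ (RatFunc.algebraMap_ne_zero R.denom_ne_zero)))
      (aeval_ne_zero_of_not_isDiffAlgebraic hDAC R.denom_ne_zero)
  have hhT : (mk _ hw - u)⁻¹ ∈ proxRing _ hT :=
    inv_mem_proxRing_of_isDiffAlgebraic hK D_algebraMap_mem_range hwDA huDA huT
      (fun j => D_iterate_div_mem_proxRing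
        (sub_mem (mk_mem_bigField hw hT) (smallField_le_bigField huT)) j)
  -- the poles of `1 / (g ∘ f - R ∘ f)` are among the zeros of a polynomial in `f`
  have hgR : Meromorphic fun z => g z - ratFun R z := hg.sub hRm
  obtain ⟨q, hq, E, hE, hqE⟩ := exists_polynomial_mul_eventuallyEq hgR.inv (hfin.subset
    fun z hz => by
    rw [Set.mem_ofPred_eq, meromorphicOrderAt_inv] at hz
    rw [merZeros, Set.mem_ofPred_eq]
    generalize meromorphicOrderAt (fun z => g z - ratFun R z) z = o at hz
    cases o with
    | top => simp
    | coe n => norm_cast at hz ⊢; omega)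
  obtain ⟨hq', hqf⟩ := mk_polynomial_eval hfm q
  have hq0 := aeval_ne_zero_of_not_isDiffAlgebraic hDAC hq
  have hEm : Differentiable ℂ fun z => E (f z) := hE.comp hf
  have hh : (mk _ hw - u)⁻¹ = mk _ hEm.meromorphic * (Polynomial.aeval (mk f hfm) q)⁻¹ := by
    rw [eq_mul_inv_iff_mul_eq₀ hq0, ← hRf, ← hqf, ← mk_sub, ← mk_inv, ← mk_mul, mk_eq_mk]
    filter_upwards [merEq_comp hqE hf hfc] with z hz
    rw [← hz, mul_comm]
    rfl
  have hmem : (mk _ hw - u)⁻¹ ∈ smallField _ hT := by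
    rcases eq_or_ne (mk _ hEm.meromorphic) 0 with h0 | h0
    · rw [hh, h0, zero_mul]; exact zero_mem _
    have hN : ∀ᶠ r in nevFilter, (mk _ hw - u)⁻¹.T r
        ≤ (mk _ hw - u)⁻¹.m r + (Polynomial.aeval (mk f hfm) q)⁻¹.T r := by
      filter_upwards [eventually_one_le_nevFilter] with r hr
      have h1 := N_mul_le h0 (inv_ne_zero hq0) hr
      rw [← hh, N_mk_eq_zero_of_differentiable hEm, Pi.zero_apply, zero_add] at h1
      rw [T_eq, T_eq]
      linarith [(Polynomial.aeval (mk f hfm) q)⁻¹.m_nonneg r]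
    exact isLittleO_of_eventually_le (eventually_T_nonneg _) hN
      ((mem_proxRing.1 hhT).add (mem_smallField.1 (inv_mem (haeval q))))
  refine mk_not_mem_smallField hw (hT := hT) ?_
  have h3 := add_mem (inv_mem hmem) huT
  rwa [inv_inv, sub_add_cancel] at h3

/-- `f g` is compared with `f a`. -/
theorem hypertranscendental_mul {f g : ℂ → ℂ} (hg : Meromorphic g)
    (hyp : Hypertranscendental (smallFunctions fun z => deriv f z / f z) f)
    (hfg : f ∈ smallFunctions g) {a : ℂ → ℂ} (ha : a ∈ smallFunctions fun z => deriv f z / f z)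
    (ha0 : ¬ MerEq a 0) (hdef : 0 < deficiency a g) :
    Hypertranscendental (smallFunctions fun z => deriv f z / f z) fun z => f z * g z := by
  have hfm := hyp.1
  have hFm : Meromorphic fun z => deriv f z / f z := hfm.deriv.div hfm
  have hF := isLittleO_log_nevT hFm (not_isRational_logDeriv hyp)
  have hlogf := isLittleO_log_nevT hfm (not_isRational_of_hypertranscendental hyp)
  have hTf := isNevS_iff_isLittleO.1 hfg.2
  have hT := hlogf.trans hTf
  have hK : smallField _ hF ≤ smallField _ hT :=
    smallField_le_smallField ((nevT_logDeriv_isBigO hfm hlogf).trans hTf.isBigO)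
  have haK := (mk_mem_smallField_iff (hF := hF) ha.1).2 ha
  have hfT : mk f hfm ∈ smallField _ hT := (mk_mem_smallField_iff hfm).2 hfg
  have hf0 := mk_ne_zero_of_hypertranscendental hyp
  have ha0' : mk a ha.1 ≠ 0 := fun h => ha0 (mk_eq_zero.1 h)
  refine hypertranscendental_of_not_isDiffAlgebraic hF (hfm.mul hg) fun hwDA => ?_
  refine absurd hdef (not_lt.2 (deficiency_le_zero ha.1 hg (hT := hT) ?_))
  refine inv_mem_proxRing_of_isDiffAlgebraic (u := mk f hfm * mk a ha.1) hK D_algebraMap_mem_range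
    hwDA (fun h => ?_) (mul_mem hfT (hK haK)) fun j => ?_
  · refine not_isDiffAlgebraic_of_hypertranscendental (hF := hF) hyp ?_
    have h1 := h.div (.of_algebraMap (⟨_, haK⟩ : smallField _ hF))
    change IsDiffAlgebraic _ D (mk f hfm * mk a ha.1 / mk a ha.1) at h1
    rwa [mul_div_cancel_right₀ _ ha0'] at h1
  · change D^[j] (mk f hfm * mk g hg - _) / _ ∈ _
    rw [← mul_sub]
    have h1 : mk f hfm * (mk g hg - mk a ha.1) ∈ bigField _ hT :=
      mul_mem (smallField_le_bigField hfT)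
        (sub_mem (mk_mem_bigField hg hT) (smallField_le_bigField (hK haK)))
    have h2 := mul_mem (D_iterate_div_mem_proxRing h1 j) (mem_proxRing_of_mem_smallField hfT)
    rwa [mul_comm (mk f hfm), ← div_div, div_mul_cancel₀ _ hf0, mul_comm] at h2

/-- The `k`-th derivative of `f + g` is compared with `f^(k) + a`. -/
theorem hypertranscendental_add {f g : ℂ → ℂ} (hg : Meromorphic g)
    (hyp : Hypertranscendental (smallFunctions fun z => deriv f z / f z) f) {k : ℕ}
    (hfg : IsNevS (nevT f) (iteratedDeriv k g)) {a : ℂ → ℂ}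
    (ha : a ∈ smallFunctions fun z => deriv f z / f z)
    (hdef : 0 < deficiency a (iteratedDeriv k g)) :
    Hypertranscendental (smallFunctions fun z => deriv f z / f z) fun z => f z + g z := by
  have hfm := hyp.1
  have hFm : Meromorphic fun z => deriv f z / f z := hfm.deriv.div hfm
  have hF := isLittleO_log_nevT hFm (not_isRational_logDeriv hyp)
  have hlogf := isLittleO_log_nevT hfm (not_isRational_of_hypertranscendental hyp)
  have hTf := isNevS_iff_isLittleO.1 hfg
  have hT := hlogf.trans hTf
  have hK : smallField _ hF ≤ smallField _ hT :=
    smallField_le_smallField ((nevT_logDeriv_isBigO hfm hlogf).trans hTf.isBigO)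
  have haK := (mk_mem_smallField_iff (hF := hF) ha.1).2 ha
  have hfT : mk f hfm ∈ smallField _ hT := (mk_mem_smallField_iff hfm).2 ⟨hfm, hfg⟩
  have hGm := meromorphic_iteratedDeriv hg k
  refine hypertranscendental_of_not_isDiffAlgebraic hF (hfm.add hg) fun hwDA => ?_
  refine absurd hdef (not_lt.2 (deficiency_le_zero ha.1 hGm (hT := hT) ?_))
  refine inv_mem_proxRing_of_isDiffAlgebraic (u := D^[k] (mk f hfm) + mk a ha.1) hK
    D_algebraMap_mem_range (hwDA.iterate D_algebraMap_mem_range k) (fun h => ?_)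
    (add_mem (D_iterate_mem_smallField hfT k) (hK haK)) fun j => ?_
  · refine not_isDiffAlgebraic_of_hypertranscendental (hF := hF) hyp (.of_iterate k ?_)
    have h1 := h.sub (.of_algebraMap (⟨_, haK⟩ : smallField _ hF))
    change IsDiffAlgebraic _ D (D^[k] (mk f hfm) + mk a ha.1 - mk a ha.1) at h1
    rwa [add_sub_cancel_right] at h1
  · change D^[j] (D^[k] (mk f hfm + mk g hg) - _) / _ ∈ _
    rw [D_iterate_add, add_sub_add_left_eq_sub, D_iterate_mk hg]
    exact D_iterate_div_mem_proxRing
      (sub_mem (mk_mem_bigField hGm hT) (smallField_le_bigField (hK haK))) j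

/-! ### Multiplication by exponentials -/

namespace Mer

theorem D_mk_exp {g : ℂ → ℂ} (hg : Differentiable ℂ g) :
    D (mk (fun z => Complex.exp (g z)) hg.cexp.meromorphic)
      = mk (fun z => Complex.exp (g z)) hg.cexp.meromorphic * D (mk g hg.meromorphic) := by
  rw [D_mk, D_mk, ← mk_mul, mk_eq_mk]
  exact Eventually.of_forall fun z => (hg z).hasDerivAt.cexp.deriv

theorem mk_exp_ne_zero {g : ℂ → ℂ} (hg : Differentiable ℂ g) :
    mk (fun z => Complex.exp (g z)) hg.cexp.meromorphic ≠ 0 := by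
  intro h
  obtain ⟨z, hz⟩ := (eventually_nhdsNE_of_codiscrete (mk_eq_zero.1 h) 0).exists
  exact Complex.exp_ne_zero _ hz

theorem aeval_map_inclusion {K L : Subfield Mer} (h : K ≤ L) (x : ℕ → Mer) (Q : MvPolynomial ℕ K) :
    MvPolynomial.aeval x (Q.map (Subfield.inclusion h)) = MvPolynomial.aeval x Q := by
  rw [MvPolynomial.aeval_def, MvPolynomial.eval₂_map, MvPolynomial.aeval_def]
  congr 1

variable {T : ℝ → ℝ} {hT : Real.log =o[nevFilter] T}

theorem mem_smallField_of_N_eq_zero {x : Mer} (hN : x.N = 0) (hx : x ∈ proxRing T hT) :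
    x ∈ smallField T hT := by
  refine (mem_proxRing.1 hx).congr_left fun r => ?_
  rw [T_eq, hN]
  simp

/-- A function without zeros that is not small is transcendental over the small functions. -/
theorem transcendental_of_N_inv_eq_zero {x : Mer} (hN : x⁻¹.N = 0) (hx : x ∉ smallField T hT) :
    Transcendental (smallField T hT) x := fun hal => by
  have hx0 : x ≠ 0 := fun h => hx (h ▸ zero_mem _)
  have h1 : x⁻¹ ∈ proxRing T hT := by
    refine inv_mem_proxRing_of_aeval le_rfl
      (Polynomial.aeval (MvPolynomial.X 0) (minpoly (smallField T hT) x)) (x := fun _ => x)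
      (y := fun _ => 0) (l := fun _ => 1) hx0 (fun _ => zero_mem _) (fun _ => one_mem _)
      (fun _ => by rw [mul_one, zero_add]) ?_ ?_
    · rw [← Polynomial.aeval_algHom_apply, MvPolynomial.aeval_X, minpoly.aeval]
    · rw [← Polynomial.aeval_algHom_apply, MvPolynomial.aeval_X, ← Polynomial.coeff_zero_eq_aeval_zero',
        Ne, map_eq_zero_iff _ (algebraMap (smallField T hT) Mer).injective]
      exact minpoly.coeff_zero_ne_zero hal.isIntegral hx0
  have h2 := inv_mem (mem_smallField_of_N_eq_zero hN h1)
  rw [inv_inv] at h2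
  exact hx h2

theorem D_iterate_div_mem_smallField {x : Mer} (hx : D x / x ∈ smallField T hT) (hx0 : x ≠ 0)
    (j : ℕ) : D^[j] x / x ∈ smallField T hT := by
  induction j with
  | zero => rw [Function.iterate_zero_apply, div_self hx0]; exact one_mem _
  | succ j ih =>
    have h1 : D^[j + 1] x / x = D (D^[j] x / x) + D^[j] x / x * (D x / x) := by
      have h2 : D (D^[j] x) = D (x * (D^[j] x / x)) := by rw [mul_div_cancel₀ _ hx0]
      rw [Function.iterate_succ_apply', h2, Derivation.leibniz, smul_eq_mul, smul_eq_mul]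
      field_simp
    rw [h1]
    exact add_mem (D_mem_smallField ih) (mul_mem ih hx)

/-- The ratios `D^[j] (x * e) / (x * e)` are small, so that every term of a distinguished
differential polynomial is a small multiple of its own power of `e`. -/
theorem aeval_ne_zero_of_distinguished {x e : Mer} (hx : x ∈ smallField T hT) (hx0 : x ≠ 0)
    (he : Transcendental (smallField T hT) e) (hDe : D e / e ∈ smallField T hT)
    {Q : MvPolynomial ℕ (smallField T hT)} (hQ0 : Q ≠ 0)
    (hQ : ∀ I J, Q.coeff I ≠ 0 → Q.coeff J ≠ 0 → I ≠ J → I.degree ≠ J.degree) :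
    MvPolynomial.aeval (fun j => D^[j] (x * e)) Q ≠ 0 := fun h0 => by
  have he_small : e ∉ smallField T hT := fun h =>
    he (isAlgebraic_algebraMap (⟨e, h⟩ : smallField T hT))
  have he0 : e ≠ 0 := fun h => he_small (h ▸ zero_mem _)
  set w := x * e with hw
  have hw0 : w ≠ 0 := mul_ne_zero hx0 he0
  have hDw : D w / w ∈ smallField T hT := by
    have h1 : D w / w = D x / x + D e / e := by
      rw [hw, Derivation.leibniz, smul_eq_mul, smul_eq_mul]
      field_simp
      ring
    rw [h1]
    exact add_mem (div_mem (D_mem_smallField hx) hx) hDe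
  have hb := D_iterate_div_mem_smallField hDw hw0
  let β : ℕ → smallField T hT := fun j => ⟨_, mul_mem (hb j) hx⟩
  -- `Q` as a polynomial in `e`
  let A : Polynomial (smallField T hT) :=
    MvPolynomial.aeval (fun j => Polynomial.C (β j) * Polynomial.X) Q
  have hA : A = 0 := by
    by_contra hA
    refine he ⟨A, hA, ?_⟩
    change Polynomial.aeval e (MvPolynomial.aeval _ Q) = 0
    rw [MvPolynomial.comp_aeval_apply, ← h0]
    congr 2
    funext j
    rw [map_mul, Polynomial.aeval_C, Polynomial.aeval_X]
    change D^[j] w / w * x * e = D^[j] w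
    rw [mul_assoc, ← hw, div_mul_cancel₀ _ hw0]
  have hAsum : A = ∑ J ∈ Q.support,
      Polynomial.C (Q.coeff J * ∏ j ∈ J.support, β j ^ J j) * Polynomial.X ^ J.degree := by
    rw [show A = _ from MvPolynomial.aeval_def _ _, MvPolynomial.eval₂_eq]
    refine Finset.sum_congr rfl fun J _ => ?_
    simp_rw [mul_pow]
    rw [Finset.prod_mul_distrib, Finset.prod_pow_eq_pow_sum, map_mul, map_prod, ← mul_assoc]
    simp_rw [map_pow]
    rfl
  obtain ⟨I, hI⟩ := MvPolynomial.ne_zero_iff.1 hQ0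
  have hcoeff : A.coeff I.degree = Q.coeff I * ∏ j ∈ I.support, β j ^ I j := by
    rw [hAsum, Polynomial.finsetSum_coeff, Finset.sum_eq_single I]
    · rw [Polynomial.coeff_C_mul_X_pow, if_pos rfl]
    · intro J hJ hJI
      rw [Polynomial.coeff_C_mul_X_pow,
        if_neg (hQ I J hI (MvPolynomial.mem_support_iff.1 hJ) hJI.symm)]
    · intro h
      exact absurd (MvPolynomial.mem_support_iff.2 hI) h
  rw [hA, Polynomial.coeff_zero, eq_comm, mul_eq_zero_iff_left hI, Finset.prod_eq_zero_iff] at hcoeff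
  obtain ⟨j, _, hj⟩ := hcoeff
  have hj0 : ∃ j, D^[j] w = 0 := by
    refine ⟨j, ?_⟩
    have h1 : D^[j] w / w * x = 0 := congrArg Subtype.val (eq_zero_of_pow_eq_zero hj)
    simpa [hx0, hw0] using h1
  -- if a derivative of `w` vanishes, then the last one that does not is a constant
  classical
  obtain ⟨i, hi⟩ : ∃ i, Nat.find hj0 = i + 1 :=
    Nat.exists_eq_succ_of_ne_zero fun h => hw0 ((Nat.find_eq_zero hj0).1 h)
  have hi1 : D (D^[i] w) = 0 := by
    have h1 := Nat.find_spec hj0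
    rwa [hi, Function.iterate_succ_apply'] at h1
  have hi2 : D^[i] w ≠ 0 := Nat.find_min hj0 (by omega)
  obtain ⟨c, hc⟩ := exists_algebraMap_eq_of_D_eq_zero hi1
  have hws : w ∈ smallField T hT := by
    have h1 := div_mem (algebraMap_mem_smallField c) (hb i)
    rwa [← hc, div_div_cancel₀ hi2] at h1
  have h1 := div_mem hws hx
  rw [hw, mul_div_cancel_left₀ _ hx0] at h1
  exact he_small h1

end Mer

open Mer

/-- The `k`-th derivative of the logarithmic derivative of `f e^g` is compared with
`(f' / f)^(k) + a'`. -/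
theorem hypertranscendental_mul_exp {f g : ℂ → ℂ} (hg : Differentiable ℂ g)
    (hyp : Hypertranscendental (smallFunctions fun z => deriv f z / f z) f) {k : ℕ}
    (hFg : IsNevS (nevT fun z => deriv f z / f z) (iteratedDeriv k g)) {a : ℂ → ℂ}
    (ha : a ∈ smallFunctions fun z => deriv f z / f z)
    (hdef : 0 < deficiency a (iteratedDeriv k g)) :
    Hypertranscendental (smallFunctions fun z => deriv f z / f z)
      fun z => f z * Complex.exp (g z) := by
  have hfm := hyp.1
  have hFm : Meromorphic fun z => deriv f z / f z := hfm.deriv.div hfm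
  have hF := isLittleO_log_nevT hFm (not_isRational_logDeriv hyp)
  have hTF := isNevS_iff_isLittleO.1 hFg
  have hT := hF.trans hTF
  have hK : smallField _ hF ≤ smallField _ hT := smallField_le_smallField hTF.isBigO
  have haK := (mk_mem_smallField_iff (hF := hF) ha.1).2 ha
  have hFT : D (mk f hfm) / mk f hfm ∈ smallField _ hT := by
    rw [D_mk, ← mk_div]
    exact (mk_mem_smallField_iff hFm).2 ⟨hFm, hFg⟩
  have hf0 := mk_ne_zero_of_hypertranscendental hyp
  have he0 := mk_exp_ne_zero hg
  have hGm := meromorphic_iteratedDeriv hg.meromorphic k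
  refine hypertranscendental_of_not_isDiffAlgebraic hF (hfm.mul hg.cexp.meromorphic) fun hwDA => ?_
  refine absurd hdef (not_lt.2 (deficiency_le_zero ha.1 hGm (hT := hT) ?_))
  have hv := ((hwDA.derivation D_algebraMap_mem_range).div hwDA).iterate D_algebraMap_mem_range k
  have hlog : D (mk f hfm * mk _ hg.cexp.meromorphic) / (mk f hfm * mk _ hg.cexp.meromorphic)
      = D (mk f hfm) / mk f hfm + D (mk g hg.meromorphic) := by
    rw [Derivation.leibniz, D_mk_exp hg, smul_eq_mul, smul_eq_mul]
    field_simp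
    ring
  have hmul : mk (fun z => f z * Complex.exp (g z)) (hfm.mul hg.cexp.meromorphic)
      = mk f hfm * mk _ hg.cexp.meromorphic := mk_mul hfm hg.cexp.meromorphic
  rw [hmul, hlog, D_iterate_add, ← Function.iterate_succ_apply,
    Function.iterate_succ_apply', D_iterate_mk hg.meromorphic] at hv
  refine inv_mem_proxRing_of_isDiffAlgebraic
    (u := D^[k] (D (mk f hfm) / mk f hfm) + D (mk a ha.1)) hK D_algebraMap_mem_range hv (fun h => ?_)
    (add_mem (D_iterate_mem_smallField hFT k) (D_mem_smallField (hK haK))) fun j => ?_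
  · refine not_isDiffAlgebraic_of_hypertranscendental (hF := hF) hyp
      (.of_logDeriv hf0 (.of_iterate k ?_))
    have h1 := h.sub (.of_algebraMap (⟨_, D_mem_smallField haK⟩ : smallField _ hF))
    change IsDiffAlgebraic _ D (_ + D (mk a ha.1) - D (mk a ha.1)) at h1
    rwa [add_sub_cancel_right] at h1
  · rw [add_sub_add_left_eq_sub, ← map_sub, ← Function.iterate_succ_apply]
    exact D_iterate_div_mem_proxRing
      (sub_mem (mk_mem_bigField hGm hT) (smallField_le_bigField (hK haK))) (j + 1)

theorem evalDiff_mul_exp_ne_zero {f g : ℂ → ℂ} (hg : Differentiable ℂ g)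
    (hyp : Hypertranscendental (smallFunctions fun z => deriv f z / f z) f)
    (hfg : f ∈ smallFunctions fun z => Complex.exp (g z)) {P : MvPolynomial ℕ (ℂ → ℂ)}
    (hP : HasCoeffsIn (smallFunctions fun z => deriv f z / f z) P) (hP0 : IsNontrivialPoly P)
    (hPd : IsDistinguished P) : ¬ MerEq (evalDiff P fun z => f z * Complex.exp (g z)) 0 := fun h0 => by
  have hfm := hyp.1
  have hFm : Meromorphic fun z => deriv f z / f z := hfm.deriv.div hfm
  have hF := isLittleO_log_nevT hFm (not_isRational_logDeriv hyp)
  have hlogf := isLittleO_log_nevT hfm (not_isRational_of_hypertranscendental hyp)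
  have hTf := isNevS_iff_isLittleO.1 hfg.2
  have hT := hlogf.trans hTf
  have hK : smallField _ hF ≤ smallField _ hT :=
    smallField_le_smallField ((nevT_logDeriv_isBigO hfm hlogf).trans hTf.isBigO)
  have he0 := mk_exp_ne_zero hg
  have hinv : (mk _ hg.cexp.meromorphic)⁻¹.N = 0 := by
    have h1 : (mk _ hg.cexp.meromorphic)⁻¹ = mk _ hg.neg.cexp.meromorphic := by
      rw [← mk_inv, mk_eq_mk]
      exact Eventually.of_forall fun z => (Complex.exp_neg (g z)).symm
    rw [h1]
    exact N_mk_eq_zero_of_differentiable hg.neg.cexp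
  have hDe : D (mk _ hg.cexp.meromorphic) / mk _ hg.cexp.meromorphic ∈ smallField _ hT := by
    refine mem_smallField_of_N_eq_zero ?_ (D_div_mem_proxRing (mk_mem_bigField _ hT))
    rw [D_mk_exp hg, mul_div_cancel_left₀ _ he0, D_mk]
    exact N_mk_eq_zero_of_differentiable (Differentiable.deriv hg)
  obtain ⟨Q, hQ, hQ0⟩ := exists_mvPolynomial_smallField (hF := hF) hP
    (hfm.mul hg.cexp.meromorphic) h0
  let i := Subfield.inclusion hK
  have hcoeff : ∀ I, (Q.map i).coeff I ≠ 0 → ¬ MerEq (P.coeff I) 0 := fun I hI h =>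
    hI (by rw [MvPolynomial.coeff_map, (hQ I).2 h, map_zero])
  obtain ⟨I, hI⟩ := hP0
  refine aeval_ne_zero_of_distinguished ((mk_mem_smallField_iff hfm).2 hfg)
    (mk_ne_zero_of_hypertranscendental hyp)
    (transcendental_of_N_inv_eq_zero hinv (mk_not_mem_smallField _ (hT := hT))) hDe
    (Q := Q.map i) (fun h => hI ((hQ I).1 ?_))
    (fun I J hI hJ => hPd I J (hcoeff I hI) (hcoeff J hJ)) ?_
  · have h1 := congrArg (MvPolynomial.coeff I) h
    rwa [MvPolynomial.coeff_map, MvPolynomial.coeff_zero, map_eq_zero_iff _ i.injective] at h1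
  · rw [mk_mul hfm hg.cexp.meromorphic] at hQ0
    rw [aeval_map_inclusion, hQ0]

theorem mainTheorem1 (f g : ℂ → ℂ) (hf : Meromorphic f) (hg : Meromorphic g)
    (S : Set (ℂ → ℂ)) (hS : S = smallFunctions (fun z => deriv f z / f z))
    (hyp : Hypertranscendental S f) :
    -- (1)
    (Differentiable ℂ f → (¬ ∃ c : ℂ, MerEq g (fun _ => c)) →
      (∃ R : RatFunc ℂ, (∀ c : ℂ, R ≠ RatFunc.C c) ∧
        (merZeros (fun z => g z - ratFun R z)).Finite) →
      Hypertranscendental S (fun z => g (f z))) ∧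
    -- (2)
    (f ∈ smallFunctions g →
      (∃ a ∈ S, ¬ MerEq a 0 ∧ 0 < deficiency a g) →
      Hypertranscendental S (fun z => f z * g z)) ∧
    -- (3)
    ((∃ k : ℕ, IsNevS (nevT f) (iteratedDeriv k g) ∧
        ∃ a ∈ S, 0 < deficiency a (iteratedDeriv k g)) →
      Hypertranscendental S (fun z => f z + g z)) ∧
    -- (4)
    (Differentiable ℂ g →
      (∃ k : ℕ, IsNevS (nevT (fun z => deriv f z / f z)) (iteratedDeriv k g) ∧
        ∃ a ∈ S, 0 < deficiency a (iteratedDeriv k g)) →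
      Hypertranscendental S (fun z => f z * Complex.exp (g z))) ∧
    -- (5)
    (Differentiable ℂ g → f ∈ smallFunctions (fun z => Complex.exp (g z)) →
      ∀ P : MvPolynomial ℕ (ℂ → ℂ), HasCoeffsIn S P → IsNontrivialPoly P → IsDistinguished P →
        ¬ MerEq (evalDiff P (fun z => f z * Complex.exp (g z))) 0) := by
  subst hS
  refine ⟨fun hfe hgc ⟨R, hR, hfin⟩ => hypertranscendental_comp hfe hg hyp hgc hR hfin, ?_⟩
  refine ⟨fun hfg ⟨a, ha, ha0, hdef⟩ => hypertranscendental_mul hg hyp hfg ha ha0 hdef, ?_⟩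
  refine ⟨fun ⟨k, hfg, a, ha, hdef⟩ => hypertranscendental_add hg hyp hfg ha hdef, ?_⟩
  exact ⟨fun hge ⟨k, hFg, a, ha, hdef⟩ => hypertranscendental_mul_exp hge hyp hFg ha hdef,
    fun hge hfg P hP hP0 hPd => evalDiff_mul_exp_ne_zero hge hyp hfg hP hP0 hPd⟩
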